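/- Let $\mathfrak g$ be a complex simple Lie algebra with a basis $(X_a)$ such that $[X_a,X_b]=i\sum_c\Gamma_{ab}^cX_c$ with $\Gamma_{ab}^c\in\mathbb R$ totally antisymmetric, let $g$ be half the eigenvalue of $\sum_a(\mathrm{ad}\,X_a)^2$ on $\mathfrak g$ (the dual Coxeter number when $\sum_aX_a^2$ is the normalized Casimir), let $\ell\in\mathbb N$ and $d=\ell+g$. Let $L(V_0,\ell)$ be the irreducible vacuum representation of level $\ell$ of the boson algebra $[X^a_m,X^b_n]=i\sum_c\Gamma_{ab}^cX^c_{m+n}+m\,\delta_{ab}\delta_{m+n}\mathcal L$ ($m,n\in\mathbb Z$, $\mathcal L$ central), i.e. the quotient by its maximal proper submodule of the module generated by $\Omega$ with $X^a_n\Omega=0$ for $n\ge0$ and $\mathcal L\Omega=\ell\Omega$. Let $\mathcal F$ be the Fock space of the fermion algebra $[\psi^a_r,\psi^b_s]_+=\delta_{ab}\delta_{r+s}$ ($r,s\in\mathbb Z+\frac12$), generated by $\Omega$ with $\psi^a_r\Omega=0$ for $r>0$. Put $H=L(V_0,\ell)\otimes\mathcal F$, with vacuum vector $\Omega=\Omega\otimes\Omega$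 and fields $X^a(z)=\sum_{n\in\mathbb Z}X^a_nz^{-n-1}$ and $\psi^a(z)=\sum_{n\in\mathbb Z}\psi^a_{n+1/2}z^{-n-1}$. For fields $A(z)=\sum_{n\in\mathbb Z} A(n)z^{-n-1}$ and $B$ on $H$ that are local with parity $\varepsilon\in\mathbb Z/2$, i.e. $(z-w)^NA(z)B(w)=(-1)^\varepsilon(z-w)^NB(w)A(z)$ for some $N\in\mathbb N$, let $A_nB$ ($n\in\mathbb Z$) be the field with $$(A_nB)(m)=\sum_{p\ge0}(-1)^p\binom np\bigl(A(n-p)B(m+p)-(-1)^{\varepsilon+n}B(m+n-p)A(p)\bigr),$$ and write $A(z)B(w)\sim\sum_{n=0}^{N-1}\frac{(A_nB)(w)}{(z-w)^{n+1}}$. Let $\mathcal S$ be the linear span of the smallest set of fields that contains $\mathrm{Id}$ and all $X^a$, $\psi^a$ and is stable under $(A,B)\mapsto A_nB$ (for local $A,B$ and $n\in\mathbb Z$) and $A\mapsto A'=\frac{d}{dz}A$. Then $A\mapsto A(-1)\Omega$ is a bijection $\mathcal S\to H$; let $V:H\to\mathcal S$ be its inverse (the state-field correspondence). Put $$S^c=V\Bigl(-\tfrac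 i2\sum_{a,b}\Gamma_{ab}^c\,\psi^a_{-1/2}\psi^b_{-1/2}\Omega\Bigr)=\sum_{n\in\mathbb Z} S^c_nz^{-n-1},\qquad B^a=X^a+S^a=\sum_{n\in\mathbb Z} B^a_nz^{-n-1},$$ $$\tau=d^{-1/2}\sum_a\psi^a_{-1/2}\bigl(X^a_{-1}+\tfrac13S^a_{-1}\bigr)\Omega,\qquad G=V(\tau)=\sum_{n\in\mathbb Z}G_{n-1/2}z^{-n-1}.$$ Then, for every $a$, $$B^a(z)G(w)\sim d^{1/2}\frac{\psi^a(w)}{(z-w)^2}\ \ (\varepsilon=0),\qquad \psi^a(z)G(w)\sim d^{-1/2}\frac{B^a(w)}{z-w}\ \ (\varepsilon=1),$$ and $$[G_r,B^a_n]=-n\,d^{1/2}\,\psi^a_{r+n},\qquad [G_r,\psi^a_s]_+=d^{-1/2}B^a_{r+s}\qquad(r,s\in\mathbb Z+\tfrac12,\ n\in\mathbb Z).$$ -/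

import Mathlib

open scoped TensorProduct VertexOperator

noncomputable section

namespace SuperVertex

/-! ### Fields: formal series `A(z) = ∑ A(n) z^{-n-1}` with `A(n) c = 0` for `n` large

The coefficient `A(n)` of `A : VertexOperator ℂ H` is `A[[n]]`. -/

section Fields

variable {H : Type*} [AddCommGroup H] [Module ℂ H]

theorem exists_ncoeff_eq_zero (A : VertexOperator ℂ H) (c : H) :
    ∃ N : ℤ, ∀ n, N ≤ n → (A[[n]]) c = 0 := by
  refine ⟨-((HahnModule.of ℂ).symm (A c)).order, fun n hn => ?_⟩
  exact VertexOperator.ncoeff_eq_zero_of_lt_order A n c (by omega)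

/-- The field `∑ f(n) z^{-n-1}` with prescribed coefficients. -/
def mkField (f : ℤ → Module.End ℂ H) (hf : ∀ c, ∃ N : ℤ, ∀ n, N ≤ n → f n c = 0) :
    VertexOperator ℂ H :=
  VertexOperator.of_coeff (fun k => f (-k - 1)) (by
    intro c
    obtain ⟨N, hN⟩ := hf c
    refine ⟨-N, fun k hk => ?_⟩
    by_contra hlt
    exact hk (hN _ (by omega)))

@[simp]
theorem ncoeff_mkField (f : ℤ → Module.End ℂ H)
    (hf : ∀ c, ∃ N : ℤ, ∀ n, N ≤ n → f n c = 0) (n : ℤ) : (mkField f hf)[[n]] = f n := by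
  rw [mkField, VertexOperator.ncoeff_of_coeff]
  congr 1
  ring

theorem field_ext {A B : VertexOperator ℂ H} (h : ∀ n, A[[n]] = B[[n]]) : A = B := by
  apply HVertexOperator.coeff_inj
  funext k
  have := h (-k - 1)
  rw [VertexOperator.ncoeff_apply, VertexOperator.ncoeff_apply] at this
  simpa using this

/-- The identity field `Id`. -/
def idField (H : Type*) [AddCommGroup H] [Module ℂ H] : VertexOperator ℂ H :=
  mkField (fun n => if n = -1 then 1 else 0) (fun c => ⟨0, fun n hn => by
    rw [if_neg (by omega)]; rfl⟩)

/-- The derivative `A'(z) = ∑ (-n) A(n-1) z^{-n-1}`. -/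
def derivField (A : VertexOperator ℂ H) : VertexOperator ℂ H :=
  mkField (fun n => (-n : ℂ) • A[[n - 1]]) (fun c => by
    obtain ⟨N, hN⟩ := exists_ncoeff_eq_zero A c
    refine ⟨N + 1, fun n hn => ?_⟩
    rw [LinearMap.smul_apply, hN _ (by omega), smul_zero])

/-- The sign `(-1)^ε` for `ε ∈ ℤ/2`. -/
def parSign (ε : ZMod 2) : ℂ := (-1) ^ ε.val

/-- `[S, T]_ε = S T - (-1)^ε T S`: the commutator for `ε = 0`, the anticommutator for `ε = 1`. -/
def superBracket (ε : ZMod 2) (S T : Module.End ℂ H) : Module.End ℂ H :=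
  S * T - parSign ε • (T * S)

/-- Locality of order `N` and parity `ε`:
`(z - w)^N A(z) B(w) = (-1)^ε (z - w)^N B(w) A(z)`, coefficient by coefficient. -/
def IsLocal (ε : ZMod 2) (N : ℕ) (A B : VertexOperator ℂ H) : Prop :=
  ∀ m n : ℤ,
    ∑ k ∈ Finset.range (N + 1), ((-1) ^ k * (N.choose k : ℂ)) •
        superBracket ε (A[[m + (N - k)]]) (B[[n + k]]) = 0

/-- The `p`-th summand of `(A_n B)(m)`.  As `(-1)^p * Ring.choose n p` vanishes for `p > n ≥ 0` and
equals the binomial coefficient of `p - n - 1` over `p` for `n < 0`, the sum over all `p` is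
`∑_{p ≤ n} (-1)^p (n choose p) [A(n-p), B(m+p)]_ε` for `n ≥ 0` (reverse the order of summation in
the second term), and
`∑_{p ≥ 0} (p-n-1 choose p) (A(n-p) B(m+p) - (-1)^{ε+n} B(m+n-p) A(p))` for `n < 0`. -/
def nthProductTerm (ε : ZMod 2) (n : ℤ) (A B : VertexOperator ℂ H) (m : ℤ) (p : ℕ) :
    Module.End ℂ H :=
  ((-1) ^ p * ((Ring.choose n p : ℤ) : ℂ)) •
    (A[[n - p]] * B[[m + p]] - (parSign ε * (-1) ^ n) • (B[[m + n - p]] * A[[(p : ℤ)]]))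

theorem nthProductTerm_support_finite (ε : ZMod 2) (n : ℤ) (A B : VertexOperator ℂ H) (m : ℤ)
    (c : H) : (Function.support fun p : ℕ => nthProductTerm ε n A B m p c).Finite := by
  obtain ⟨N₁, h₁⟩ := exists_ncoeff_eq_zero A c
  obtain ⟨N₂, h₂⟩ := exists_ncoeff_eq_zero B c
  refine (Set.finite_lt_nat (max N₁.toNat (N₂ - m).toNat)).subset fun p hp => ?_
  by_contra hlt
  simp only [Set.mem_ofPred_eq, not_lt] at hlt
  apply hp
  simp only [nthProductTerm, LinearMap.smul_apply, LinearMap.sub_apply, Module.End.mul_apply]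
  rw [h₁ p (by omega), h₂ (m + p) (by omega)]
  simp

/-- The coefficient `(A_n B)(m)`; on each vector only finitely many summands are nonzero. -/
def nthProductCoeff (ε : ZMod 2) (n : ℤ) (A B : VertexOperator ℂ H) (m : ℤ) :
    Module.End ℂ H where
  toFun c := ∑ᶠ p : ℕ, nthProductTerm ε n A B m p c
  map_add' c c' := by
    simp only [map_add]
    exact finsum_add_distrib (nthProductTerm_support_finite ε n A B m c)
      (nthProductTerm_support_finite ε n A B m c')
  map_smul' r c := by
    simp only [map_smul, RingHom.id_apply]
    exact (smul_finsum r _).symm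

theorem nthProductCoeff_truncated (ε : ZMod 2) (n : ℤ) (A B : VertexOperator ℂ H) (c : H) :
    ∃ N : ℤ, ∀ m, N ≤ m → nthProductCoeff ε n A B m c = 0 := by
  obtain ⟨N₁, h₁⟩ := exists_ncoeff_eq_zero A c
  obtain ⟨N₂, h₂⟩ := exists_ncoeff_eq_zero B c
  choose M hM using fun p : ℕ => exists_ncoeff_eq_zero B ((A[[(p : ℤ)]]) c)
  refine ⟨max N₂ (∑ p ∈ Finset.range N₁.toNat, |M p - n + p|), fun m hm => ?_⟩
  refine finsum_eq_zero_of_forall_eq_zero fun p => ?_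
  simp only [nthProductTerm, LinearMap.smul_apply, LinearMap.sub_apply, Module.End.mul_apply]
  rw [h₂ (m + p) (by have := le_max_left N₂ (∑ p ∈ Finset.range N₁.toNat, |M p - n + p|); omega)]
  have hz : (B[[m + n - p]]) ((A[[(p : ℤ)]]) c) = 0 := by
    by_cases hp : N₁ ≤ p
    · rw [h₁ p hp, map_zero]
    · apply hM
      have h := Finset.single_le_sum (f := fun p : ℕ => |M p - n + p|)
        (fun i _ => abs_nonneg _) (Finset.mem_range.2 (show p < N₁.toNat by omega))
      have h' := le_abs_self (M p - n + p)
      have h'' := le_max_right N₂ (∑ p ∈ Finset.range N₁.toNat, |M p - n + p|)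
      omega
  rw [hz]
  simp

/-- The field `A_n B`. -/
def nthProduct (ε : ZMod 2) (n : ℤ) (A B : VertexOperator ℂ H) : VertexOperator ℂ H :=
  mkField (nthProductCoeff ε n A B) (nthProductCoeff_truncated ε n A B)

/-- The operator product expansion `A(z) B(w) ∼ ∑_{n ≥ 0} C_n(w) / (z - w)^{n+1}`: `A` and `B` are
local (with parity `ε` and some order `N`), the field `A_n B` is `C_n` for every `n ≥ 0`, and the
poles have order at most `N`. -/
def HasOPE (ε : ZMod 2) (A B : VertexOperator ℂ H) (C : ℕ → VertexOperator ℂ H) : Prop :=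
  (∃ N : ℕ, IsLocal ε N A B ∧ ∀ n, N ≤ n → C n = 0) ∧
    ∀ n : ℕ, nthProduct ε (n : ℤ) A B = C n

/-- The smallest set of fields that contains `Id` and the generators and is stable under
`(A, B) ↦ A_n B` (for local `A`, `B` and all `n ∈ ℤ`) and under `A ↦ A'`. -/
inductive Generated (gen : Set (VertexOperator ℂ H)) : VertexOperator ℂ H → Prop
  | id : Generated gen (idField H)
  | of (A : VertexOperator ℂ H) : A ∈ gen → Generated gen A
  | nthProduct (ε : ZMod 2) (N : ℕ) (n : ℤ) (A B : VertexOperator ℂ H) :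
      Generated gen A → Generated gen B → IsLocal ε N A B →
        Generated gen (nthProduct ε n A B)
  | deriv (A : VertexOperator ℂ H) : Generated gen A → Generated gen (derivField A)

/-- The space of fields generated by `gen`: the linear span of `Generated gen`. -/
def fieldSpace (gen : Set (VertexOperator ℂ H)) : Submodule ℂ (VertexOperator ℂ H) :=
  Submodule.span ℂ {A | Generated gen A}

/-- The state `A(z)Ω` at `z = 0`, i.e. `A(-1)Ω`. -/
def stateOf (Ω : H) (A : VertexOperator ℂ H) : H := (A[[-1]]) Ω

open Classical in
/-- The state-field correspondence: `V(a)` is the field in `fieldSpace gen` whose state is `a`. -/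
def stateField (gen : Set (VertexOperator ℂ H)) (Ω : H) (a : H) : VertexOperator ℂ H :=
  if h : ∃ A ∈ fieldSpace gen, stateOf Ω A = a then h.choose else 0

end Fields

/-! ### The boson algebra and its irreducible vacuum representation `L(V₀, ℓ)` -/

section Boson

variable {ι : Type*} [Fintype ι] [DecidableEq ι]

/-- Generators `X^a_n` (`n ∈ ℤ`) and the central element. -/
inductive BosonGen (ι : Type*) : Type _
  | X (a : ι) (n : ℤ) : BosonGen ι
  | central : BosonGen ι

/-- `[X^a_m, X^b_n] = i ∑_c Γ_{ab}^c X^c_{m+n} + m δ_{ab} δ_{m+n} 𝓛`, with `𝓛` central. -/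
inductive BosonRel (Γ : ι → ι → ι → ℝ) :
    FreeAlgebra ℂ (BosonGen ι) → FreeAlgebra ℂ (BosonGen ι) → Prop
  | comm (a b : ι) (m n : ℤ) : BosonRel Γ
      (FreeAlgebra.ι ℂ (BosonGen.X a m) * FreeAlgebra.ι ℂ (BosonGen.X b n) -
        FreeAlgebra.ι ℂ (BosonGen.X b n) * FreeAlgebra.ι ℂ (BosonGen.X a m))
      (∑ c, (Complex.I * (Γ a b c : ℂ)) • FreeAlgebra.ι ℂ (BosonGen.X c (m + n)) +
        if a = b ∧ m + n = 0 then (m : ℂ) • FreeAlgebra.ι ℂ BosonGen.central else 0)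
  | central (a : ι) (n : ℤ) : BosonRel Γ
      (FreeAlgebra.ι ℂ BosonGen.central * FreeAlgebra.ι ℂ (BosonGen.X a n))
      (FreeAlgebra.ι ℂ (BosonGen.X a n) * FreeAlgebra.ι ℂ BosonGen.central)

/-- The enveloping algebra of the boson algebra (the affine Lie algebra with structure constants
`i Γ`), by generators and relations. -/
def BosonAlgebra (Γ : ι → ι → ι → ℝ) : Type _ := RingQuot (BosonRel Γ)

instance (Γ : ι → ι → ι → ℝ) : Ring (BosonAlgebra Γ) :=
  inferInstanceAs (Ring (RingQuot (BosonRel Γ)))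

instance (Γ : ι → ι → ι → ℝ) : Algebra ℂ (BosonAlgebra Γ) :=
  inferInstanceAs (Algebra ℂ (RingQuot (BosonRel Γ)))

/-- The quotient map from the free algebra. -/
def bosonProj (Γ : ι → ι → ι → ℝ) : FreeAlgebra ℂ (BosonGen ι) →ₐ[ℂ] BosonAlgebra Γ :=
  RingQuot.mkAlgHom ℂ (BosonRel Γ)

theorem bosonProj_surjective (Γ : ι → ι → ι → ℝ) : Function.Surjective (bosonProj Γ) :=
  RingQuot.mkAlgHom_surjective ℂ (BosonRel Γ)

theorem bosonProj_rel (Γ : ι → ι → ι → ℝ) {x y : FreeAlgebra ℂ (BosonGen ι)}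
    (h : BosonRel Γ x y) : bosonProj Γ x = bosonProj Γ y :=
  RingQuot.mkAlgHom_rel ℂ h

/-- The element `X^a_n`. -/
def bosonX (Γ : ι → ι → ι → ℝ) (a : ι) (n : ℤ) : BosonAlgebra Γ :=
  bosonProj Γ (FreeAlgebra.ι ℂ (BosonGen.X a n))

/-- The central element `𝓛`. -/
def bosonCentral (Γ : ι → ι → ι → ℝ) : BosonAlgebra Γ :=
  bosonProj Γ (FreeAlgebra.ι ℂ BosonGen.central)

/-- The left ideal generated by the `X^a_n` with `n ≥ 0` and by `𝓛 - ℓ`. -/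
def vacuumIdeal (Γ : ι → ι → ι → ℝ) (ℓ : ℕ) : Submodule (BosonAlgebra Γ) (BosonAlgebra Γ) :=
  Submodule.span (BosonAlgebra Γ)
    ({x | ∃ (a : ι) (n : ℤ), 0 ≤ n ∧ x = bosonX Γ a n} ∪
      {bosonCentral Γ - algebraMap ℂ (BosonAlgebra Γ) (ℓ : ℂ)})

/-- The vacuum module: freely generated by `Ω` subject to `X^a_n Ω = 0` for `n ≥ 0` and
`𝓛 Ω = ℓ Ω`. -/
abbrev VacuumModule (Γ : ι → ι → ι → ℝ) (ℓ : ℕ) : Type _ := BosonAlgebra Γ ⧸ vacuumIdeal Γ ℓ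

/-- The cyclic vector of the vacuum module. -/
def vacuumModuleVec (Γ : ι → ι → ι → ℝ) (ℓ : ℕ) : VacuumModule Γ ℓ :=
  (vacuumIdeal Γ ℓ).mkQ 1

/-- The maximal proper submodule of the vacuum module: the sum of all submodules that do not
contain the cyclic vector. -/
def maxProper (Γ : ι → ι → ι → ℝ) (ℓ : ℕ) : Submodule (BosonAlgebra Γ) (VacuumModule Γ ℓ) :=
  sSup {N | vacuumModuleVec Γ ℓ ∉ N}

/-- The irreducible level `ℓ` representation `L(V₀, ℓ)`. -/
abbrev BosonRep (Γ : ι → ι → ι → ℝ) (ℓ : ℕ) : Type _ := VacuumModule Γ ℓ ⧸ maxProper Γ ℓ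

/-- The vacuum vector of `L(V₀, ℓ)`. -/
def bosonVac (Γ : ι → ι → ι → ℝ) (ℓ : ℕ) : BosonRep Γ ℓ :=
  (maxProper Γ ℓ).mkQ (vacuumModuleVec Γ ℓ)

/-- The operator `X^a_n` on `L(V₀, ℓ)`. -/
def bosonMode (Γ : ι → ι → ι → ℝ) (ℓ : ℕ) (a : ι) (n : ℤ) : Module.End ℂ (BosonRep Γ ℓ) :=
  Algebra.lsmul ℂ ℂ (BosonRep Γ ℓ) (bosonX Γ a n)

theorem bosonX_comm (Γ : ι → ι → ι → ℝ) (a b : ι) (m n : ℤ) :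
    bosonX Γ a m * bosonX Γ b n = bosonX Γ b n * bosonX Γ a m +
      (∑ c, (Complex.I * (Γ a b c : ℂ)) • bosonX Γ c (m + n) +
        if a = b ∧ m + n = 0 then (m : ℂ) • bosonCentral Γ else 0) := by
  have h := bosonProj_rel Γ (BosonRel.comm (Γ := Γ) a b m n)
  rw [← sub_eq_iff_eq_add']
  simp only [map_sub, map_mul, map_add, map_sum, map_smul, apply_ite (bosonProj Γ),
    map_zero] at h
  exact h

theorem bosonMode_truncated (Γ : ι → ι → ι → ℝ) (ℓ : ℕ) (a : ι) (v : BosonRep Γ ℓ) :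
    ∃ N : ℤ, ∀ n, N ≤ n → bosonMode Γ ℓ a n v = 0 := by
  obtain ⟨v, rfl⟩ := (maxProper Γ ℓ).mkQ_surjective v
  obtain ⟨u, rfl⟩ := (vacuumIdeal Γ ℓ).mkQ_surjective v
  obtain ⟨u, rfl⟩ := bosonProj_surjective Γ u
  have key : ∀ w : FreeAlgebra ℂ (BosonGen ι), ∀ v : BosonRep Γ ℓ,
      (∀ b, ∃ N : ℤ, ∀ n, N ≤ n → bosonX Γ b n • v = 0) →
      ∀ b, ∃ N : ℤ, ∀ n, N ≤ n →
        bosonX Γ b n • (bosonProj Γ w • v) = 0 := by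
    intro w
    induction w using FreeAlgebra.induction with
    | grade0 r =>
      intro v hv b
      obtain ⟨N, hN⟩ := hv b
      refine ⟨N, fun n hn => ?_⟩
      rw [AlgHom.commutes, algebraMap_smul, smul_comm, hN n hn, smul_zero]
    | grade1 x =>
      intro v hv b
      cases x with
      | central =>
        obtain ⟨N, hN⟩ := hv b
        refine ⟨N, fun n hn => ?_⟩
        have h := bosonProj_rel Γ (BosonRel.central (Γ := Γ) b n)
        rw [map_mul, map_mul] at h
        rw [bosonX, smul_smul, ← h, mul_smul, ← bosonX, hN n hn, smul_zero]
      | X c m =>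
        choose N hN using hv
        refine ⟨max (N b) (max (1 - m) (∑ e, |N e - m|)), fun n hn => ?_⟩
        have h1 : N b ≤ n := le_trans (le_max_left _ _) hn
        have h2 : 1 - m ≤ n := le_trans ((le_max_left _ _).trans (le_max_right _ _)) hn
        have h3 : ∑ e, |N e - m| ≤ n := le_trans ((le_max_right _ _).trans (le_max_right _ _)) hn
        change bosonX Γ b n • bosonX Γ c m • v = 0
        rw [smul_smul, bosonX_comm, if_neg (by omega), add_zero, add_smul, mul_smul, hN b n h1,
          smul_zero, zero_add, Finset.sum_smul]
        refine Finset.sum_eq_zero fun e _ => ?_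
        have h4 := Finset.single_le_sum (f := fun e => |N e - m|)
          (fun i _ => abs_nonneg _) (Finset.mem_univ e)
        have h5 := le_abs_self (N e - m)
        rw [smul_assoc, hN e _ (by omega), smul_zero]
    | mul x y hx hy =>
      intro v hv b
      simpa only [map_mul, mul_smul] using hx _ (hy v hv) b
    | add x y hx hy =>
      intro v hv b
      obtain ⟨N₁, h₁⟩ := hx v hv b
      obtain ⟨N₂, h₂⟩ := hy v hv b
      refine ⟨max N₁ N₂, fun n hn => ?_⟩
      rw [map_add, add_smul, smul_add, h₁ n (le_trans (le_max_left _ _) hn),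
        h₂ n (le_trans (le_max_right _ _) hn), add_zero]
  have hvac : ∀ b, ∃ N : ℤ, ∀ n, N ≤ n → bosonX Γ b n • bosonVac Γ ℓ = 0 := by
    refine fun b => ⟨0, fun n hn => ?_⟩
    rw [bosonVac, vacuumModuleVec, ← map_smul, ← map_smul, smul_eq_mul, mul_one]
    have : (vacuumIdeal Γ ℓ).mkQ (bosonX Γ b n) = 0 := by
      rw [Submodule.mkQ_apply, Submodule.Quotient.mk_eq_zero]
      exact Submodule.subset_span (Or.inl ⟨b, n, hn, rfl⟩)
    rw [this, map_zero]
  obtain ⟨N, hN⟩ := key u _ hvac a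
  refine ⟨N, fun n hn => ?_⟩
  have h := hN n hn
  have h' : bosonProj Γ u • bosonVac Γ ℓ =
      (maxProper Γ ℓ).mkQ
        ((vacuumIdeal Γ ℓ).mkQ (bosonProj Γ u)) := by
    rw [bosonVac, vacuumModuleVec, ← map_smul, ← map_smul, smul_eq_mul, mul_one]
  rwa [h'] at h

end Boson

/-! ### The fermion algebra and its Fock space -/

section Fermion

variable {ι : Type*} [DecidableEq ι]

/-- The generator indexed by `(a, n)` is `ψ^a_{n+1/2}`; the relation is
`[ψ^a_r, ψ^b_s]_+ = δ_{ab} δ_{r+s}` with `r = m + 1/2`, `s = n + 1/2`. -/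
inductive FermionRel (ι : Type*) [DecidableEq ι] :
    FreeAlgebra ℂ (ι × ℤ) → FreeAlgebra ℂ (ι × ℤ) → Prop
  | anticomm (a b : ι) (m n : ℤ) : FermionRel ι
      (FreeAlgebra.ι ℂ (a, m) * FreeAlgebra.ι ℂ (b, n) +
        FreeAlgebra.ι ℂ (b, n) * FreeAlgebra.ι ℂ (a, m))
      (if a = b ∧ m + n + 1 = 0 then 1 else 0)

/-- The fermion algebra. -/
def FermionAlgebra (ι : Type*) [DecidableEq ι] : Type _ := RingQuot (FermionRel ι)

instance (ι : Type*) [DecidableEq ι] : Ring (FermionAlgebra ι) :=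
  inferInstanceAs (Ring (RingQuot (FermionRel ι)))

instance (ι : Type*) [DecidableEq ι] : Algebra ℂ (FermionAlgebra ι) :=
  inferInstanceAs (Algebra ℂ (RingQuot (FermionRel ι)))

/-- The quotient map from the free algebra. -/
def fermionProj (ι : Type*) [DecidableEq ι] : FreeAlgebra ℂ (ι × ℤ) →ₐ[ℂ] FermionAlgebra ι :=
  RingQuot.mkAlgHom ℂ (FermionRel ι)

theorem fermionProj_surjective (ι : Type*) [DecidableEq ι] :
    Function.Surjective (fermionProj ι) :=
  RingQuot.mkAlgHom_surjective ℂ (FermionRel ι)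

theorem fermionProj_rel {x y : FreeAlgebra ℂ (ι × ℤ)} (h : FermionRel ι x y) :
    fermionProj ι x = fermionProj ι y :=
  RingQuot.mkAlgHom_rel ℂ h

/-- The element `ψ^a_{n+1/2}`. -/
def fermionPsi (a : ι) (n : ℤ) : FermionAlgebra ι :=
  fermionProj ι (FreeAlgebra.ι ℂ (a, n))

/-- The left ideal generated by the `ψ^a_r` with `r > 0`. -/
def fockIdeal (ι : Type*) [DecidableEq ι] : Submodule (FermionAlgebra ι) (FermionAlgebra ι) :=
  Submodule.span (FermionAlgebra ι) {x | ∃ (a : ι) (n : ℤ), 0 ≤ n ∧ x = fermionPsi a n}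

/-- The fermionic Fock space: freely generated by `Ω` subject to `ψ^a_r Ω = 0` for `r > 0`. -/
abbrev FermionFock (ι : Type*) [DecidableEq ι] : Type _ := FermionAlgebra ι ⧸ fockIdeal ι

/-- The vacuum vector of the Fock space. -/
def fermionVac (ι : Type*) [DecidableEq ι] : FermionFock ι := (fockIdeal ι).mkQ 1

/-- The operator `ψ^a_{n+1/2}` on the Fock space. -/
def fermionMode (a : ι) (n : ℤ) : Module.End ℂ (FermionFock ι) :=
  Algebra.lsmul ℂ ℂ (FermionFock ι) (fermionPsi a n)

theorem fermionPsi_anticomm (a b : ι) (m n : ℤ) :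
    fermionPsi a m * fermionPsi b n =
      (if a = b ∧ m + n + 1 = 0 then 1 else 0) - fermionPsi b n * fermionPsi a m := by
  have h := fermionProj_rel (FermionRel.anticomm (ι := ι) a b m n)
  rw [eq_sub_iff_add_eq]
  simp only [map_mul, map_add, apply_ite (fermionProj ι), map_one, map_zero] at h
  exact h

theorem fermionMode_truncated (a : ι) (v : FermionFock ι) :
    ∃ N : ℤ, ∀ n, N ≤ n → fermionMode a n v = 0 := by
  obtain ⟨u, rfl⟩ := (fockIdeal ι).mkQ_surjective v
  obtain ⟨u, rfl⟩ := fermionProj_surjective ι u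
  have key : ∀ w : FreeAlgebra ℂ (ι × ℤ), ∀ v : FermionFock ι,
      (∀ b : ι, ∃ N : ℤ, ∀ n, N ≤ n → fermionPsi b n • v = 0) →
      ∀ b : ι, ∃ N : ℤ, ∀ n, N ≤ n →
        fermionPsi b n • (fermionProj ι w • v) = 0 := by
    intro w
    induction w using FreeAlgebra.induction with
    | grade0 r =>
      intro v hv b
      obtain ⟨N, hN⟩ := hv b
      refine ⟨N, fun n hn => ?_⟩
      rw [AlgHom.commutes, algebraMap_smul, smul_comm, hN n hn, smul_zero]
    | grade1 x =>
      intro v hv b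
      obtain ⟨c, m⟩ := x
      obtain ⟨N, hN⟩ := hv b
      refine ⟨max N (-m), fun n hn => ?_⟩
      have h1 : N ≤ n := le_trans (le_max_left _ _) hn
      have h2 : -m ≤ n := le_trans (le_max_right _ _) hn
      change fermionPsi b n • fermionPsi c m • v = 0
      rw [smul_smul, fermionPsi_anticomm, if_neg (by omega), zero_sub, neg_smul, mul_smul,
        hN n h1, smul_zero, neg_zero]
    | mul x y hx hy =>
      intro v hv b
      simpa only [map_mul, mul_smul] using hx _ (hy v hv) b
    | add x y hx hy =>
      intro v hv b
      obtain ⟨N₁, h₁⟩ := hx v hv b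
      obtain ⟨N₂, h₂⟩ := hy v hv b
      refine ⟨max N₁ N₂, fun n hn => ?_⟩
      rw [map_add, add_smul, smul_add, h₁ n (le_trans (le_max_left _ _) hn),
        h₂ n (le_trans (le_max_right _ _) hn), add_zero]
  have hvac : ∀ b : ι, ∃ N : ℤ, ∀ n, N ≤ n → fermionPsi b n • fermionVac ι = 0 := by
    refine fun b => ⟨0, fun n hn => ?_⟩
    rw [fermionVac, ← map_smul, smul_eq_mul, mul_one, Submodule.mkQ_apply,
      Submodule.Quotient.mk_eq_zero]
    exact Submodule.subset_span ⟨b, n, hn, rfl⟩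
  obtain ⟨N, hN⟩ := key u _ hvac a
  refine ⟨N, fun n hn => ?_⟩
  have h := hN n hn
  have h' : fermionProj ι u • fermionVac ι =
      (fockIdeal ι).mkQ (fermionProj ι u) := by
    rw [fermionVac, ← map_smul, smul_eq_mul, mul_one]
  rwa [h'] at h

end Fermion

/-! ### The space `H = L(V₀, ℓ) ⊗ F` and its fields -/

section Super

theorem tensor_truncated {V W U : Type*} [AddCommGroup V] [Module ℂ V] [AddCommGroup W]
    [Module ℂ W] [AddCommGroup U] [Module ℂ U] (f : ℤ → V ⊗[ℂ] W →ₗ[ℂ] U)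
    (hf : ∀ v w, ∃ N : ℤ, ∀ n, N ≤ n → f n (v ⊗ₜ w) = 0) (t : V ⊗[ℂ] W) :
    ∃ N : ℤ, ∀ n, N ≤ n → f n t = 0 := by
  induction t using TensorProduct.induction_on with
  | zero => exact ⟨0, fun n _ => map_zero _⟩
  | tmul v w => exact hf v w
  | add x y hx hy =>
    obtain ⟨N₁, h₁⟩ := hx
    obtain ⟨N₂, h₂⟩ := hy
    refine ⟨max N₁ N₂, fun n hn => ?_⟩
    rw [map_add, h₁ n (le_trans (le_max_left _ _) hn), h₂ n (le_trans (le_max_right _ _) hn),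
      add_zero]

variable {ι : Type*} [Fintype ι] [DecidableEq ι]

/-- `H = L(V₀, ℓ) ⊗ F`. -/
abbrev SuperSpace (Γ : ι → ι → ι → ℝ) (ℓ : ℕ) : Type _ := BosonRep Γ ℓ ⊗[ℂ] FermionFock ι

/-- The vacuum vector of `H`. -/
def vac (Γ : ι → ι → ι → ℝ) (ℓ : ℕ) : SuperSpace Γ ℓ := bosonVac Γ ℓ ⊗ₜ[ℂ] fermionVac ι

/-- The boson field `X^a(z) = ∑ X^a_n z^{-n-1}` on `H`. -/
def fieldX (Γ : ι → ι → ι → ℝ) (ℓ : ℕ) (a : ι) : VertexOperator ℂ (SuperSpace Γ ℓ) :=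
  mkField (fun n => (bosonMode Γ ℓ a n).rTensor (FermionFock ι))
    (tensor_truncated _ fun v w => by
      obtain ⟨N, hN⟩ := bosonMode_truncated Γ ℓ a v
      refine ⟨N, fun n hn => ?_⟩
      rw [LinearMap.rTensor_tmul, hN n hn, TensorProduct.zero_tmul])

/-- The fermion field `ψ^a(z) = ∑ ψ^a_{n+1/2} z^{-n-1}` on `H`. -/
def fieldPsi (Γ : ι → ι → ι → ℝ) (ℓ : ℕ) (a : ι) : VertexOperator ℂ (SuperSpace Γ ℓ) :=
  mkField (fun n => (fermionMode a n).lTensor (BosonRep Γ ℓ))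
    (tensor_truncated _ fun v w => by
      obtain ⟨N, hN⟩ := fermionMode_truncated a w
      refine ⟨N, fun n hn => ?_⟩
      rw [LinearMap.lTensor_tmul, hN n hn, TensorProduct.tmul_zero])

/-- The generating fields `X^a(z)` and `ψ^a(z)`. -/
def generators (Γ : ι → ι → ι → ℝ) (ℓ : ℕ) : Set (VertexOperator ℂ (SuperSpace Γ ℓ)) :=
  Set.range (fieldX Γ ℓ) ∪ Set.range (fieldPsi Γ ℓ)

/-- The state-field correspondence `V` of `H`. -/
def vertexV (Γ : ι → ι → ι → ℝ) (ℓ : ℕ) (v : SuperSpace Γ ℓ) : VertexOperator ℂ (SuperSpace Γ ℓ) :=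
  stateField (generators Γ ℓ) (vac Γ ℓ) v

/-- The field `S^c = V(s^c)`, `s^c = -(i/2) ∑_{a,b} Γ_{ab}^c ψ^a_{-1/2} ψ^b_{-1/2} Ω`. -/
def fieldS (Γ : ι → ι → ι → ℝ) (ℓ : ℕ) (c : ι) : VertexOperator ℂ (SuperSpace Γ ℓ) :=
  vertexV Γ ℓ ((-(Complex.I / 2)) • ∑ a, ∑ b, (Γ a b c : ℂ) •
    ((fieldPsi Γ ℓ a)[[-1]]) (((fieldPsi Γ ℓ b)[[-1]]) (vac Γ ℓ)))

/-- The boson field `B^a = X^a + S^a`. -/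
def fieldB (Γ : ι → ι → ι → ℝ) (ℓ : ℕ) (a : ι) : VertexOperator ℂ (SuperSpace Γ ℓ) :=
  fieldX Γ ℓ a + fieldS Γ ℓ a

/-- The number `g`: half the eigenvalue of `∑_a (ad X_a)^2`.  Since
`∑_a [X_a, [X_a, X_b]] = ∑_d (∑_{a,c} Γ_{ac}^b Γ_{ac}^d) X_d`, the eigenvalue is
`(∑_{a,b,c} (Γ_{ab}^c)^2) / dim`. -/
def dualCoxeter (Γ : ι → ι → ι → ℝ) : ℝ :=
  (∑ a, ∑ b, ∑ c, Γ a b c ^ 2) / Fintype.card ι / 2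

/-- `d = ℓ + g`. -/
def level (Γ : ι → ι → ι → ℝ) (ℓ : ℕ) : ℝ := ℓ + dualCoxeter Γ

/-- `τ = d^{-1/2} ∑_a ψ^a_{-1/2} (X^a_{-1} + (1/3) S^a_{-1}) Ω`. -/
def tau (Γ : ι → ι → ι → ℝ) (ℓ : ℕ) : SuperSpace Γ ℓ :=
  (((Real.sqrt (level Γ ℓ))⁻¹ : ℝ) : ℂ) • ∑ a, ((fieldPsi Γ ℓ a)[[-1]])
    (((fieldX Γ ℓ a)[[-1]]) (vac Γ ℓ) + (1 / 3 : ℂ) • ((fieldS Γ ℓ a)[[-1]]) (vac Γ ℓ))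

/-- The field `G = V(τ)`. -/
def fieldG (Γ : ι → ι → ι → ℝ) (ℓ : ℕ) : VertexOperator ℂ (SuperSpace Γ ℓ) :=
  vertexV Γ ℓ (tau Γ ℓ)

/-- The mode `G_{k+1/2}`, where `G(z) = ∑ G_{n-1/2} z^{-n-1}`. -/
def modeG (Γ : ι → ι → ι → ℝ) (ℓ : ℕ) (k : ℤ) : Module.End ℂ (SuperSpace Γ ℓ) :=
  (fieldG Γ ℓ)[[k + 1]]

/-- The mode `ψ^a_{k+1/2}`, where `ψ^a(z) = ∑ ψ^a_{n+1/2} z^{-n-1}`. -/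
def modePsi (Γ : ι → ι → ι → ℝ) (ℓ : ℕ) (a : ι) (k : ℤ) : Module.End ℂ (SuperSpace Γ ℓ) :=
  (fieldPsi Γ ℓ a)[[k]]

/-- The mode `B^a_n`, where `B^a(z) = ∑ B^a_n z^{-n-1}`. -/
def modeB (Γ : ι → ι → ι → ℝ) (ℓ : ℕ) (a : ι) (n : ℤ) : Module.End ℂ (SuperSpace Γ ℓ) :=
  (fieldB Γ ℓ a)[[n]]

end Super

end SuperVertex

end

open SuperVertex

/-! A field is determined by the vector it creates from the vacuum. Call a field homogeneous if it
has a parity, is local to the generators, kills Ω with its modes A(n), n ≥ 0, and satisfies [T,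
A(n)] = -n A(n-1) for a translation operator T with TΩ = 0. If moreover A(-1)Ω = 0, covariance gives
A(n)Ω = 0 for all n, and locality carries this from Ω to everything the generating modes reach,
which is all of H (`VacuumData.IsHomogeneous.eq_zero`). Homogeneity passes to A_nB: locality by
Dong's lemma (`IsLocal.nthProduct_left`), covariance because T acts as a derivation
(`translation_nthProduct`). Since A_nB creates A(n)B(-1)Ω (`stateOf_nthProduct`), every vector is
the state of a generated field, and the state-field correspondence follows.

Each operator product expansion thereby becomes a computation with vectors: A_nG is the homogeneous
field with state A(n)τ, so only B^a_n τ and ψ^a_{n+1/2} τ with n ≥ 0 are needed. The mode brackets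
then come from the commutator formula `IsLocal.superBracket_eq_sum`.

The operator T has to be constructed. It is a combination of modes, namely the Sugawara operator of
the bosons plus a quadratic expression in the fermions, so it is defined on the quotient L(V₀, ℓ)
without further argument. The Sugawara part has the right commutators because the Casimir operator
of a simple Lie algebra is the scalar 2g (`sum_mul_structureConstants`), and it can be normalized
because d = ℓ + g > 0.

For the vectors, S^a rotates the fermions by the adjoint action and is a current of level g. The
operator ψ^a_{1/2} meets the cubic term of τ in three equal ways, which cancels the factor 1/3 and
leaves d^{-1/2} B^a_{-1}Ω (`fieldPsi_tau`). The vector τ is invariant under B^a_0, and B^a_1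
collects ℓ from the boson term and (g + 2g)/3 = g from the cubic term, in total d (`fieldB_tau`). -/

noncomputable section

namespace SuperVertex

/-! ### Difference operators on coefficient families and Newton's formula -/

section Shift

variable {G M : Type*} [AddCommGroup G] [AddCommGroup M] [Module ℂ M]

/-- The operator `F ↦ F(· + g)` on families indexed by an abelian group. -/
def shift (g : G) : Module.End ℂ (G → M) := LinearMap.funLeft ℂ M (· + g)

@[simp]
theorem shift_apply (g : G) (F : G → M) (x : G) : shift g F x = F (x + g) := rfl

theorem shift_mul (g h : G) : shift (M := M) g * shift h = shift (g + h) := by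
  ext F x
  simp [add_assoc]

theorem shift_commute (g h : G) : Commute (shift (M := M) g) (shift h) := by
  rw [Commute, SemiconjBy, shift_mul, shift_mul, add_comm]

theorem shift_pow (g : G) (n : ℕ) : shift (M := M) g ^ n = shift (n • g) := by
  induction n with
  | zero => ext F x; simp
  | succ n ih => rw [pow_succ, ih, shift_mul, succ_nsmul]

/-- The difference of two shifts: on coefficient families, multiplication by a difference of two
variables. -/
def diff (a b : G) : Module.End ℂ (G → M) := shift a - shift b

@[simp]
theorem diff_apply (a b : G) (F : G → M) (x : G) : diff a b F x = F (x + a) - F (x + b) := rfl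

theorem shift_diff_commute (g a b : G) : Commute (shift (M := M) g) (diff a b) :=
  (shift_commute g a).sub_right (shift_commute g b)

theorem diff_commute (a b c d : G) : Commute (diff (M := M) a b) (diff c d) :=
  (shift_diff_commute a c d).sub_left (shift_diff_commute b c d)

/-- The binomial theorem for two commuting shifts. Its right side is the shape of the sum in
`IsLocal`. -/
theorem diff_pow_apply (a b : G) (N : ℕ) (F : G → M) (x : G) :
    (diff a b ^ N) F x = ∑ k ∈ Finset.range (N + 1), ((-1) ^ k * (N.choose k : ℂ)) •
      F (x + ((N : ℤ) - k) • a + (k : ℤ) • b) := by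
  have h : diff (M := M) a b = (-1 : ℂ) • shift b + shift a := by
    rw [diff]; module
  rw [h, ((shift_commute b a).smul_left (-1 : ℂ)).add_pow]
  simp only [LinearMap.sum_apply, Finset.sum_apply]
  refine Finset.sum_congr rfl fun k hk => ?_
  have hk' : k ≤ N := Nat.lt_succ_iff.1 (Finset.mem_range.1 hk)
  rw [smul_pow, shift_pow, shift_pow, smul_mul_assoc, shift_mul, ← nsmul_eq_mul',
    ← Nat.cast_smul_eq_nsmul ℂ, smul_smul, mul_comm, LinearMap.smul_apply, Pi.smul_apply,
    shift_apply]
  congr 2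
  rw [← Nat.cast_sub hk', natCast_zsmul, natCast_zsmul]
  abel

/-- Newton's forward difference formula on `ℤ`. -/
theorem eq_sum_choose_smul_diff (N : ℕ) (f : ℤ → M) (hf : (diff 1 0 ^ N) f = 0) (m : ℤ) :
    f m = ∑ j ∈ Finset.range N, ((Ring.choose m j : ℤ) : ℂ) • (diff 1 0 ^ j) f 0 := by
  induction N generalizing f m with
  | zero => simpa using congrFun hf m
  | succ N ih =>
    have step : ∀ m, f (m + 1) - f m = ∑ j ∈ Finset.range N,
        ((Ring.choose m j : ℤ) : ℂ) • (diff 1 0 ^ (j + 1)) f 0 := by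
      intro m
      have := ih (diff 1 0 f) (by rw [pow_succ] at hf; exact hf) m
      rw [diff_apply, add_zero] at this
      rw [this]
      refine Finset.sum_congr rfl fun j _ => ?_
      rw [pow_succ]; rfl
    rw [Finset.sum_range_succ']
    -- By `step` and Pascal's rule, f minus the non-constant part of its Newton sum has period 1,
    -- hence is constant on ℤ.
    have hz : ∀ m : ℤ, f (m + 1) - ∑ j ∈ Finset.range N,
        ((Ring.choose (m + 1) (j + 1) : ℤ) : ℂ) • (diff 1 0 ^ (j + 1)) f 0 =
        f m - ∑ j ∈ Finset.range N,
        ((Ring.choose m (j + 1) : ℤ) : ℂ) • (diff 1 0 ^ (j + 1)) f 0 := by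
      intro m
      rw [sub_eq_sub_iff_sub_eq_sub, step, ← Finset.sum_sub_distrib]
      refine Finset.sum_congr rfl fun j _ => ?_
      rw [Ring.choose_succ_succ, Int.cast_add, add_smul, add_sub_cancel_right]
    have hconst : ∀ m : ℤ, f m - ∑ j ∈ Finset.range N,
        ((Ring.choose m (j + 1) : ℤ) : ℂ) • (diff 1 0 ^ (j + 1)) f 0 = f 0 := by
      intro m
      induction m using Int.induction_on with
      | zero => simp [Ring.choose_zero_succ]
      | succ i hi => rw [hz, hi]
      | pred i hi => rw [← hi, ← hz, sub_add_cancel]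
    rw [← sub_eq_iff_eq_add', pow_zero]
    simpa using hconst m

end Shift

/-! ### Locality and the commutator formula -/

section Locality

variable {H : Type*} [AddCommGroup H] [Module ℂ H]

/-- The family of all superbrackets of modes of `A` and `B`. -/
def bracketFamily (ε : ZMod 2) (A B : VertexOperator ℂ H) : ℤ × ℤ → Module.End ℂ H :=
  fun x => superBracket ε (A[[x.1]]) (B[[x.2]])

/-- Since A(n) is the coefficient of z^{-n-1}, multiplication by z shifts the index by +1. Locality
thus becomes an equation in a commutative algebra of operators, where powers of z - w can be
manipulated. -/
theorem isLocal_iff (ε : ZMod 2) (N : ℕ) (A B : VertexOperator ℂ H) :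
    IsLocal ε N A B ↔ (diff (1, 0) (0, 1) ^ N) (bracketFamily ε A B) = 0 := by
  rw [funext_iff, Prod.forall]
  refine forall₂_congr fun m n => ?_
  rw [diff_pow_apply]
  simp [bracketFamily]

theorem IsLocal.mono {ε : ZMod 2} {N N' : ℕ} {A B : VertexOperator ℂ H} (h : IsLocal ε N A B)
    (hN : N ≤ N') : IsLocal ε N' A B := by
  rw [isLocal_iff] at *
  rw [← Nat.sub_add_cancel hN, pow_add, Module.End.mul_apply, h, map_zero]

theorem parSign_mul_self (ε : ZMod 2) : parSign ε * parSign ε = 1 := by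
  rw [parSign, ← pow_add, ← two_mul, pow_mul]; simp

theorem parSign_zero : parSign 0 = 1 := by simp [parSign]

theorem parSign_one : parSign 1 = -1 := by simp [parSign, ZMod.val_one]

theorem parSign_add (ε ε' : ZMod 2) : parSign (ε + ε') = parSign ε * parSign ε' := by
  have h : ∀ ε : ZMod 2, ε = 0 ∨ ε = 1 := by decide
  have h2 : (1 + 1 : ZMod 2) = 0 := rfl
  rcases h ε with rfl | rfl <;> rcases h ε' with rfl | rfl <;>
    simp [parSign_zero, parSign_one, h2]

theorem superBracket_swap (ε : ZMod 2) (S T : Module.End ℂ H) :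
    superBracket ε T S = -parSign ε • superBracket ε S T := by
  rw [superBracket, superBracket, smul_sub, smul_smul, neg_mul, parSign_mul_self]
  module

/-- Exchanging z and w reverses the binomial sum at the cost of (-1)^N, and exchanging the entries
of the bracket costs -(-1)^ε. -/
theorem IsLocal.symm {ε : ZMod 2} {N : ℕ} {A B : VertexOperator ℂ H} (h : IsLocal ε N A B) :
    IsLocal ε N B A := by
  intro m n
  rw [← Finset.sum_range_reflect]
  have := congrArg (fun T => (-parSign ε * (-1) ^ N) • T) (h n m)
  simp only [smul_zero, Finset.smul_sum] at this
  rw [← this]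
  refine Finset.sum_congr rfl fun k hk => ?_
  have hk' : k ≤ N := Nat.lt_succ_iff.1 (Finset.mem_range.1 hk)
  rw [superBracket_swap, add_tsub_cancel_right, Nat.choose_symm hk', smul_smul, smul_smul,
    Nat.cast_sub hk', sub_sub_cancel]
  congr 1
  have : (-1 : ℂ) ^ N = (-1) ^ (N - k) * (-1) ^ k := by rw [← pow_add, Nat.sub_add_cancel hk']
  rw [this]
  have h2 : (-1 : ℂ) ^ k * (-1) ^ k = 1 := by rw [← mul_pow]; simp
  linear_combination (-parSign ε * (-1) ^ (N - k) * (N.choose k : ℂ)) * (-h2)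

theorem superBracket_add_left (ε : ZMod 2) (S S' T : Module.End ℂ H) :
    superBracket ε (S + S') T = superBracket ε S T + superBracket ε S' T := by
  simp only [superBracket, add_mul, mul_add, smul_add]; abel

theorem superBracket_smul_left (ε : ZMod 2) (r : ℂ) (S T : Module.End ℂ H) :
    superBracket ε (r • S) T = r • superBracket ε S T := by
  simp only [superBracket, smul_mul_assoc, mul_smul_comm, smul_sub, smul_comm r]

theorem ncoeff_add (A B : VertexOperator ℂ H) (n : ℤ) : (A + B)[[n]] = A[[n]] + B[[n]] := by
  rw [map_add]; rfl

theorem ncoeff_smul (r : ℂ) (A : VertexOperator ℂ H) (n : ℤ) : (r • A)[[n]] = r • A[[n]] := by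
  rw [map_smul]; rfl

theorem ncoeff_zero (n : ℤ) : (0 : VertexOperator ℂ H)[[n]] = 0 := by
  rw [map_zero]; rfl

/-- Locality of some order, with parity `ε`. -/
def LocalTo (ε : ZMod 2) (A B : VertexOperator ℂ H) : Prop := ∃ N, IsLocal ε N A B

theorem IsLocal.localTo {ε : ZMod 2} {N : ℕ} {A B : VertexOperator ℂ H} (h : IsLocal ε N A B) :
    LocalTo ε A B := ⟨N, h⟩

theorem LocalTo.symm {ε : ZMod 2} {A B : VertexOperator ℂ H} (h : LocalTo ε A B) :
    LocalTo ε B A := h.imp fun _ => IsLocal.symm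

theorem LocalTo.add_left {ε : ZMod 2} {A A' B : VertexOperator ℂ H} (h : LocalTo ε A B)
    (h' : LocalTo ε A' B) : LocalTo ε (A + A') B := by
  obtain ⟨N, h⟩ := h
  obtain ⟨N', h'⟩ := h'
  refine ⟨max N N', ?_⟩
  have h := (isLocal_iff _ _ _ _).1 (h.mono (le_max_left N N'))
  have h' := (isLocal_iff _ _ _ _).1 (h'.mono (le_max_right N N'))
  rw [isLocal_iff]
  have : bracketFamily ε (A + A') B = bracketFamily ε A B + bracketFamily ε A' B := by
    funext x
    simp only [bracketFamily, ncoeff_add, superBracket_add_left, Pi.add_apply]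
  rw [this, map_add, h, h', add_zero]

theorem LocalTo.smul_left {ε : ZMod 2} {A B : VertexOperator ℂ H} (r : ℂ) (h : LocalTo ε A B) :
    LocalTo ε (r • A) B := by
  obtain ⟨N, h⟩ := h
  refine ⟨N, ?_⟩
  rw [isLocal_iff] at *
  have : bracketFamily ε (r • A) B = r • bracketFamily ε A B := by
    funext x
    simp only [bracketFamily, ncoeff_smul, superBracket_smul_left, Pi.smul_apply]
  rw [this, map_smul, h, smul_zero]

theorem LocalTo.zero_left (ε : ZMod 2) (B : VertexOperator ℂ H) : LocalTo ε 0 B := by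
  refine ⟨0, ?_⟩
  intro m n
  simp [ncoeff_zero, superBracket]

/-- On each vector the coefficient of `A_n B` is a sum over all sufficiently long ranges. -/
theorem exists_nthProduct_apply_eq_sum (ε : ZMod 2) (n : ℤ) (A B : VertexOperator ℂ H) (m : ℤ)
    (c : H) : ∃ K₀ : ℕ, ∀ K, K₀ ≤ K →
      ((nthProduct ε n A B)[[m]]) c = ∑ p ∈ Finset.range K, nthProductTerm ε n A B m p c := by
  obtain ⟨K₀, hK₀⟩ := (nthProductTerm_support_finite ε n A B m c).bddAbove
  refine ⟨K₀ + 1, fun K hK => ?_⟩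
  rw [nthProduct, ncoeff_mkField]
  refine finsum_eq_sum_of_support_subset _ fun p hp => ?_
  have := hK₀ hp
  simp only [Finset.coe_range, Set.mem_Iio]
  omega

/-- The binomials vanish beyond p = j, and reversing the second half of the sum pairs it with the
first. The result is a j-th difference of brackets, the form in which Newton's formula will meet it.
-/
theorem ncoeff_nthProduct_natCast (ε : ZMod 2) (j : ℕ) (A B : VertexOperator ℂ H) (m : ℤ) :
    (nthProduct ε (j : ℤ) A B)[[m]] = ∑ p ∈ Finset.range (j + 1),
      ((-1) ^ p * (j.choose p : ℂ)) • superBracket ε (A[[(j : ℤ) - p]]) (B[[m + p]]) := by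
  ext c
  obtain ⟨K₀, hK⟩ := exists_nthProduct_apply_eq_sum ε j A B m c
  rw [hK (max K₀ (j + 1)) (le_max_left _ _)]
  have hsub : Finset.range (j + 1) ⊆ Finset.range (max K₀ (j + 1)) :=
    Finset.range_subset_range.2 (le_max_right _ _)
  rw [← Finset.sum_subset hsub]
  · simp only [nthProductTerm, Ring.choose_natCast, superBracket, smul_sub,
      LinearMap.sum_apply, LinearMap.sub_apply, Finset.sum_sub_distrib]
    congr 1
    · rw [← Finset.sum_range_reflect]
      refine Finset.sum_congr rfl fun k hk => ?_
      have hk' : k ≤ j := Nat.lt_succ_iff.1 (Finset.mem_range.1 hk)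
      rw [add_tsub_cancel_right, Nat.choose_symm hk', Nat.cast_sub hk',
        show m + (j : ℤ) - (j - k) = m + k by ring]
      simp only [LinearMap.smul_apply, smul_smul, Int.cast_natCast]
      congr 1
      have : (-1 : ℂ) ^ j = (-1) ^ (j - k) * (-1) ^ k := by rw [← pow_add, Nat.sub_add_cancel hk']
      rw [zpow_natCast, this]
      have h2 : (-1 : ℂ) ^ (j - k) * (-1) ^ (j - k) = 1 := by rw [← mul_pow]; simp
      linear_combination (parSign ε * (-1) ^ k * (j.choose k : ℂ)) * h2
  · intro p _ hp
    rw [nthProductTerm, Ring.choose_natCast, Nat.choose_eq_zero_of_lt (by simpa using hp)]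
    simp

/-- The commutator formula for local fields. -/
theorem IsLocal.superBracket_eq_sum {ε : ZMod 2} {N : ℕ} {A B : VertexOperator ℂ H}
    (h : IsLocal ε N A B) (m n : ℤ) :
    superBracket ε (A[[m]]) (B[[n]]) = ∑ j ∈ Finset.range N,
      ((Ring.choose m j : ℤ) : ℂ) • (nthProduct ε (j : ℤ) A B)[[m + n - j]] := by
  -- Along the line of fixed total index m + n the bracket is a function of k alone. Locality
  -- annihilates its N-th difference, and its j-th difference at 0 is a mode of A_jB.
  have key : ∀ (j : ℕ) (x : ℤ),
      (diff 1 0 ^ j) (fun k : ℤ => superBracket ε (A[[k]]) (B[[m + n - k]])) x =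
      ∑ p ∈ Finset.range (j + 1), ((-1) ^ p * (j.choose p : ℂ)) •
        superBracket ε (A[[x + (j - p)]]) (B[[(m + n - x - j) + p]]) := by
    intro j x
    rw [diff_pow_apply]
    refine Finset.sum_congr rfl fun p _ => ?_
    simp only [smul_eq_mul, mul_one, mul_zero, add_zero]
    congr 4
    ring_nf
  have := eq_sum_choose_smul_diff N
    (fun k : ℤ => superBracket ε (A[[k]]) (B[[m + n - k]])) (by
      funext x
      rw [key]
      exact h x _) m
  simp only [add_sub_cancel_left] at this
  rw [this]
  refine Finset.sum_congr rfl fun j _ => ?_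
  rw [key, ncoeff_nthProduct_natCast]
  simp

end Locality

/-! ### Expansions of (z - w)^n for integral n -/

section BinomialExpansion

variable {G M : Type*} [AddCommGroup G] [AddCommGroup M] [Module ℂ M]

/-- Every monomial of degree m + n in x and y contains x^m or y^n. The double induction avoids
writing the expansion. -/
theorem add_pow_apply_eq_zero {x y : Module.End ℂ M} (h : Commute x y) (m n : ℕ) (D : M)
    (hx : (x ^ m) D = 0) (hy : (y ^ n) D = 0) : ((x + y) ^ (m + n)) D = 0 := by
  induction m generalizing n D with
  | zero => rw [show D = 0 by simpa using hx, map_zero]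
  | succ m ihm =>
    induction n generalizing D with
    | zero => rw [show D = 0 by simpa using hy, map_zero]
    | succ n ihn =>
      have h1 : ((x + y) ^ (m + (n + 1))) (x D) = 0 := by
        refine ihm (n + 1) (x D) ?_ ?_
        · rwa [pow_succ] at hx
        · rw [← Module.End.mul_apply, (h.symm.pow_left (n + 1)).eq, Module.End.mul_apply, hy,
            map_zero]
      have h2 : ((x + y) ^ (m + 1 + n)) (y D) = 0 := by
        refine ihn (y D) ?_ ?_
        · rw [← Module.End.mul_apply, (h.pow_left (m + 1)).eq, Module.End.mul_apply, hx,
            map_zero]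
        · rwa [pow_succ] at hy
      rw [show m + 1 + (n + 1) = (m + 1 + n) + 1 by ring, pow_succ, Module.End.mul_apply,
        LinearMap.add_apply, map_add, h2, show m + 1 + n = m + (n + 1) by ring, h1, add_zero]

/-- A family that vanishes far in the direction `e`. -/
def TruncIn (e : G) (K : G → M) : Prop := ∀ x, ∃ P : ℕ, ∀ p, P ≤ p → K (x + p • e) = 0

omit [Module ℂ M] in
theorem TruncIn.add {e : G} {K K' : G → M} (h : TruncIn e K) (h' : TruncIn e K') :
    TruncIn e (K + K') := by
  intro x
  obtain ⟨P, hP⟩ := h x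
  obtain ⟨P', hP'⟩ := h' x
  refine ⟨max P P', fun p hp => ?_⟩
  rw [Pi.add_apply, hP p (le_trans (le_max_left _ _) hp), hP' p (le_trans (le_max_right _ _) hp),
    add_zero]

theorem TruncIn.smul {e : G} {K : G → M} (r : ℂ) (h : TruncIn e K) : TruncIn e (r • K) := by
  intro x
  obtain ⟨P, hP⟩ := h x
  exact ⟨P, fun p hp => by rw [Pi.smul_apply, hP p hp, smul_zero]⟩

theorem TruncIn.shift {e : G} {K : G → M} (g : G) (h : TruncIn e K) : TruncIn e (shift g K) := by
  intro x
  obtain ⟨P, hP⟩ := h (x + g)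
  exact ⟨P, fun p hp => by rw [shift_apply, add_right_comm, hP p hp]⟩

theorem diff_eq_add_smul (a b : G) (K : G → M) :
    diff a b K = shift a K + (-1 : ℂ) • shift b K := by
  rw [diff, LinearMap.sub_apply]; module

theorem TruncIn.diff {e : G} {K : G → M} (a b : G) (h : TruncIn e K) : TruncIn e (diff a b K) := by
  rw [diff_eq_add_smul]
  exact (h.shift a).add ((h.shift b).smul _)

theorem TruncIn.diff_pow {e : G} {K : G → M} (a b : G) (N : ℕ) (h : TruncIn e K) :
    TruncIn e ((SuperVertex.diff a b ^ N) K) := by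
  induction N with
  | zero => exact h
  | succ N ih => rw [pow_succ']; exact ih.diff a b

/-- The coefficients of the expansion of `(z - w)^n K` in the domain where `z` dominates, where
multiplication by `z` and `w` are the shifts by `a` and `b`. -/
def binomExp (a b : G) (n : ℤ) (K : G → M) (x : G) : M :=
  ∑ᶠ p : ℕ, ((-1) ^ p * ((Ring.choose n p : ℤ) : ℂ)) • K (x + n • a + p • (b - a))

theorem exists_binomExp_eq_sum {a b : G} {K : G → M} (h : TruncIn (b - a) K) (n : ℤ) (x : G) :
    ∃ P : ℕ, ∀ Q, P ≤ Q → binomExp a b n K x = ∑ p ∈ Finset.range Q,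
      ((-1) ^ p * ((Ring.choose n p : ℤ) : ℂ)) • K (x + n • a + p • (b - a)) := by
  obtain ⟨P, hP⟩ := h (x + n • a)
  refine ⟨P, fun Q hQ => finsum_eq_sum_of_support_subset _ fun p hp => ?_⟩
  simp only [Finset.coe_range, Set.mem_Iio]
  by_contra hlt
  exact hp (by simp only [hP p (by omega), smul_zero])

theorem binomExp_shift (a b g : G) (n : ℤ) (K : G → M) :
    binomExp a b n (shift g K) = shift g (binomExp a b n K) := by
  funext x
  simp only [binomExp, shift_apply]
  congr 1
  funext p
  rw [show x + n • a + p • (b - a) + g = x + g + n • a + p • (b - a) by abel]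

theorem binomExp_add {a b : G} {K K' : G → M} (h : TruncIn (b - a) K) (h' : TruncIn (b - a) K')
    (n : ℤ) : binomExp a b n (K + K') = binomExp a b n K + binomExp a b n K' := by
  funext x
  obtain ⟨P, hP⟩ := exists_binomExp_eq_sum h n x
  obtain ⟨P', hP'⟩ := exists_binomExp_eq_sum h' n x
  obtain ⟨P'', hP''⟩ := exists_binomExp_eq_sum (h.add h') n x
  have h1 := le_max_left P (max P' P'')
  have h2 := (le_max_left P' P'').trans (le_max_right P (max P' P''))
  have h3 := (le_max_right P' P'').trans (le_max_right P (max P' P''))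
  rw [Pi.add_apply, hP _ h1, hP' _ h2, hP'' _ h3, ← Finset.sum_add_distrib]
  exact Finset.sum_congr rfl fun p _ => by rw [Pi.add_apply, smul_add]

theorem binomExp_smul (a b : G) (r : ℂ) (K : G → M) (n : ℤ) :
    binomExp a b n (r • K) = r • binomExp a b n K := by
  funext x
  rw [Pi.smul_apply, binomExp, binomExp, smul_finsum]
  congr 1
  funext p
  rw [Pi.smul_apply, smul_comm]

theorem binomExp_diff {a b : G} {K : G → M} (h : TruncIn (b - a) K) (c d : G) (n : ℤ) :
    binomExp a b n (diff c d K) = diff c d (binomExp a b n K) := by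
  rw [diff_eq_add_smul, diff_eq_add_smul, binomExp_add (h.shift c) ((h.shift d).smul _),
    binomExp_smul, binomExp_shift, binomExp_shift]

theorem binomExp_diff_pow {a b : G} {K : G → M} (h : TruncIn (b - a) K) (c d : G) (n : ℤ)
    (N : ℕ) : binomExp a b n ((diff c d ^ N) K) = (diff c d ^ N) (binomExp a b n K) := by
  induction N with
  | zero => rfl
  | succ N ih =>
    rw [pow_succ', Module.End.mul_apply, binomExp_diff (h.diff_pow c d N), ih]; rfl

theorem binomExp_zero (a b : G) (K : G → M) : binomExp a b 0 K = K := by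
  funext x
  rw [binomExp, finsum_eq_single _ 0]
  · simp
  · intro p hp
    obtain ⟨q, rfl⟩ := Nat.exists_eq_succ_of_ne_zero hp
    simp [Ring.choose_zero_succ]

/-- Pascal's rule for generalized binomial coefficients. Truncation makes the sums finite at each
point. -/
theorem diff_binomExp {a b : G} {K : G → M} (h : TruncIn (b - a) K) (n : ℤ) :
    diff a b (binomExp a b n K) = binomExp a b (n + 1) K := by
  funext x
  obtain ⟨P, hP⟩ := exists_binomExp_eq_sum h n (x + a)
  obtain ⟨P', hP'⟩ := exists_binomExp_eq_sum h n (x + b)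
  obtain ⟨P'', hP''⟩ := exists_binomExp_eq_sum h (n + 1) x
  -- The sum at x + a is taken one term longer than the sum at x + b, so that after splitting off p
  -- = 0 its term p + 1 faces the term p of the other.
  obtain ⟨Q, h1, h2, h3⟩ : ∃ Q, P ≤ Q + 1 ∧ P' ≤ Q ∧ P'' ≤ Q + 1 :=
    ⟨P + P' + P'', by omega, by omega, by omega⟩
  rw [diff_apply, hP _ h1, hP' _ h2, hP'' _ h3, Finset.sum_range_succ', Finset.sum_range_succ',
    add_sub_right_comm, ← Finset.sum_sub_distrib]
  congr 1
  · refine Finset.sum_congr rfl fun p _ => ?_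
    have e1 : x + a + n • a + (p + 1) • (b - a) = x + (n + 1) • a + (p + 1) • (b - a) := by
      rw [add_zsmul a n 1, one_zsmul]; abel
    have e2 : x + b + n • a + p • (b - a) = x + (n + 1) • a + (p + 1) • (b - a) := by
      rw [add_zsmul a n 1, one_zsmul, succ_nsmul]; abel
    rw [e1, e2, ← sub_smul, Ring.choose_succ_succ]
    congr 1
    push_cast
    ring
  · simp only [Ring.choose_zero_right]
    congr 2
    rw [add_smul, one_smul]; abel

theorem diff_pow_binomExp {a b : G} {K : G → M} (h : TruncIn (b - a) K) (n : ℤ) (t : ℕ) :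
    (diff a b ^ t) (binomExp a b n K) = binomExp a b (n + t) K := by
  induction t with
  | zero => simp
  | succ t ih =>
    rw [pow_succ', Module.End.mul_apply, ih, diff_binomExp h]
    congr 1
    push_cast
    ring

/-- If `t` is large, multiplication by `(z - w)^t` turns the expansion of `(z - w)^n K` into
`(z - w)^M K`. -/
theorem diff_pow_binomExp_eq {a b : G} {K : G → M} (h : TruncIn (b - a) K) {n : ℤ} {t N : ℕ}
    (hn : n + t = N) : (diff a b ^ t) (binomExp a b n K) = (diff a b ^ N) K := by
  rw [diff_pow_binomExp h, hn, ← zero_add (N : ℤ), ← diff_pow_binomExp h, binomExp_zero]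

theorem diff_swap_pow (a b : G) (t : ℕ) (K : G → M) :
    (diff b a ^ t) K = (-1 : ℂ) ^ t • (diff a b ^ t) K := by
  have : diff (M := M) b a = (-1 : ℂ) • diff a b := by
    rw [diff, diff]; module
  rw [this, smul_pow, LinearMap.smul_apply]

end BinomialExpansion

/-! ### Dong's lemma -/

section Dong

variable {H : Type*} [AddCommGroup H] [Module ℂ H]

/-- The direction of the first variable `z` in `ℤ³`. -/
abbrev dirZ : ℤ × ℤ × ℤ := (1, 0, 0)

/-- The direction of the second variable `w` in `ℤ³`. -/
abbrev dirW : ℤ × ℤ × ℤ := (0, 1, 0)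

/-- The direction of the third variable `u` in `ℤ³`. -/
abbrev dirU : ℤ × ℤ × ℤ := (0, 0, 1)

theorem IsLocal.sum_apply_eq_zero {ε : ZMod 2} {N : ℕ} {A B : VertexOperator ℂ H}
    (h : IsLocal ε N A B) (m n : ℤ) (v : H) :
    ∑ k ∈ Finset.range (N + 1), ((-1) ^ k * (N.choose k : ℂ)) •
      ((A[[m + (N - k)]]) ((B[[n + k]]) v) - parSign ε • (B[[n + k]]) ((A[[m + (N - k)]]) v))
      = 0 := by
  simpa [superBracket] using LinearMap.congr_fun (h m n) v

/-- The difference of the two expansions of `(z - w)^n A(z) B(w)`, from the two orderings `K` and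
`K'` of a triple product. -/
def expansionDiff (ε : ZMod 2) (n : ℤ) (K K' : ℤ × ℤ × ℤ → H) : ℤ × ℤ × ℤ → H :=
  binomExp dirZ dirW n K - (parSign ε * (-1) ^ n) • binomExp dirW dirZ n K'

/-- The exponent t = N + max(-n, 0) makes n + t = N + max(n, 0). Both expansions then become the
same nonnegative power of z - w, and this power contains the factor (z - w)^N that identifies the
two orderings. -/
theorem diff_pow_expansionDiff {ε : ZMod 2} {n : ℤ} {N : ℕ} {K K' : ℤ × ℤ × ℤ → H}
    (hK : TruncIn (dirW - dirZ) K) (hK' : TruncIn (dirZ - dirW) K')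
    (h : (diff dirZ dirW ^ N) (K - parSign ε • K') = 0) :
    (diff dirZ dirW ^ (N + (-n).toNat)) (expansionDiff ε n K K') = 0 := by
  set t := N + (-n).toNat with ht
  have hn : n + (t : ℤ) = ((N + n.toNat : ℕ) : ℤ) := by omega
  rw [expansionDiff, map_sub, map_smul, diff_pow_binomExp_eq hK hn, diff_swap_pow dirW dirZ t,
    diff_pow_binomExp_eq hK' hn, diff_swap_pow dirZ dirW (N + n.toNat), smul_smul, smul_smul]
  have hs : (parSign ε * (-1) ^ n) * ((-1) ^ t * (-1) ^ (N + n.toNat)) = parSign ε := by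
    have : (-1 : ℂ) ^ n * (-1) ^ t = (-1) ^ (N + n.toNat) := by
      rw [← zpow_natCast, ← zpow_natCast, ← zpow_add₀ (by norm_num), hn]
    rw [← mul_assoc, mul_assoc (parSign ε), this, mul_assoc, ← mul_pow]
    simp
  rw [mul_assoc _ ((-1 : ℂ) ^ t), hs, ← map_smul, ← map_sub, add_comm N, pow_add, Module.End.mul_apply, h, map_zero]

theorem diff_pow_expansionDiff_comm {ε : ZMod 2} {n : ℤ} {N : ℕ} {K K' : ℤ × ℤ × ℤ → H}
    (hK : TruncIn (dirW - dirZ) K) (hK' : TruncIn (dirZ - dirW) K') (c d : ℤ × ℤ × ℤ) :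
    (diff c d ^ N) (expansionDiff ε n K K') =
      expansionDiff ε n ((diff c d ^ N) K) ((diff c d ^ N) K') := by
  rw [expansionDiff, map_sub, map_smul, ← binomExp_diff_pow hK, ← binomExp_diff_pow hK']
  rfl

theorem expansionDiff_smul (ε : ZMod 2) (n : ℤ) (r : ℂ) (K K' : ℤ × ℤ × ℤ → H) :
    expansionDiff ε n (r • K) (r • K') = r • expansionDiff ε n K K' := by
  rw [expansionDiff, expansionDiff, binomExp_smul, binomExp_smul, smul_sub, smul_comm r]

/-- The modes of A_nB are residues in z, that is, coefficients of index 0 in the first coordinate.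
The operator F stands for whatever is applied on the left, so that both C(u)(A_nB)(w) and
(A_nB)(w)C(u) are covered. -/
theorem nthProduct_apply_eq_expansionDiff (ε : ZMod 2) (n : ℤ) (A B : VertexOperator ℂ H)
    (K K' : ℤ × ℤ × ℤ → H) (F : Module.End ℂ H) (c : H) (j l : ℤ)
    (hK : TruncIn (dirW - dirZ) K) (hK' : TruncIn (dirZ - dirW) K')
    (h : ∀ i j, K (i, j, l) = F ((A[[i]]) ((B[[j]]) c)))
    (h' : ∀ i j, K' (i, j, l) = F ((B[[j]]) ((A[[i]]) c))) :
    F (((nthProduct ε n A B)[[j]]) c) = expansionDiff ε n K K' (0, j, l) := by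
  obtain ⟨P, hP⟩ := exists_nthProduct_apply_eq_sum ε n A B j c
  obtain ⟨P', hP'⟩ := exists_binomExp_eq_sum hK n (0, j, l)
  obtain ⟨P'', hP''⟩ := exists_binomExp_eq_sum hK' n (0, j, l)
  obtain ⟨Q, h1, h2, h3⟩ : ∃ Q, P ≤ Q ∧ P' ≤ Q ∧ P'' ≤ Q :=
    ⟨P + P' + P'', by omega, by omega, by omega⟩
  rw [expansionDiff, Pi.sub_apply, Pi.smul_apply, hP _ h1, hP' _ h2, hP'' _ h3, map_sum,
    Finset.smul_sum, ← Finset.sum_sub_distrib]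
  refine Finset.sum_congr rfl fun p _ => ?_
  have e1 : ((0, j, l) + n • dirZ + p • (dirW - dirZ) : ℤ × ℤ × ℤ) = (n - p, j + p, l) := by
    simp [sub_eq_add_neg]
  have e2 : ((0, j, l) + n • dirW + p • (dirZ - dirW) : ℤ × ℤ × ℤ) = ((p : ℤ), j + n - p, l) := by
    simp [sub_eq_add_neg]
  rw [e1, e2, h, h', nthProductTerm, smul_comm (parSign ε * (-1) ^ n), ← smul_sub]
  simp only [LinearMap.smul_apply, LinearMap.sub_apply, Module.End.mul_apply, map_smul, map_sub]

/-- Dong's lemma. -/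
theorem IsLocal.nthProduct_left {ε α β : ZMod 2} {N : ℕ} {A B C : VertexOperator ℂ H}
    (hAB : IsLocal ε N A B) (hAC : IsLocal α N A C) (hBC : IsLocal β N B C) (n : ℤ) :
    LocalTo (α + β) (nthProduct ε n A B) C := by
  set t := N + (-n).toNat with ht
  refine ⟨t + N + N, fun j l => LinearMap.ext fun v => ?_⟩
  let K₁ : ℤ × ℤ × ℤ → H := fun x => (A[[x.1]]) ((B[[x.2.1]]) ((C[[x.2.2]]) v))
  let K₂ : ℤ × ℤ × ℤ → H := fun x => (A[[x.1]]) ((C[[x.2.2]]) ((B[[x.2.1]]) v))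
  let K₃ : ℤ × ℤ × ℤ → H := fun x => (C[[x.2.2]]) ((A[[x.1]]) ((B[[x.2.1]]) v))
  let L₁ : ℤ × ℤ × ℤ → H := fun x => (B[[x.2.1]]) ((A[[x.1]]) ((C[[x.2.2]]) v))
  let L₂ : ℤ × ℤ × ℤ → H := fun x => (B[[x.2.1]]) ((C[[x.2.2]]) ((A[[x.1]]) v))
  let L₃ : ℤ × ℤ × ℤ → H := fun x => (C[[x.2.2]]) ((B[[x.2.1]]) ((A[[x.1]]) v))
  have tK₁ : TruncIn (dirW - dirZ) K₁ := fun ⟨x, y, z⟩ => by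
    obtain ⟨M, hM⟩ := exists_ncoeff_eq_zero B ((C[[z]]) v)
    refine ⟨(M - y).toNat, fun p hp => ?_⟩
    simp [K₁, hM (y + p) (by omega)]
  have tK₃ : TruncIn (dirW - dirZ) K₃ := fun ⟨x, y, z⟩ => by
    obtain ⟨M, hM⟩ := exists_ncoeff_eq_zero B v
    refine ⟨(M - y).toNat, fun p hp => ?_⟩
    simp [K₃, hM (y + p) (by omega)]
  have tL₁ : TruncIn (dirZ - dirW) L₁ := fun ⟨x, y, z⟩ => by
    obtain ⟨M, hM⟩ := exists_ncoeff_eq_zero A ((C[[z]]) v)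
    refine ⟨(M - x).toNat, fun p hp => ?_⟩
    simp [L₁, hM (x + p) (by omega)]
  have tL₃ : TruncIn (dirZ - dirW) L₃ := fun ⟨x, y, z⟩ => by
    obtain ⟨M, hM⟩ := exists_ncoeff_eq_zero A v
    refine ⟨(M - x).toNat, fun p hp => ?_⟩
    simp [L₃, hM (x + p) (by omega)]
  have f₁ : (diff dirW dirU ^ N) (K₁ - parSign β • K₂) = 0 := by
    funext ⟨x, y, z⟩
    rw [diff_pow_apply]
    have := congrArg (A[[x]]) (hBC.sum_apply_eq_zero y z v)
    simpa [K₁, K₂, map_sum] using this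
  have f₂ : (diff dirZ dirU ^ N) (K₂ - parSign α • K₃) = 0 := by
    funext ⟨x, y, z⟩
    rw [diff_pow_apply]
    have := hAC.sum_apply_eq_zero x z ((B[[y]]) v)
    simpa [K₂, K₃] using this
  have g₁ : (diff dirZ dirU ^ N) (L₁ - parSign α • L₂) = 0 := by
    funext ⟨x, y, z⟩
    rw [diff_pow_apply]
    have := congrArg (B[[y]]) (hAC.sum_apply_eq_zero x z v)
    simpa [L₁, L₂, map_sum] using this
  have g₂ : (diff dirW dirU ^ N) (L₂ - parSign β • L₃) = 0 := by
    funext ⟨x, y, z⟩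
    rw [diff_pow_apply]
    have := hBC.sum_apply_eq_zero y z ((A[[x]]) v)
    simpa [L₂, L₃] using this
  have e₁ : (diff dirZ dirW ^ N) (K₁ - parSign ε • L₁) = 0 := by
    funext ⟨x, y, z⟩
    rw [diff_pow_apply]
    have := hAB.sum_apply_eq_zero x y ((C[[z]]) v)
    simpa [K₁, L₁] using this
  have e₃ : (diff dirZ dirW ^ N) (K₃ - parSign ε • L₃) = 0 := by
    funext ⟨x, y, z⟩
    rw [diff_pow_apply]
    have := congrArg (C[[z]]) (hAB.sum_apply_eq_zero x y v)
    simpa [K₃, L₃, map_sum] using this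
  have hcomm := ((diff_commute (M := H) dirZ dirU dirW dirU).pow_pow N N).eq
  -- The factors (z - u)^N and (w - u)^N let C pass A and B, one after the other; the signs multiply
  -- to that of α + β.
  have hK : (diff dirZ dirU ^ N) ((diff dirW dirU ^ N) K₁) =
      parSign (α + β) • (diff dirZ dirU ^ N) ((diff dirW dirU ^ N) K₃) := by
    rw [map_sub, map_smul, sub_eq_zero] at f₁ f₂
    rw [f₁, map_smul, ← Module.End.mul_apply, hcomm, Module.End.mul_apply, f₂, map_smul,
      smul_smul, ← Module.End.mul_apply, ← hcomm, Module.End.mul_apply, parSign_add, mul_comm]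
  have hL : (diff dirZ dirU ^ N) ((diff dirW dirU ^ N) L₁) =
      parSign (α + β) • (diff dirZ dirU ^ N) ((diff dirW dirU ^ N) L₃) := by
    rw [map_sub, map_smul, sub_eq_zero] at g₁ g₂
    rw [← Module.End.mul_apply, hcomm, Module.End.mul_apply, g₁, map_smul,
      ← Module.End.mul_apply, ← hcomm, Module.End.mul_apply, g₂, map_smul, smul_smul, parSign_add]
  set D : ℤ × ℤ × ℤ → H :=
    expansionDiff ε n K₁ L₁ - parSign (α + β) • expansionDiff ε n K₃ L₃ with hD
  have hD₁ : (diff dirZ dirW ^ t) D = 0 := by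
    rw [hD, map_sub, map_smul, diff_pow_expansionDiff tK₁ tL₁ e₁,
      diff_pow_expansionDiff tK₃ tL₃ e₃, smul_zero, sub_zero]
  have hD₂ : (diff dirZ dirU ^ N) ((diff dirW dirU ^ N) D) = 0 := by
    rw [hD, map_sub, map_sub, map_smul, map_smul, diff_pow_expansionDiff_comm tK₁ tL₁,
      diff_pow_expansionDiff_comm tK₃ tL₃,
      diff_pow_expansionDiff_comm (tK₁.diff_pow _ _ _) (tL₁.diff_pow _ _ _),
      diff_pow_expansionDiff_comm (tK₃.diff_pow _ _ _) (tL₃.diff_pow _ _ _), hK, hL,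
      expansionDiff_smul, sub_self]
  -- D is killed by (z - w)^t and by (z - u)^N (w - u)^N. Writing w - u = (w - z) + (z - u) in t + N
  -- of the factors shows that a power of w - u alone kills D, and such a power respects the residue
  -- in z.
  have hD₃ : (diff dirW dirU ^ (t + N + N)) D = 0 := by
    have hsum : diff (M := H) dirW dirU = diff dirW dirZ + diff dirZ dirU := by
      rw [diff, diff, diff]; abel
    rw [pow_add, Module.End.mul_apply]
    nth_rewrite 1 [hsum]
    refine add_pow_apply_eq_zero (diff_commute _ _ _ _) t N _ ?_ hD₂
    rw [diff_swap_pow dirZ dirW, ← Module.End.mul_apply,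
      ((diff_commute (M := H) dirZ dirW dirW dirU).pow_pow t N).eq, Module.End.mul_apply, hD₁,
      map_zero, smul_zero]
  have hval : ∀ j l, (superBracket (α + β) ((nthProduct ε n A B)[[j]]) (C[[l]])) v =
      D (0, j, l) := by
    intro j l
    rw [superBracket, hD, LinearMap.sub_apply, LinearMap.smul_apply, Module.End.mul_apply,
      Module.End.mul_apply, Pi.sub_apply, Pi.smul_apply]
    rw [← nthProduct_apply_eq_expansionDiff ε n A B K₁ L₁ 1 ((C[[l]]) v) j l tK₁ tL₁
        (fun _ _ => rfl) (fun _ _ => rfl),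
      ← nthProduct_apply_eq_expansionDiff ε n A B K₃ L₃ (C[[l]]) v j l tK₃ tL₃
        (fun _ _ => rfl) (fun _ _ => rfl)]
    rfl
  have := congrFun hD₃ (0, j, l)
  rw [diff_pow_apply] at this
  simp only [LinearMap.sum_apply, LinearMap.smul_apply, hval]
  simpa using this

theorem LocalTo.nthProduct_left {ε α β : ZMod 2} {A B C : VertexOperator ℂ H}
    (hAB : LocalTo ε A B) (hAC : LocalTo α A C) (hBC : LocalTo β B C) (n : ℤ) :
    LocalTo (α + β) (nthProduct ε n A B) C := by
  obtain ⟨N₁, h₁⟩ := hAB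
  obtain ⟨N₂, h₂⟩ := hAC
  obtain ⟨N₃, h₃⟩ := hBC
  exact IsLocal.nthProduct_left (N := N₁ + N₂ + N₃) (h₁.mono (by omega)) (h₂.mono (by omega))
    (h₃.mono (by omega)) n

end Dong

theorem eq_zero_of_eq_neg {M : Type*} [AddCommGroup M] [Module ℂ M] {x : M} (h : x = -x) :
    x = 0 := by
  have : (2 : ℂ) • x = 0 := by
    rw [two_smul]
    nth_rewrite 1 [h]
    exact neg_add_cancel x
  simpa using this

/-! ### Homogeneous fields and the state-field correspondence -/

section Homogeneous

variable {H : Type*} [AddCommGroup H] [Module ℂ H]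

theorem ncoeff_idField (n : ℤ) : (idField H)[[n]] = if n = -1 then 1 else 0 := by
  rw [idField, ncoeff_mkField]

theorem ncoeff_derivField (A : VertexOperator ℂ H) (n : ℤ) :
    (derivField A)[[n]] = (-n : ℂ) • A[[n - 1]] := by
  rw [derivField, ncoeff_mkField]

theorem isLocal_idField_left (A : VertexOperator ℂ H) : IsLocal 0 0 (idField H) A := by
  intro m n
  simp only [ncoeff_idField, superBracket, parSign_zero, one_smul, zero_add,
    Finset.sum_range_one]
  split_ifs <;> simp

theorem choose_mul_sub (n : ℤ) (p : ℕ) :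
    ((Ring.choose n p : ℤ) : ℂ) * (n - p) = (Ring.choose n (p + 1) : ℤ) * (p + 1) := by
  have h := Ring.choose_smul_choose n (Nat.le_succ p)
  rw [Nat.succ_eq_add_one, Nat.choose_succ_self_right, Nat.add_sub_cancel_left,
    Ring.choose_one_right, nsmul_eq_mul] at h
  rw [mul_comm ((Ring.choose n (p + 1) : ℤ) : ℂ)]
  exact_mod_cast h.symm

theorem choose_neg_two (p : ℕ) : (-1 : ℂ) ^ p * ((Ring.choose (-2 : ℤ) p : ℤ) : ℂ) = p + 1 := by
  induction p with
  | zero => simp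
  | succ p ih =>
    have h := choose_mul_sub (-2) p
    have hp : (p : ℂ) + 1 ≠ 0 := Nat.cast_add_one_ne_zero p
    apply mul_right_cancel₀ hp
    rw [mul_assoc, ← h, pow_succ]
    push_cast
    linear_combination (p + 2 : ℂ) * ih

theorem choose_neg_one (p : ℕ) : (-1 : ℂ) ^ p * ((Ring.choose (-1 : ℤ) p : ℤ) : ℂ) = 1 := by
  induction p with
  | zero => simp
  | succ p ih =>
    have h := choose_mul_sub (-1) p
    have hp : (p : ℂ) + 1 ≠ 0 := Nat.cast_add_one_ne_zero p
    apply mul_right_cancel₀ hp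
    rw [mul_assoc, ← h, pow_succ]
    push_cast
    linear_combination (p + 1 : ℂ) * ih

theorem sum_range_ite_and {M : Type*} [AddCommMonoid M] {q K : ℕ} (Q : Prop) [Decidable Q] (x : M)
    (hq : q < K) :
    ∑ p ∈ Finset.range K, (if p = q ∧ Q then x else 0) = if Q then x else 0 := by
  by_cases hQ : Q <;> simp [hQ, hq]

/-- The derivative is a product with the identity field. -/
theorem derivField_eq_nthProduct (A : VertexOperator ℂ H) :
    derivField A = nthProduct 0 (-2) A (idField H) := by
  refine field_ext fun n => LinearMap.ext fun c => ?_
  obtain ⟨P, hP⟩ := exists_nthProduct_apply_eq_sum 0 (-2) A (idField H) n c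
  rw [hP _ (le_max_left P (n.natAbs + 1)), ncoeff_derivField]
  -- The identity field has a single nonzero mode, so at most one p survives: in the first product
  -- when n < 0, in the second when n > 0. In both cases its weight is p + 1 = |n|.
  have hterm : ∀ p : ℕ, nthProductTerm 0 (-2) A (idField H) n p c =
      (if p = (-1 - n).toNat ∧ n ≤ -1 then (-n : ℂ) • (A[[n - 1]]) c else 0) +
      (if p = (n - 1).toNat ∧ 1 ≤ n then (-n : ℂ) • (A[[n - 1]]) c else 0) := by
    intro p
    rw [nthProductTerm, choose_neg_two, ncoeff_idField, ncoeff_idField, parSign_zero]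
    by_cases h1 : n + p = -1
    · rw [if_pos h1, if_neg (by omega), if_pos ⟨by omega, by omega⟩, if_neg (by omega)]
      have : (p : ℂ) + 1 = -n := by
        have : (p : ℤ) + 1 = -n := by omega
        exact_mod_cast this
      rw [this, show (-2 : ℤ) - p = n - 1 by omega]
      simp
    · rw [if_neg h1, if_neg (show ¬(p = (-1 - n).toNat ∧ n ≤ -1) by omega)]
      by_cases h2 : n + -2 - p = -1
      · rw [if_pos h2, if_pos ⟨by omega, by omega⟩]
        have : (p : ℂ) + 1 = n := by
          have : (p : ℤ) + 1 = n := by omega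
          exact_mod_cast this
        rw [this, show (p : ℤ) = n - 1 by omega]
        simp
      · rw [if_neg h2, if_neg (by omega)]
        simp
  simp only [hterm, Finset.sum_add_distrib]
  rw [sum_range_ite_and _ _ (by omega), sum_range_ite_and _ _ (by omega)]
  rcases lt_trichotomy n 0 with h | h | h
  · rw [if_pos (by omega), if_neg (by omega), add_zero]; rfl
  · subst h; simp
  · rw [if_neg (by omega), if_pos (by omega), zero_add]; rfl

variable (H) in
/-- A vacuum vector, a translation operator, a parity involution, and sets of even and odd
generating fields. -/
structure VacuumData where
  Ω : H
  T : Module.End ℂ H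
  θ : Module.End ℂ H
  even : Set (VertexOperator ℂ H)
  odd : Set (VertexOperator ℂ H)
  T_vac : T Ω = 0
  θ_vac : θ Ω = Ω
  cyclic : ∀ W : Submodule ℂ H, Ω ∈ W →
    (∀ A ∈ even ∪ odd, ∀ n, ∀ v ∈ W, (A[[n]]) v ∈ W) → W = ⊤

/-- A translation covariant field of parity `p` that creates a state from the vacuum and is local
to the generators. -/
structure VacuumData.IsHomogeneous (D : VacuumData H) (p : ZMod 2) (A : VertexOperator ℂ H) :
    Prop where
  local_even : ∀ B ∈ D.even, LocalTo 0 A B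
  local_odd : ∀ B ∈ D.odd, LocalTo p A B
  parity : ∀ n v, D.θ ((A[[n]]) v) = parSign p • (A[[n]]) (D.θ v)
  vacuum : ∀ n, 0 ≤ n → (A[[n]]) D.Ω = 0
  translation : ∀ n v, D.T ((A[[n]]) v) = (A[[n]]) (D.T v) + (-n : ℂ) • (A[[n - 1]]) v

theorem nthProduct_apply_eq_zero {ε : ZMod 2} {A B : VertexOperator ℂ H} {Ω : H}
    (hA : ∀ n, 0 ≤ n → (A[[n]]) Ω = 0) (hB : ∀ n, 0 ≤ n → (B[[n]]) Ω = 0) (n : ℤ) {m : ℤ}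
    (hm : 0 ≤ m) : ((nthProduct ε n A B)[[m]]) Ω = 0 := by
  rw [nthProduct, ncoeff_mkField]
  refine finsum_eq_zero_of_forall_eq_zero fun p => ?_
  simp [nthProductTerm, hA p (by omega), hB (m + p) (by omega)]

/-- On Ω only the summand p = 0 of the first product survives. This turns the coefficients of an
operator product expansion into vectors. -/
theorem stateOf_nthProduct {ε : ZMod 2} {A B : VertexOperator ℂ H} {Ω : H}
    (hA : ∀ n, 0 ≤ n → (A[[n]]) Ω = 0) (hB : ∀ n, 0 ≤ n → (B[[n]]) Ω = 0) (n : ℤ) :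
    stateOf Ω (nthProduct ε n A B) = (A[[n]]) (stateOf Ω B) := by
  rw [stateOf, nthProduct, ncoeff_mkField]
  refine (finsum_eq_single _ 0 fun p hp => ?_).trans ?_
  · simp [nthProductTerm, hA p (by omega), hB (-1 + p) (by omega)]
  · simp [nthProductTerm, hA 0 le_rfl, stateOf]

theorem intertwine_nthProduct {ε : ZMod 2} {A B : VertexOperator ℂ H} {θ : Module.End ℂ H}
    {r s : ℂ} (hA : ∀ n v, θ ((A[[n]]) v) = r • (A[[n]]) (θ v))
    (hB : ∀ n v, θ ((B[[n]]) v) = s • (B[[n]]) (θ v)) (n m : ℤ) (v : H) :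
    θ (((nthProduct ε n A B)[[m]]) v) = (r * s) • ((nthProduct ε n A B)[[m]]) (θ v) := by
  obtain ⟨P, hP⟩ := exists_nthProduct_apply_eq_sum ε n A B m v
  obtain ⟨P', hP'⟩ := exists_nthProduct_apply_eq_sum ε n A B m (θ v)
  rw [hP _ (le_max_left P P'), hP' _ (le_max_right P P'), map_sum, Finset.smul_sum]
  refine Finset.sum_congr rfl fun p _ => ?_
  simp only [nthProductTerm, LinearMap.smul_apply, LinearMap.sub_apply, Module.End.mul_apply,
    map_smul, map_sub, hA, hB, smul_sub, smul_smul]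
  congr 2 <;> ring

/-- T differentiates both factors, and the derivative of (z - w)^n cancels between z and w. For
coefficients this is a summation by parts, based on (n - p) C(n, p) = (p + 1) C(n, p + 1). -/
theorem translation_nthProduct {ε : ZMod 2} {A B : VertexOperator ℂ H} {T : Module.End ℂ H}
    (hA : ∀ n v, T ((A[[n]]) v) = (A[[n]]) (T v) + (-n : ℂ) • (A[[n - 1]]) v)
    (hB : ∀ n v, T ((B[[n]]) v) = (B[[n]]) (T v) + (-n : ℂ) • (B[[n - 1]]) v) (n m : ℤ) (v : H) :
    T (((nthProduct ε n A B)[[m]]) v) = ((nthProduct ε n A B)[[m]]) (T v) +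
      (-m : ℂ) • ((nthProduct ε n A B)[[m - 1]]) v := by
  obtain ⟨P, hP⟩ := exists_nthProduct_apply_eq_sum ε n A B m v
  obtain ⟨P', hP'⟩ := exists_nthProduct_apply_eq_sum ε n A B m (T v)
  obtain ⟨P'', hP''⟩ := exists_nthProduct_apply_eq_sum ε n A B (m - 1) v
  obtain ⟨M, hM⟩ := exists_ncoeff_eq_zero A v
  obtain ⟨M', hM'⟩ := exists_ncoeff_eq_zero B v
  obtain ⟨Q, h1, h2, h3, h4, h5⟩ : ∃ Q : ℕ, P ≤ Q ∧ P' ≤ Q ∧ P'' ≤ Q ∧ M < Q ∧ M' - m < Q :=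
    ⟨P + P' + P'' + M.toNat + (M' - m).toNat + 1, by omega, by omega, by omega, by omega,
      by omega⟩
  -- The two sides differ by the sum of u (p + 1) - u p. It telescopes to zero, because u carries
  -- the factor p and vanishes for large p by truncation.
  let u : ℕ → H := fun p => (p * ((-1) ^ p * ((Ring.choose n p : ℤ) : ℂ))) •
    ((A[[n - p]]) ((B[[m + p - 1]]) v) -
      (parSign ε * (-1) ^ n) • (B[[m + n - p]]) ((A[[(p : ℤ) - 1]]) v))
  have hu : u Q = 0 := by
    simp only [u]
    rw [hM (Q - 1) (by omega), hM' (m + Q - 1) (by omega)]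
    simp
  have hu0 : u 0 = 0 := by simp [u]
  rw [hP _ h1, hP' _ h2, hP'' _ h3, map_sum, ← sub_eq_iff_eq_add', Finset.smul_sum,
    ← Finset.sum_sub_distrib, ← sub_eq_zero, ← Finset.sum_sub_distrib]
  trans ∑ p ∈ Finset.range Q, (u (p + 1) - u p)
  · refine Finset.sum_congr rfl fun p _ => ?_
    have hc := choose_mul_sub n p
    simp only [u, nthProductTerm, LinearMap.smul_apply, LinearMap.sub_apply, Module.End.mul_apply,
      map_smul, map_sub, map_add, hA, hB]
    rw [show m - 1 + (p : ℤ) = m + p - 1 by ring, show m - 1 + n - (p : ℤ) = m + n - p - 1 by ring]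
    push_cast
    rw [show n - ((p : ℤ) + 1) = n - p - 1 by ring, show m + ((p : ℤ) + 1) - 1 = m + p by ring,
      show m + n - ((p : ℤ) + 1) = m + n - p - 1 by ring, show (p : ℤ) + 1 - 1 = p by ring,
      pow_succ,
      show ((p : ℂ) + 1) * ((-1) ^ p * -1 * ((Ring.choose n (p + 1) : ℤ) : ℂ)) =
        -((-1) ^ p) * (((Ring.choose n (p + 1) : ℤ) : ℂ) * (p + 1)) by ring, ← hc]
    module
  · rw [Finset.sum_range_sub, hu, hu0, sub_zero]

namespace VacuumData.IsHomogeneous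

variable {D : VacuumData H} {p q : ZMod 2} {A B : VertexOperator ℂ H}

theorem add (hA : D.IsHomogeneous p A) (hB : D.IsHomogeneous p B) :
    D.IsHomogeneous p (A + B) where
  local_even C hC := (hA.local_even C hC).add_left (hB.local_even C hC)
  local_odd C hC := (hA.local_odd C hC).add_left (hB.local_odd C hC)
  parity n v := by
    rw [ncoeff_add, LinearMap.add_apply, map_add, hA.parity, hB.parity, ← smul_add]; rfl
  vacuum n hn := by rw [ncoeff_add, LinearMap.add_apply, hA.vacuum n hn, hB.vacuum n hn, add_zero]
  translation n v := by
    simp only [ncoeff_add, LinearMap.add_apply, map_add, hA.translation, hB.translation]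
    module

theorem smul (r : ℂ) (hA : D.IsHomogeneous p A) : D.IsHomogeneous p (r • A) where
  local_even C hC := (hA.local_even C hC).smul_left r
  local_odd C hC := (hA.local_odd C hC).smul_left r
  parity n v := by
    rw [ncoeff_smul, LinearMap.smul_apply, map_smul, hA.parity, smul_comm]; rfl
  vacuum n hn := by rw [ncoeff_smul, LinearMap.smul_apply, hA.vacuum n hn, smul_zero]
  translation n v := by
    simp only [ncoeff_smul, LinearMap.smul_apply, map_smul, hA.translation]
    module

theorem zero (D : VacuumData H) (p : ZMod 2) : D.IsHomogeneous p 0 where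
  local_even C _ := LocalTo.zero_left _ _
  local_odd C _ := LocalTo.zero_left _ _
  parity n v := by simp [ncoeff_zero]
  vacuum n hn := by simp [ncoeff_zero]
  translation n v := by simp [ncoeff_zero]

theorem sum {κ : Type*} (s : Finset κ) (f : κ → VertexOperator ℂ H)
    (h : ∀ i ∈ s, D.IsHomogeneous p (f i)) : D.IsHomogeneous p (∑ i ∈ s, f i) :=
  Finset.sum_induction f (D.IsHomogeneous p) (fun _ _ => add) (zero D p) h

theorem id (D : VacuumData H) : D.IsHomogeneous 0 (idField H) where
  local_even C _ := (isLocal_idField_left C).localTo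
  local_odd C _ := (isLocal_idField_left C).localTo
  parity n v := by
    rw [ncoeff_idField, parSign_zero, one_smul]
    split_ifs <;> simp
  vacuum n hn := by rw [ncoeff_idField, if_neg (by omega)]; rfl
  translation n v := by
    rw [ncoeff_idField, ncoeff_idField]
    by_cases h : n = -1
    · subst h; simp
    · by_cases h0 : n = 0
      · subst h0; simp
      · rw [if_neg h, if_neg (by omega)]; simp

theorem nthProduct {ε : ZMod 2} (hA : D.IsHomogeneous p A) (hB : D.IsHomogeneous q B)
    (hAB : LocalTo ε A B) (n : ℤ) : D.IsHomogeneous (p + q) (nthProduct ε n A B) where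
  local_even C hC := by
    simpa using hAB.nthProduct_left (hA.local_even C hC) (hB.local_even C hC) n
  local_odd C hC := hAB.nthProduct_left (hA.local_odd C hC) (hB.local_odd C hC) n
  parity m v := by
    rw [parSign_add]; exact intertwine_nthProduct hA.parity hB.parity n m v
  vacuum m hm := nthProduct_apply_eq_zero hA.vacuum hB.vacuum n hm
  translation m v := translation_nthProduct hA.translation hB.translation n m v

/-- The vectors killed by all modes of A form a subspace that is stable under the modes of any field
local to A. As it contains Ω, cyclicity makes it all of H. -/
theorem eq_zero_of_apply_vac (hA : D.IsHomogeneous p A) (h : ∀ n, (A[[n]]) D.Ω = 0) : A = 0 := by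
  let W : Submodule ℂ H := ⨅ n : ℤ, LinearMap.ker (A[[n]])
  have hW : ∀ v, v ∈ W ↔ ∀ n, (A[[n]]) v = 0 := fun v => by simp [W]
  have closed : ∀ (ε : ZMod 2) (B : VertexOperator ℂ H), LocalTo ε A B →
      ∀ n, ∀ v ∈ W, (B[[n]]) v ∈ W := by
    rintro ε B ⟨N, hN⟩ n v hv
    rw [hW] at hv
    obtain ⟨M, hM⟩ := exists_ncoeff_eq_zero B v
    -- Descending induction on n from the point where B(n)v = 0. The terms B A v of the locality
    -- relation vanish, so it expresses A(m)B(n)v through vectors A(m-j)B(n+j)v with j ≥ 1.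
    have key : ∀ (k : ℕ) (n : ℤ), M - k ≤ n → ∀ m, (A[[m]]) ((B[[n]]) v) = 0 := by
      intro k
      induction k with
      | zero => intro n hn m; rw [hM n (by omega), map_zero]
      | succ k ih =>
        intro n hn m
        have := hN.sum_apply_eq_zero (m - N) n v
        rw [Finset.sum_range_succ'] at this
        rw [Finset.sum_eq_zero] at this
        · simpa [hv] using this
        · intro j _
          rw [ih (n + (j + 1 : ℕ)) (by push_cast at hn ⊢; omega), hv]
          simp
    exact (hW _).2 (key (M - n).toNat n (by omega))
  have htop : W = ⊤ := by
    refine D.cyclic W ((hW _).2 h) ?_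
    rintro B (hB | hB)
    · exact closed 0 B (hA.local_even B hB)
    · exact closed p B (hA.local_odd B hB)
  refine field_ext fun n => LinearMap.ext fun v => ?_
  rw [ncoeff_zero]
  exact (hW v).1 (htop ▸ Submodule.mem_top) n

/-- Covariance and TΩ = 0 give T A(-1-k)Ω = (k+1) A(-2-k)Ω, so the state determines all of A(z)Ω. -/
theorem apply_vac_eq_zero (hA : D.IsHomogeneous p A) (h : stateOf D.Ω A = 0) (n : ℤ) :
    (A[[n]]) D.Ω = 0 := by
  rcases le_or_gt 0 n with hn | hn
  · exact hA.vacuum n hn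
  · obtain ⟨k, rfl⟩ : ∃ k : ℕ, n = -1 - k := ⟨(-1 - n).toNat, by omega⟩
    clear hn
    induction k with
    | zero => simpa [stateOf] using h
    | succ k ih =>
      have := hA.translation (-1 - k) D.Ω
      rw [ih, D.T_vac, map_zero, map_zero, zero_add, eq_comm, smul_eq_zero] at this
      rcases this with h0 | h0
      · exfalso
        have : ((k + 1 : ℕ) : ℂ) = 0 := by push_cast at h0 ⊢; linear_combination h0
        exact Nat.cast_ne_zero.2 (Nat.succ_ne_zero k) this
      · rw [← h0]; push_cast; ring_nf

/-- A homogeneous field is determined by its state. -/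
theorem eq_zero (hA : D.IsHomogeneous p A) (h : stateOf D.Ω A = 0) : A = 0 :=
  hA.eq_zero_of_apply_vac (hA.apply_vac_eq_zero h)

theorem ext (hA : D.IsHomogeneous p A) (hB : D.IsHomogeneous p B)
    (h : stateOf D.Ω A = stateOf D.Ω B) : A = B := by
  rw [← sub_eq_zero, sub_eq_add_neg, ← neg_one_smul ℂ B]
  refine (hA.add (hB.smul (-1))).eq_zero ?_
  rw [stateOf] at *
  rw [ncoeff_add, ncoeff_smul, LinearMap.add_apply, LinearMap.smul_apply, h, stateOf]
  module

/-- Elements of a linear span of fields need not have a parity. The involution θ separates the even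
and odd parts of the state, after which each part is treated alone. -/
theorem add_eq_zero (hA : D.IsHomogeneous 0 A) (hB : D.IsHomogeneous 1 B)
    (h : stateOf D.Ω (A + B) = 0) : A + B = 0 := by
  rw [stateOf, ncoeff_add, LinearMap.add_apply] at h
  have h' := congrArg D.θ h
  rw [map_add, hA.parity, hB.parity, D.θ_vac, parSign_zero, parSign_one, map_zero] at h'
  have hA0 : (A[[-1]]) D.Ω = 0 := by
    have : (2 : ℂ) • (A[[-1]]) D.Ω = 0 := by
      rw [← add_zero (0 : H)]
      nth_rewrite 1 [← h]
      rw [← h']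
      module
    simpa using this
  rw [hA.eq_zero hA0, hB.eq_zero (by rwa [hA0, zero_add] at h), add_zero]

end VacuumData.IsHomogeneous

namespace VacuumData

/-- A homogeneous field that is local to all homogeneous fields. -/
structure IsVertexField (D : VacuumData H) (p : ZMod 2) (A : VertexOperator ℂ H) : Prop
    extends D.IsHomogeneous p A where
  localTo : ∀ q B, D.IsHomogeneous q B → LocalTo (p * q) A B

namespace IsVertexField

variable {D : VacuumData H} {p q : ZMod 2} {A B : VertexOperator ℂ H}

theorem add (hA : D.IsVertexField p A) (hB : D.IsVertexField p B) :
    D.IsVertexField p (A + B) :=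
  ⟨hA.toIsHomogeneous.add hB.toIsHomogeneous,
    fun q C hC => (hA.localTo q C hC).add_left (hB.localTo q C hC)⟩

theorem smul (r : ℂ) (hA : D.IsVertexField p A) : D.IsVertexField p (r • A) :=
  ⟨hA.toIsHomogeneous.smul r, fun q C hC => (hA.localTo q C hC).smul_left r⟩

theorem zero (D : VacuumData H) (p : ZMod 2) : D.IsVertexField p 0 :=
  ⟨.zero D p, fun _ _ _ => LocalTo.zero_left _ _⟩

theorem id (D : VacuumData H) : D.IsVertexField 0 (idField H) :=
  ⟨.id D, fun q C _ => by rw [zero_mul]; exact (isLocal_idField_left C).localTo⟩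

theorem nthProduct {ε : ZMod 2} (hA : D.IsVertexField p A) (hB : D.IsVertexField q B)
    (hAB : LocalTo ε A B) (n : ℤ) : D.IsVertexField (p + q) (nthProduct ε n A B) :=
  ⟨hA.toIsHomogeneous.nthProduct hB.toIsHomogeneous hAB n, fun r C hC => by
    rw [add_mul]; exact hAB.nthProduct_left (hA.localTo r C hC) (hB.localTo r C hC) n⟩

theorem deriv (hA : D.IsVertexField p A) : D.IsVertexField p (derivField A) := by
  rw [derivField_eq_nthProduct]
  simpa using hA.nthProduct (.id D) (isLocal_idField_left A).symm.localTo (-2)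

end IsVertexField

variable (D : VacuumData H) (h₀ : ∀ A ∈ D.even, D.IsHomogeneous 0 A)
  (h₁ : ∀ A ∈ D.odd, D.IsHomogeneous 1 A)

/-- The space of fields generated by the even and odd generators. -/
abbrev fields : Submodule ℂ (VertexOperator ℂ H) := fieldSpace (D.even ∪ D.odd)

include h₀ h₁ in
-- The sign ε with which two generated fields are multiplied need not come from their own parities.
-- Dong's lemma puts no condition on it, so the parities of the factors simply add.
theorem exists_isVertexField {A : VertexOperator ℂ H} (hA : Generated (D.even ∪ D.odd) A) :
    ∃ p, D.IsVertexField p A := by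
  induction hA with
  | id => exact ⟨0, .id D⟩
  | of A hA =>
    rcases hA with hA | hA
    · exact ⟨0, h₀ A hA, fun q B hB => by rw [zero_mul]; exact (hB.local_even A hA).symm⟩
    · exact ⟨1, h₁ A hA, fun q B hB => by rw [one_mul]; exact (hB.local_odd A hA).symm⟩
  | nthProduct ε N n A B _ _ hAB ihA ihB =>
    obtain ⟨p, hp⟩ := ihA
    obtain ⟨q, hq⟩ := ihB
    exact ⟨p + q, hp.nthProduct hq hAB.localTo n⟩
  | deriv A _ ih =>
    obtain ⟨p, hp⟩ := ih
    exact ⟨p, hp.deriv⟩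

include h₀ h₁ in
theorem exists_even_add_odd {A : VertexOperator ℂ H} (hA : A ∈ D.fields) :
    ∃ A₀ A₁, A = A₀ + A₁ ∧ D.IsVertexField 0 A₀ ∧ D.IsVertexField 1 A₁ := by
  induction hA using Submodule.span_induction with
  | mem A hA =>
    obtain ⟨p, hp⟩ := D.exists_isVertexField h₀ h₁ hA
    have h : ∀ p : ZMod 2, p = 0 ∨ p = 1 := by decide
    rcases h p with rfl | rfl
    · exact ⟨A, 0, (add_zero A).symm, hp, .zero D 1⟩
    · exact ⟨0, A, (zero_add A).symm, .zero D 0, hp⟩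
  | zero => exact ⟨0, 0, (add_zero 0).symm, .zero D 0, .zero D 1⟩
  | add A B _ _ ihA ihB =>
    obtain ⟨A₀, A₁, rfl, h₀, h₁⟩ := ihA
    obtain ⟨B₀, B₁, rfl, k₀, k₁⟩ := ihB
    exact ⟨A₀ + B₀, A₁ + B₁, by abel, h₀.add k₀, h₁.add k₁⟩
  | smul r A _ ih =>
    obtain ⟨A₀, A₁, rfl, h₀, h₁⟩ := ih
    exact ⟨r • A₀, r • A₁, smul_add r A₀ A₁, h₀.smul r, h₁.smul r⟩

include h₀ h₁ in
/-- A field of the generated space whose state has parity `p` is itself of parity `p`. -/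
theorem isVertexField_of_parity {A : VertexOperator ℂ H} (hA : A ∈ D.fields) {p : ZMod 2}
    (h : D.θ (stateOf D.Ω A) = parSign p • stateOf D.Ω A) : D.IsVertexField p A := by
  obtain ⟨B, C, rfl, hB, hC⟩ := D.exists_even_add_odd h₀ h₁ hA
  rw [stateOf, ncoeff_add, LinearMap.add_apply, map_add, hB.parity, hC.parity, D.θ_vac,
    parSign_zero, parSign_one] at h
  have hp : ∀ p : ZMod 2, p = 0 ∨ p = 1 := by decide
  rcases hp p with rfl | rfl
  · have : stateOf D.Ω C = 0 := by
      refine eq_zero_of_eq_neg ?_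
      rw [parSign_zero, one_smul, one_smul, add_right_inj, neg_one_smul ℂ] at h
      exact h.symm
    rwa [hC.toIsHomogeneous.eq_zero this, add_zero]
  · have : stateOf D.Ω B = 0 := by
      refine eq_zero_of_eq_neg ?_
      rw [parSign_one, smul_add, one_smul, add_left_inj, neg_one_smul ℂ] at h
      exact h
    rwa [hB.toIsHomogeneous.eq_zero this, zero_add]

end VacuumData

theorem stateOf_add (Ω : H) (A B : VertexOperator ℂ H) :
    stateOf Ω (A + B) = stateOf Ω A + stateOf Ω B := by
  rw [stateOf, ncoeff_add]; rfl

theorem stateOf_smul (Ω : H) (r : ℂ) (A : VertexOperator ℂ H) :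
    stateOf Ω (r • A) = r • stateOf Ω A := by
  rw [stateOf, ncoeff_smul]; rfl

/-- A field of the generated space is determined by its state. -/
theorem VacuumData.stateOf_injOn (D : VacuumData H) (h₀ : ∀ A ∈ D.even, D.IsHomogeneous 0 A)
    (h₁ : ∀ A ∈ D.odd, D.IsHomogeneous 1 A) {A B : VertexOperator ℂ H}
    (hA : A ∈ D.fields) (hB : B ∈ D.fields)
    (h : stateOf D.Ω A = stateOf D.Ω B) : A = B := by
  obtain ⟨C₀, C₁, hC, k₀, k₁⟩ := D.exists_even_add_odd h₀ h₁
    (Submodule.add_mem _ hA (Submodule.smul_mem _ (-1) hB))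
  have : A + (-1 : ℂ) • B = 0 := by
    rw [hC]
    refine k₀.toIsHomogeneous.add_eq_zero k₁.toIsHomogeneous ?_
    rw [← hC, stateOf_add, stateOf_smul, h]
    module
  rw [← sub_eq_zero, sub_eq_add_neg, ← neg_one_smul ℂ B]
  exact this

/-- Every vector is the state of a field of the generated space. -/
theorem VacuumData.exists_stateOf_eq (D : VacuumData H)
    (h₀ : ∀ A ∈ D.even, D.IsHomogeneous 0 A) (h₁ : ∀ A ∈ D.odd, D.IsHomogeneous 1 A) (v : H) :
    ∃ A ∈ D.fields, stateOf D.Ω A = v := by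
  -- The span of the states contains Ω, the state of the identity, and is stable under generating
  -- modes, because A(n) maps the state of B to the state of A_nB.
  let W : Submodule ℂ H := Submodule.span ℂ (stateOf D.Ω '' {A | Generated (D.even ∪ D.odd) A})
  have hW : W = ⊤ := by
    refine D.cyclic W (Submodule.subset_span ⟨idField H, .id, ?_⟩) fun A hA n v hv => ?_
    · rw [stateOf, ncoeff_idField, if_pos rfl]; rfl
    · induction hv using Submodule.span_induction with
      | mem v hv =>
        obtain ⟨B, hB, rfl⟩ := hv
        obtain ⟨p, hp⟩ := D.exists_isVertexField h₀ h₁ (.of A hA)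
        obtain ⟨q, hq⟩ := D.exists_isVertexField h₀ h₁ hB
        have hloc : ∃ ε, LocalTo ε A B := by
          rcases hA with hA | hA
          · exact ⟨0, (hq.local_even A hA).symm⟩
          · exact ⟨q, (hq.local_odd A hA).symm⟩
        obtain ⟨ε, N, hN⟩ := hloc
        exact Submodule.subset_span ⟨_, .nthProduct ε N n A B (.of A hA) hB hN,
          stateOf_nthProduct hp.vacuum hq.vacuum n⟩
      | zero => rw [map_zero]; exact W.zero_mem
      | add v w _ _ ihv ihw => rw [map_add]; exact W.add_mem ihv ihw
      | smul r v _ ih => rw [map_smul]; exact W.smul_mem r ih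
  have hv : v ∈ W := hW ▸ Submodule.mem_top
  induction hv using Submodule.span_induction with
  | mem v hv =>
    obtain ⟨A, hA, rfl⟩ := hv
    exact ⟨A, Submodule.subset_span hA, rfl⟩
  | zero => exact ⟨0, Submodule.zero_mem _, by rw [stateOf, ncoeff_zero]; rfl⟩
  | add v w _ _ ihv ihw =>
    obtain ⟨A, hA, rfl⟩ := ihv
    obtain ⟨B, hB, rfl⟩ := ihw
    exact ⟨A + B, Submodule.add_mem _ hA hB, stateOf_add _ _ _⟩
  | smul r v _ ih =>
    obtain ⟨A, hA, rfl⟩ := ih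
    exact ⟨r • A, Submodule.smul_mem _ r hA, stateOf_smul _ _ _⟩

theorem stateField_spec {gen : Set (VertexOperator ℂ H)} {Ω v : H}
    (h : ∃ A ∈ fieldSpace gen, stateOf Ω A = v) :
    stateField gen Ω v ∈ fieldSpace gen ∧ stateOf Ω (stateField gen Ω v) = v := by
  rw [stateField, dif_pos h]
  exact h.choose_spec

end Homogeneous

/-! ### The mode relations on H and cyclicity of the vacuum -/

section BosonModes

variable {ι : Type*} [Fintype ι] [DecidableEq ι] (Γ : ι → ι → ι → ℝ) (ℓ : ℕ)

theorem bosonCentral_mul (x : BosonAlgebra Γ) : bosonCentral Γ * x = x * bosonCentral Γ := by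
  obtain ⟨x, rfl⟩ := bosonProj_surjective Γ x
  induction x using FreeAlgebra.induction with
  | grade0 r => rw [AlgHom.commutes, Algebra.commutes]
  | grade1 x =>
    cases x with
    | central => rfl
    | X a n =>
      have := bosonProj_rel Γ (BosonRel.central (Γ := Γ) a n)
      rwa [map_mul, map_mul] at this
  | mul x y hx hy => rw [map_mul, ← mul_assoc, hx, mul_assoc, hy, mul_assoc]
  | add x y hx hy => rw [map_add, mul_add, hx, hy, add_mul]

theorem exists_smul_bosonVac (v : BosonRep Γ ℓ) :
    ∃ u : FreeAlgebra ℂ (BosonGen ι), v = bosonProj Γ u • bosonVac Γ ℓ := by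
  obtain ⟨v, rfl⟩ := (maxProper Γ ℓ).mkQ_surjective v
  obtain ⟨u, rfl⟩ := (vacuumIdeal Γ ℓ).mkQ_surjective v
  obtain ⟨u, rfl⟩ := bosonProj_surjective Γ u
  refine ⟨u, ?_⟩
  rw [bosonVac, vacuumModuleVec, ← map_smul, ← map_smul, smul_eq_mul, mul_one]

theorem smul_bosonVac_eq_zero {x : BosonAlgebra Γ} (hx : x ∈ vacuumIdeal Γ ℓ) :
    x • bosonVac Γ ℓ = 0 := by
  have h : (vacuumIdeal Γ ℓ).mkQ x = 0 := by
    rwa [Submodule.mkQ_apply, Submodule.Quotient.mk_eq_zero]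
  rw [bosonVac, vacuumModuleVec, ← map_smul, ← map_smul, smul_eq_mul, mul_one, h, map_zero]

theorem bosonMode_bosonVac (a : ι) {n : ℤ} (hn : 0 ≤ n) : bosonMode Γ ℓ a n (bosonVac Γ ℓ) = 0 :=
  smul_bosonVac_eq_zero Γ ℓ (Submodule.subset_span (Or.inl ⟨a, n, hn, rfl⟩))

theorem bosonCentral_smul (v : BosonRep Γ ℓ) : bosonCentral Γ • v = (ℓ : ℂ) • v := by
  obtain ⟨u, rfl⟩ := exists_smul_bosonVac Γ ℓ v
  have h := smul_bosonVac_eq_zero Γ ℓ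
    (x := bosonCentral Γ - algebraMap ℂ (BosonAlgebra Γ) (ℓ : ℂ)) (Submodule.subset_span (Or.inr rfl))
  rw [sub_smul, sub_eq_zero, algebraMap_smul] at h
  rw [smul_smul, bosonCentral_mul, mul_smul, h, smul_comm]

theorem bosonMode_mul (a b : ι) (m n : ℤ) :
    bosonMode Γ ℓ a m * bosonMode Γ ℓ b n = bosonMode Γ ℓ b n * bosonMode Γ ℓ a m +
      (∑ c, (Complex.I * (Γ a b c : ℂ)) • bosonMode Γ ℓ c (m + n) +
        (if a = b ∧ m + n = 0 then (m * ℓ : ℂ) else 0) • 1) := by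
  refine LinearMap.ext fun v => ?_
  have h := congrArg (· • v) (bosonX_comm Γ a b m n)
  simp only [add_smul, mul_smul, Finset.sum_smul, smul_assoc] at h
  simp only [Module.End.mul_apply, LinearMap.add_apply, LinearMap.sum_apply, LinearMap.smul_apply,
    Module.End.one_apply, bosonMode, Algebra.lsmul_coe]
  rw [h]
  congr 2
  · simp only [mul_smul]
  · split_ifs
    · rw [smul_assoc, bosonCentral_smul, mul_smul]
    · rw [zero_smul, zero_smul]

theorem fieldX_apply_fieldX (a b : ι) (m n : ℤ) (v : SuperSpace Γ ℓ) :
    ((fieldX Γ ℓ a)[[m]]) (((fieldX Γ ℓ b)[[n]]) v) =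
      ((fieldX Γ ℓ b)[[n]]) (((fieldX Γ ℓ a)[[m]]) v) +
      (∑ c, (Complex.I * (Γ a b c : ℂ)) • ((fieldX Γ ℓ c)[[m + n]]) v +
        (if a = b ∧ m + n = 0 then (m * ℓ : ℂ) else 0) • v) := by
  simp only [fieldX, ncoeff_mkField]
  have h := congrArg (LinearMap.rTensorHom (FermionFock ι)) (bosonMode_mul Γ ℓ a b m n)
  have h1 : LinearMap.rTensor (FermionFock ι) (1 : Module.End ℂ (BosonRep Γ ℓ)) = 1 :=
    LinearMap.rTensor_id _ _
  simp only [map_add, map_sum, map_smul, LinearMap.coe_rTensorHom, LinearMap.rTensor_mul, h1] at h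
  simpa only [LinearMap.sum_apply, LinearMap.add_apply, LinearMap.smul_apply,
    Module.End.mul_apply, Module.End.one_apply] using LinearMap.congr_fun h v

theorem fieldX_vac (a : ι) {n : ℤ} (hn : 0 ≤ n) : ((fieldX Γ ℓ a)[[n]]) (vac Γ ℓ) = 0 := by
  rw [fieldX, ncoeff_mkField, vac, LinearMap.rTensor_tmul, bosonMode_bosonVac Γ ℓ a hn,
    TensorProduct.zero_tmul]

omit [Fintype ι] in
theorem fermionMode_mul (a b : ι) (m n : ℤ) :
    fermionMode a m * fermionMode b n =
      (if a = b ∧ m + n + 1 = 0 then (1 : ℂ) else 0) • 1 - fermionMode b n * fermionMode a m := by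
  refine LinearMap.ext fun v => ?_
  have h := congrArg (· • v) (fermionPsi_anticomm a b m n)
  simp only [sub_smul, mul_smul] at h
  simp only [Module.End.mul_apply, LinearMap.sub_apply, LinearMap.smul_apply,
    Module.End.one_apply, fermionMode, Algebra.lsmul_coe]
  rw [h]
  congr 1
  split_ifs <;> simp

theorem fieldPsi_apply_fieldPsi (a b : ι) (m n : ℤ) (v : SuperSpace Γ ℓ) :
    ((fieldPsi Γ ℓ a)[[m]]) (((fieldPsi Γ ℓ b)[[n]]) v) =
      (if a = b ∧ m + n + 1 = 0 then (1 : ℂ) else 0) • v -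
      ((fieldPsi Γ ℓ b)[[n]]) (((fieldPsi Γ ℓ a)[[m]]) v) := by
  simp only [fieldPsi, ncoeff_mkField]
  have h := congrArg (LinearMap.lTensorHom (BosonRep Γ ℓ)) (fermionMode_mul a b m n)
  have h1 : LinearMap.lTensor (BosonRep Γ ℓ) (1 : Module.End ℂ (FermionFock ι)) = 1 :=
    LinearMap.lTensor_id _ _
  simp only [map_sub, map_smul, LinearMap.coe_lTensorHom, LinearMap.lTensor_mul, h1] at h
  simpa only [LinearMap.sub_apply, LinearMap.smul_apply,
    Module.End.mul_apply, Module.End.one_apply] using LinearMap.congr_fun h v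

theorem fieldX_apply_fieldPsi (a b : ι) (m n : ℤ) (v : SuperSpace Γ ℓ) :
    ((fieldX Γ ℓ a)[[m]]) (((fieldPsi Γ ℓ b)[[n]]) v) =
      ((fieldPsi Γ ℓ b)[[n]]) (((fieldX Γ ℓ a)[[m]]) v) := by
  simp only [fieldX, fieldPsi, ncoeff_mkField]
  rw [← LinearMap.comp_apply, ← LinearMap.comp_apply, LinearMap.rTensor_comp_lTensor,
    LinearMap.lTensor_comp_rTensor]

theorem fieldPsi_vac (a : ι) {n : ℤ} (hn : 0 ≤ n) : ((fieldPsi Γ ℓ a)[[n]]) (vac Γ ℓ) = 0 := by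
  have h : fermionMode a n (fermionVac ι) = 0 := by
    rw [fermionMode, Algebra.lsmul_coe, fermionVac]
    beta_reduce
    rw [← map_smul, smul_eq_mul, mul_one,
      Submodule.mkQ_apply, Submodule.Quotient.mk_eq_zero]
    exact Submodule.subset_span ⟨a, n, hn, rfl⟩
  rw [fieldPsi, ncoeff_mkField, vac, LinearMap.lTensor_tmul, h, TensorProduct.tmul_zero]

/-- `H` is generated from the vacuum by the modes of the generating fields. -/
theorem eq_top_of_vac_mem (W : Submodule ℂ (SuperSpace Γ ℓ)) (hvac : vac Γ ℓ ∈ W)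
    (hX : ∀ a n, ∀ v ∈ W, ((fieldX Γ ℓ a)[[n]]) v ∈ W)
    (hψ : ∀ a n, ∀ v ∈ W, ((fieldPsi Γ ℓ a)[[n]]) v ∈ W) : W = ⊤ := by
  have hF : ∀ (u : FreeAlgebra ℂ (ι × ℤ)) (x : BosonRep Γ ℓ) (y : FermionFock ι), x ⊗ₜ[ℂ] y ∈ W →
      x ⊗ₜ[ℂ] (fermionProj ι u • y) ∈ W := by
    intro u
    induction u using FreeAlgebra.induction with
    | grade0 r =>
      intro x y h
      rw [AlgHom.commutes, algebraMap_smul, TensorProduct.tmul_smul]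
      exact W.smul_mem r h
    | grade1 z =>
      intro x y h
      have := hψ z.1 z.2 _ h
      rwa [fieldPsi, ncoeff_mkField, LinearMap.lTensor_tmul] at this
    | mul u w hu hw =>
      intro x y h
      rw [map_mul, mul_smul]
      exact hu _ _ (hw _ _ h)
    | add u w hu hw =>
      intro x y h
      rw [map_add, add_smul, TensorProduct.tmul_add]
      exact W.add_mem (hu _ _ h) (hw _ _ h)
  have hB : ∀ (u : FreeAlgebra ℂ (BosonGen ι)) (x : BosonRep Γ ℓ) (y : FermionFock ι),
      x ⊗ₜ[ℂ] y ∈ W → (bosonProj Γ u • x) ⊗ₜ[ℂ] y ∈ W := by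
    intro u
    induction u using FreeAlgebra.induction with
    | grade0 r =>
      intro x y h
      rw [AlgHom.commutes, algebraMap_smul, ← TensorProduct.smul_tmul']
      exact W.smul_mem r h
    | grade1 z =>
      intro x y h
      cases z with
      | X a n =>
        have := hX a n _ h
        rwa [fieldX, ncoeff_mkField, LinearMap.rTensor_tmul] at this
      | central =>
        change (bosonCentral Γ • x) ⊗ₜ[ℂ] y ∈ W
        rw [bosonCentral_smul, ← TensorProduct.smul_tmul']
        exact W.smul_mem _ h
    | mul u w hu hw =>
      intro x y h
      rw [map_mul, mul_smul]
      exact hu _ _ (hw _ _ h)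
    | add u w hu hw =>
      intro x y h
      rw [map_add, add_smul, TensorProduct.add_tmul]
      exact W.add_mem (hu _ _ h) (hw _ _ h)
  rw [Submodule.eq_top_iff']
  intro t
  induction t using TensorProduct.induction_on with
  | zero => exact W.zero_mem
  | tmul x y =>
    obtain ⟨u, rfl⟩ := exists_smul_bosonVac Γ ℓ x
    obtain ⟨y, rfl⟩ := (fockIdeal ι).mkQ_surjective y
    obtain ⟨w, rfl⟩ := fermionProj_surjective ι y
    have h : (fockIdeal ι).mkQ (fermionProj ι w) = fermionProj ι w • fermionVac ι := by
      rw [fermionVac, ← map_smul, smul_eq_mul, mul_one]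
    rw [h]
    exact hB _ _ _ (hF _ _ _ hvac)
  | add x y hx hy => exact W.add_mem hx hy

end BosonModes

/-! ### The parity involution of the Fock space -/

section Parity

variable (ι : Type*) [DecidableEq ι]

/-- The automorphism `ψ ↦ -ψ` of the fermion algebra. -/
def fermionParity : FermionAlgebra ι →ₐ[ℂ] FermionAlgebra ι :=
  RingQuot.liftAlgHom ℂ (s := FermionRel ι)
    ⟨FreeAlgebra.lift ℂ fun x : ι × ℤ => -fermionPsi x.1 x.2, by
      rintro _ _ ⟨a, b, m, n⟩
      rw [map_add, map_mul, map_mul, FreeAlgebra.lift_ι_apply, FreeAlgebra.lift_ι_apply,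
        neg_mul_neg, neg_mul_neg, fermionPsi_anticomm, sub_add_cancel]
      split_ifs <;> simp⟩

theorem fermionParity_psi (a : ι) (n : ℤ) :
    fermionParity ι (fermionPsi a n) = -fermionPsi a n := by
  refine (RingQuot.liftAlgHom_mkAlgHom_apply ℂ _ _ _).trans ?_
  exact FreeAlgebra.lift_ι_apply _ _

/-- The induced involution of the Fock space. -/
def fockParity : Module.End ℂ (FermionFock ι) :=
  -- The automorphism is only semilinear over the fermion algebra, so it descends to the quotient
  -- semilinearly. It fixes the scalars, hence the induced map is ℂ-linear.
  let f : FermionAlgebra ι →ₛₗ[(fermionParity ι : FermionAlgebra ι →+* FermionAlgebra ι)]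
      FermionAlgebra ι :=
    { toFun := fermionParity ι
      map_add' := map_add _
      map_smul' := fun r x => map_mul _ r x }
  let g := Submodule.mapQ (fockIdeal ι) (fockIdeal ι) f (by
    rw [fockIdeal, Submodule.span_le]
    rintro _ ⟨a, n, hn, rfl⟩
    change fermionParity ι (fermionPsi a n) ∈ fockIdeal ι
    rw [fermionParity_psi]
    exact neg_mem (Submodule.subset_span ⟨a, n, hn, rfl⟩))
  { toFun := g
    map_add' := map_add g
    map_smul' := fun r y => by
      rw [← algebraMap_smul (FermionAlgebra ι) r y, map_smulₛₗ, RingHom.id_apply,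
        RingHom.coe_coe, AlgHom.commutes, algebraMap_smul] }

theorem fockParity_vac : fockParity ι (fermionVac ι) = fermionVac ι :=
  congrArg (fockIdeal ι).mkQ (map_one (fermionParity ι))

theorem fockParity_mode (a : ι) (n : ℤ) (y : FermionFock ι) :
    fockParity ι (fermionMode a n y) = -fermionMode a n (fockParity ι y) := by
  obtain ⟨y, rfl⟩ := (fockIdeal ι).mkQ_surjective y
  have h : fermionParity ι (fermionPsi a n * y) = -(fermionPsi a n * fermionParity ι y) := by
    rw [map_mul, fermionParity_psi, neg_mul]
  exact congrArg (fockIdeal ι).mkQ h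

end Parity

/-! ### Structure constants and the Casimir eigenvalue -/

section StructureConstants

variable {𝔤 ι : Type*} [LieRing 𝔤] [LieAlgebra ℂ 𝔤] [Fintype ι]
  (X : Module.Basis ι ℂ 𝔤) {Γ : ι → ι → ι → ℝ}
  (hX : ∀ a b, ⁅X a, X b⁆ = ∑ c, (Complex.I * (Γ a b c : ℂ)) • X c)
  (hΓ₁ : ∀ a b c, Γ a b c = -Γ b a c) (hΓ₂ : ∀ a b c, Γ a b c = -Γ a c b)

include hX in
theorem lie_lie_basis (a b c : ι) :
    ⁅X a, ⁅X b, X c⁆⁆ = ∑ f, (-∑ e, (Γ b c e * Γ a e f : ℂ)) • X f := by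
  simp only [hX, lie_sum, lie_smul, Finset.smul_sum, smul_smul, Finset.sum_smul,
    ← Finset.sum_neg_distrib]
  rw [Finset.sum_comm]
  refine Finset.sum_congr rfl fun f _ => Finset.sum_congr rfl fun e _ => ?_
  congr 1
  linear_combination ((Γ b c e * Γ a e f : ℂ)) * Complex.I_mul_I

include hX hΓ₁ in
/-- The Jacobi identity for the structure constants. -/
theorem jacobi_structureConstants (a b c f : ι) :
    ∑ e, Γ b c e * Γ a e f = ∑ e, Γ a b e * Γ e c f + ∑ e, Γ a c e * Γ b e f := by
  classical
  have h := leibniz_lie (X a) (X b) (X c)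
  rw [← lie_skew ⁅X a, X b⁆ (X c), lie_lie_basis X hX, lie_lie_basis X hX, lie_lie_basis X hX] at h
  have h' := congrArg (fun v => X.repr v f) h
  simp only [map_add, map_neg, map_sum, map_smul, Finsupp.add_apply, Finsupp.neg_apply,
    Finsupp.finsetSum_apply, Finsupp.smul_apply, Module.Basis.repr_self, smul_eq_mul,
    Finsupp.single_apply, mul_ite, mul_one, mul_zero, Finset.sum_ite_eq', Finset.mem_univ,
    if_true, neg_neg] at h'
  have h'' : -∑ e, Γ b c e * Γ a e f = ∑ e, Γ a b e * Γ c e f + -∑ e, Γ a c e * Γ b e f := by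
    exact_mod_cast h'
  have h3 : ∑ e, Γ a b e * Γ e c f = -∑ e, Γ a b e * Γ c e f := by
    rw [← Finset.sum_neg_distrib]
    exact Finset.sum_congr rfl fun e _ => by rw [hΓ₁ e c f]; ring
  rw [h3]
  linarith

/-- The Casimir operator `∑ (ad X_a)²`. -/
def casimir : Module.End ℂ 𝔤 := ∑ a, (LieAlgebra.ad ℂ 𝔤 (X a)) * (LieAlgebra.ad ℂ 𝔤 (X a))

theorem casimir_apply (v : 𝔤) : casimir X v = ∑ a, ⁅X a, ⁅X a, v⁆⁆ := by
  simp [casimir, LinearMap.sum_apply]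

include hX hΓ₂ in
theorem casimir_basis (b : ι) :
    casimir X (X b) = ∑ d, ((∑ a, ∑ c, Γ a c b * Γ a c d : ℝ) : ℂ) • X d := by
  rw [casimir_apply]
  simp only [lie_lie_basis X hX]
  rw [Finset.sum_comm]
  refine Finset.sum_congr rfl fun d _ => ?_
  rw [← Finset.sum_smul]
  congr 1
  push_cast
  refine Finset.sum_congr rfl fun a _ => ?_
  rw [← Finset.sum_neg_distrib]
  refine Finset.sum_congr rfl fun c _ => ?_
  rw [hΓ₂ a b c]
  push_cast
  ring

include hX hΓ₁ hΓ₂ in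
-- The commutator of the Casimir operator with ad X_b contracts iΓ_{ab}^c, antisymmetric in a and c,
-- with an expression symmetric in a and c.
theorem casimir_lie (y v : 𝔤) : casimir X ⁅y, v⁆ = ⁅y, casimir X v⁆ := by
  have key : ∀ b, casimir X ⁅X b, v⁆ = ⁅X b, casimir X v⁆ := by
    intro b
    rw [casimir_apply, casimir_apply, lie_sum, ← sub_eq_zero, ← Finset.sum_sub_distrib]
    have h : ∀ a, ⁅X a, ⁅X a, ⁅X b, v⁆⁆⁆ - ⁅X b, ⁅X a, ⁅X a, v⁆⁆⁆ =
        ∑ c, (Complex.I * (Γ a b c : ℂ)) • (⁅X a, ⁅X c, v⁆⁆ + ⁅X c, ⁅X a, v⁆⁆) := by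
      intro a
      have e : ⁅X a, ⁅X a, ⁅X b, v⁆⁆⁆ - ⁅X b, ⁅X a, ⁅X a, v⁆⁆⁆ =
          ⁅X a, ⁅⁅X a, X b⁆, v⁆⁆ + ⁅⁅X a, X b⁆, ⁅X a, v⁆⁆ := by
        rw [leibniz_lie (X a) (X b) v, lie_add, leibniz_lie (X a) (X b) ⁅X a, v⁆]
        abel
      rw [e, hX]
      simp only [sum_lie, smul_lie, lie_sum, lie_smul, smul_add, Finset.sum_add_distrib]
    simp only [h]
    have hneg : ∑ a, ∑ c, (Complex.I * (Γ a b c : ℂ)) • (⁅X a, ⁅X c, v⁆⁆ + ⁅X c, ⁅X a, v⁆⁆) =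
        -∑ a, ∑ c, (Complex.I * (Γ a b c : ℂ)) • (⁅X a, ⁅X c, v⁆⁆ + ⁅X c, ⁅X a, v⁆⁆) := by
      conv_lhs => rw [Finset.sum_comm]
      simp only [← Finset.sum_neg_distrib]
      refine Finset.sum_congr rfl fun a _ => Finset.sum_congr rfl fun c _ => ?_
      have : Γ c b a = -Γ a b c := by rw [hΓ₁ c b a, hΓ₂ b c a, hΓ₁ b a c, neg_neg]
      rw [this, add_comm ⁅X c, ⁅X a, v⁆⁆]
      push_cast
      module
    exact eq_zero_of_eq_neg hneg
  rw [← X.sum_repr y]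
  simp only [sum_lie, smul_lie, map_sum, map_smul, key]

include hX hΓ₁ hΓ₂ in
/-- By Schur's lemma the Casimir operator of a simple Lie algebra is a scalar. -/
theorem sum_mul_structureConstants [LieAlgebra.IsSimple ℂ 𝔤] [DecidableEq ι] (b d : ι) :
    ∑ a, ∑ c, Γ a c b * Γ a c d = if b = d then 2 * dualCoxeter Γ else 0 := by
  have : FiniteDimensional ℂ 𝔤 := Module.Finite.of_basis X
  have : Nontrivial 𝔤 := ⟨X b, 0, X.ne_zero b⟩
  obtain ⟨μ, hμ⟩ := Module.End.exists_eigenvalue (casimir X)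
  -- An eigenspace of an operator commuting with the adjoint action is an ideal, and simplicity
  -- makes a nonzero one everything.
  let I : LieIdeal ℂ 𝔤 := { Module.End.eigenspace (casimir X) μ with
    lie_mem := by
      intro y v hv
      have hv' : casimir X v = μ • v := Module.End.mem_eigenspace_iff.1 hv
      refine Module.End.mem_eigenspace_iff.2 ?_
      rw [casimir_lie X hX hΓ₁ hΓ₂, hv', lie_smul] }
  have hI : I = ⊤ := by
    refine (LieAlgebra.IsSimple.eq_bot_or_eq_top I).resolve_left fun h => ?_
    obtain ⟨v, hv, hv0⟩ := hμ.exists_hasEigenvector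
    have : v ∈ I := hv
    rw [h] at this
    exact hv0 ((LieSubmodule.mem_bot v).1 this)
  have hall : ∀ b d, ((∑ a, ∑ c, Γ a c b * Γ a c d : ℝ) : ℂ) = if b = d then μ else 0 := by
    intro b d
    have hb : X b ∈ I := hI ▸ LieSubmodule.mem_top _
    have hb' : casimir X (X b) = μ • X b := Module.End.mem_eigenspace_iff.1 hb
    rw [casimir_basis X hX hΓ₂] at hb'
    have h := congrArg (fun v => X.repr v d) hb'
    simpa [Finsupp.single_apply] using h
  have hr : ∀ b d, ∑ a, ∑ c, Γ a c b * Γ a c d = if b = d then μ.re else 0 := by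
    intro b d
    have := congrArg Complex.re (hall b d)
    rw [Complex.ofReal_re] at this
    rw [this]
    split_ifs <;> rfl
  have hcard : (Fintype.card ι : ℝ) ≠ 0 := by
    have : Nonempty ι := ⟨b⟩
    exact_mod_cast Fintype.card_ne_zero
  -- The trace identifies the eigenvalue: setting b = d and summing gives the sum of all squares of
  -- structure constants.
  have hg : 2 * dualCoxeter Γ = μ.re := by
    have hs : ∑ a, ∑ b, ∑ c, Γ a b c ^ 2 = Fintype.card ι * μ.re := by
      calc ∑ a, ∑ b, ∑ c, Γ a b c ^ 2 = ∑ c, ∑ a, ∑ b, Γ a b c * Γ a b c := by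
            simp only [pow_two]
            rw [Finset.sum_comm (s := Finset.univ (α := ι)) (t := Finset.univ (α := ι))
              (f := fun c a => ∑ b, Γ a b c * Γ a b c)]
            exact Finset.sum_congr rfl fun a _ => Finset.sum_comm
        _ = _ := by simp [hr]
    rw [dualCoxeter, hs]
    field_simp
  rw [hr, hg]

include hX in
-- A simple Lie algebra is not abelian, so some real structure constant is nonzero. This yields d >
-- 0, by which the Sugawara operator is divided.
theorem dualCoxeter_pos [LieAlgebra.IsSimple ℂ 𝔤] : 0 < dualCoxeter Γ := by
  have hne : ∃ a b c, Γ a b c ≠ 0 := by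
    by_contra! h
    refine LieAlgebra.IsSimple.non_abelian (R := ℂ) (L := 𝔤) ⟨fun x y => ?_⟩
    rw [← X.sum_repr x, ← X.sum_repr y]
    simp only [sum_lie, lie_sum, smul_lie, lie_smul, hX, h]
    simp
  obtain ⟨a, b, c, h⟩ := hne
  have : Nonempty ι := ⟨a⟩
  have hs : 0 < ∑ a, ∑ b, ∑ c, Γ a b c ^ 2 := by
    refine Finset.sum_pos' (fun _ _ => by positivity) ⟨a, Finset.mem_univ a, ?_⟩
    refine Finset.sum_pos' (fun _ _ => by positivity) ⟨b, Finset.mem_univ b, ?_⟩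
    exact Finset.sum_pos' (fun _ _ => by positivity) ⟨c, Finset.mem_univ c, by positivity⟩
  have : (0 : ℝ) < Fintype.card ι := by exact_mod_cast Fintype.card_pos
  rw [dualCoxeter]
  positivity

end StructureConstants

/-! ### Differences of shifted sums -/

section ShiftedSums

variable {M : Type*} [AddCommGroup M] [Module ℂ M]

/-- Only the boundary values φ(0), …, φ(k-1) survive, with a minus sign, and the reflection j ↦ k -
1 - j pairs them to the constant c. This boundary term is the source of the shift from ℓ to ℓ + g.
-/
theorem sum_shift_sub_of_nonneg (φ : ℤ → M) (c : M) (k : ℕ)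
    (hφ : ∀ j, φ j + φ (k - 1 - j) = c) {J : ℤ} (hJ : ∀ j, J ≤ j → φ j = 0) {K : ℕ}
    (hK : J ≤ K) :
    ∑ p ∈ Finset.range K, (φ (p + k) - φ p) = (-(k : ℂ) / 2) • c := by
  have h1 : ∑ p ∈ Finset.range K, φ ((p : ℤ) + k) =
      ∑ p ∈ Finset.range K, φ p - ∑ p ∈ Finset.range k, φ p := by
    have e1 := Finset.sum_range_add (fun p : ℕ => φ p) k K
    have e2 := Finset.sum_range_add (fun p : ℕ => φ p) K k
    rw [Finset.sum_eq_zero (s := Finset.range k) (f := fun x => φ ((K + x : ℕ) : ℤ))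
      (fun p _ => hJ _ (by push_cast; omega)), add_zero, add_comm K k, e1] at e2
    rw [eq_sub_iff_add_eq', ← e2]
    congr 1
    exact Finset.sum_congr rfl fun p _ => by push_cast; rw [add_comm]
  have h2 : (2 : ℂ) • ∑ p ∈ Finset.range k, φ p = (k : ℂ) • c := by
    rw [two_smul]
    nth_rewrite 2 [← Finset.sum_range_reflect]
    rw [← Finset.sum_add_distrib, Finset.sum_congr rfl (g := fun _ => c), Finset.sum_const,
      Finset.card_range, Nat.cast_smul_eq_nsmul]
    intro p hp
    have hp' : p < k := Finset.mem_range.1 hp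
    rw [← hφ p, show ((k - 1 - p : ℕ) : ℤ) = k - 1 - p by omega]
  rw [Finset.sum_sub_distrib, h1, neg_div, neg_smul, div_eq_inv_mul, mul_smul, ← h2]
  module

theorem sum_shift_sub (φ : ℤ → M) (c : M) (n : ℤ) (hφ : ∀ j, φ j + φ (n - 1 - j) = c) {J : ℤ}
    (hJ : ∀ j, J ≤ j → φ j = 0) {K : ℕ} (hK : J ≤ K) (hK' : J - n ≤ K) :
    ∑ p ∈ Finset.range K, (φ (p + n) - φ p) = (-(n : ℂ) / 2) • c := by
  rcases le_total 0 n with hn | hn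
  · lift n to ℕ using hn
    exact_mod_cast sum_shift_sub_of_nonneg φ c n hφ hJ hK
  · obtain ⟨k, rfl⟩ : ∃ k : ℕ, n = -k := ⟨(-n).toNat, by omega⟩
    have := sum_shift_sub_of_nonneg (fun j => φ (j - k)) c k (fun j => by
      rw [← hφ (j - k)]; congr 2; ring) (J := J + k) (fun j hj => hJ _ (by omega)) (K := K)
      (by omega)
    simp only [add_sub_cancel_right] at this
    have h' : ∑ p ∈ Finset.range K, (φ ((p : ℤ) + -k) - φ p) =
        -∑ p ∈ Finset.range K, (φ p - φ ((p : ℤ) - k)) := by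
      rw [← Finset.sum_neg_distrib]
      exact Finset.sum_congr rfl fun p _ => by rw [neg_sub, sub_eq_add_neg (p : ℤ)]
    rw [h', this]
    push_cast
    module

end ShiftedSums

/-! ### The translation operator -/

section Translation

variable {ι : Type*} [Fintype ι] [DecidableEq ι] (Γ : ι → ι → ι → ℝ) (ℓ : ℕ)

/-- The Sugawara operator `∑_a ∑_{p ≥ 0} X^a_{-1-p} X^a_p`, up to normalization. -/
def sugawara : Module.End ℂ (SuperSpace Γ ℓ) :=
  ∑ a, (nthProduct 0 (-1) (fieldX Γ ℓ a) (fieldX Γ ℓ a))[[0]]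

/-- The translation operator of the free fermions, up to normalization. -/
def fermionTranslation : Module.End ℂ (SuperSpace Γ ℓ) :=
  ∑ a, (nthProduct 1 (-2) (fieldPsi Γ ℓ a) (fieldPsi Γ ℓ a))[[0]]

/-- The translation operator of `H`. -/
def translation : Module.End ℂ (SuperSpace Γ ℓ) :=
  (1 / (2 * (level Γ ℓ : ℂ))) • sugawara Γ ℓ + (1 / 2 : ℂ) • fermionTranslation Γ ℓ

theorem translation_vac : translation Γ ℓ (vac Γ ℓ) = 0 := by
  have h1 : sugawara Γ ℓ (vac Γ ℓ) = 0 := by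
    rw [sugawara, LinearMap.sum_apply]
    exact Finset.sum_eq_zero fun a _ => nthProduct_apply_eq_zero
      (fun n hn => fieldX_vac Γ ℓ a hn) (fun n hn => fieldX_vac Γ ℓ a hn) _ le_rfl
  have h2 : fermionTranslation Γ ℓ (vac Γ ℓ) = 0 := by
    rw [fermionTranslation, LinearMap.sum_apply]
    exact Finset.sum_eq_zero fun a _ => nthProduct_apply_eq_zero
      (fun n hn => fieldPsi_vac Γ ℓ a hn) (fun n hn => fieldPsi_vac Γ ℓ a hn) _ le_rfl
  rw [translation, LinearMap.add_apply, LinearMap.smul_apply, LinearMap.smul_apply, h1, h2]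
  simp

theorem exists_uniform {κ : Type*} [Fintype κ] {P : κ → ℤ → Prop}
    (h : ∀ a, ∃ K₀, ∀ K, K₀ ≤ K → P a K) : ∃ K₀, ∀ a, ∀ K, K₀ ≤ K → P a K := by
  choose f hf using h
  refine ⟨∑ a, |f a|, fun a K hK => hf a K ?_⟩
  have h1 := Finset.single_le_sum (f := fun a => |f a|) (fun i _ => abs_nonneg _)
    (Finset.mem_univ a)
  have h2 := le_abs_self (f a)
  omega

/-- Both factors are the same field, so the two halves of each normally ordered product coincide;
this gives the factor 2. The cutoff K is left free so that several such sums can share it. -/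
theorem exists_sugawara_apply_eq_sum (v : SuperSpace Γ ℓ) : ∃ K₀ : ℤ, ∀ K : ℕ, K₀ ≤ K →
    sugawara Γ ℓ v = (2 : ℂ) • ∑ p ∈ Finset.range K,
      ∑ a, ((fieldX Γ ℓ a)[[-1 - (p : ℤ)]]) (((fieldX Γ ℓ a)[[(p : ℤ)]]) v) := by
  obtain ⟨K₀, hK₀⟩ := exists_uniform (P := fun (a : ι) (K : ℤ) => ∀ K' : ℕ, (K' : ℤ) = K →
      ((nthProduct 0 (-1) (fieldX Γ ℓ a) (fieldX Γ ℓ a))[[0]]) v = ∑ p ∈ Finset.range K',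
        nthProductTerm 0 (-1) (fieldX Γ ℓ a) (fieldX Γ ℓ a) 0 p v) (fun a => by
    obtain ⟨P, hP⟩ := exists_nthProduct_apply_eq_sum 0 (-1) (fieldX Γ ℓ a) (fieldX Γ ℓ a) 0 v
    exact ⟨P, fun K hK K' hK' => hP K' (by omega)⟩)
  refine ⟨K₀, fun K hK => ?_⟩
  rw [sugawara, LinearMap.sum_apply, Finset.sum_comm, Finset.smul_sum]
  refine Finset.sum_congr rfl fun a _ => ?_
  rw [hK₀ a K hK K rfl, Finset.smul_sum]
  refine Finset.sum_congr rfl fun p _ => ?_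
  rw [nthProductTerm, choose_neg_one, parSign_zero, one_smul, zero_add,
    show (0 : ℤ) + -1 - p = -1 - p by ring]
  simp only [LinearMap.sub_apply, LinearMap.smul_apply, Module.End.mul_apply]
  norm_num
  module

theorem exists_fermionTranslation_apply_eq_sum (v : SuperSpace Γ ℓ) : ∃ K₀ : ℤ, ∀ K : ℕ, K₀ ≤ K →
    fermionTranslation Γ ℓ v = (2 : ℂ) • ∑ p ∈ Finset.range K, ((p : ℂ) + 1) •
      ∑ a, ((fieldPsi Γ ℓ a)[[-2 - (p : ℤ)]]) (((fieldPsi Γ ℓ a)[[(p : ℤ)]]) v) := by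
  obtain ⟨K₀, hK₀⟩ := exists_uniform (P := fun (a : ι) (K : ℤ) => ∀ K' : ℕ, (K' : ℤ) = K →
      ((nthProduct 1 (-2) (fieldPsi Γ ℓ a) (fieldPsi Γ ℓ a))[[0]]) v = ∑ p ∈ Finset.range K',
        nthProductTerm 1 (-2) (fieldPsi Γ ℓ a) (fieldPsi Γ ℓ a) 0 p v) (fun a => by
    obtain ⟨P, hP⟩ := exists_nthProduct_apply_eq_sum 1 (-2) (fieldPsi Γ ℓ a) (fieldPsi Γ ℓ a) 0 v
    exact ⟨P, fun K hK K' hK' => hP K' (by omega)⟩)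
  refine ⟨K₀, fun K hK => ?_⟩
  simp only [Finset.smul_sum (s := Finset.univ (α := ι))]
  rw [fermionTranslation, LinearMap.sum_apply, Finset.sum_comm, Finset.smul_sum]
  refine Finset.sum_congr rfl fun a _ => ?_
  rw [hK₀ a K hK K rfl, Finset.smul_sum]
  refine Finset.sum_congr rfl fun p _ => ?_
  rw [nthProductTerm, choose_neg_two, parSign_one, zero_add,
    show (0 : ℤ) + -2 - p = -2 - p by ring]
  simp only [LinearMap.sub_apply, LinearMap.smul_apply, Module.End.mul_apply]
  norm_num
  module

theorem sugawara_fieldPsi (b : ι) (n : ℤ) (v : SuperSpace Γ ℓ) :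
    sugawara Γ ℓ (((fieldPsi Γ ℓ b)[[n]]) v) = ((fieldPsi Γ ℓ b)[[n]]) (sugawara Γ ℓ v) := by
  obtain ⟨K₁, h₁⟩ := exists_sugawara_apply_eq_sum Γ ℓ v
  obtain ⟨K₂, h₂⟩ := exists_sugawara_apply_eq_sum Γ ℓ (((fieldPsi Γ ℓ b)[[n]]) v)
  rw [h₁ (max K₁ K₂).toNat (by omega), h₂ (max K₁ K₂).toNat (by omega)]
  simp only [map_smul, map_sum, fieldX_apply_fieldPsi]

theorem fermionTranslation_fieldX (b : ι) (n : ℤ) (v : SuperSpace Γ ℓ) :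
    fermionTranslation Γ ℓ (((fieldX Γ ℓ b)[[n]]) v) =
      ((fieldX Γ ℓ b)[[n]]) (fermionTranslation Γ ℓ v) := by
  obtain ⟨K₁, h₁⟩ := exists_fermionTranslation_apply_eq_sum Γ ℓ v
  obtain ⟨K₂, h₂⟩ := exists_fermionTranslation_apply_eq_sum Γ ℓ (((fieldX Γ ℓ b)[[n]]) v)
  rw [h₁ (max K₁ K₂).toNat (by omega), h₂ (max K₁ K₂).toNat (by omega)]
  simp only [map_smul, map_sum, fieldX_apply_fieldPsi]

/-- Carrying ψ^b past two fermions restores the sign and leaves two delta terms. For n ≠ 0 exactly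
one p contributes, with weight p + 1 = |n|. -/
theorem fermionTranslation_fieldPsi (b : ι) (n : ℤ) (v : SuperSpace Γ ℓ) :
    fermionTranslation Γ ℓ (((fieldPsi Γ ℓ b)[[n]]) v) =
      ((fieldPsi Γ ℓ b)[[n]]) (fermionTranslation Γ ℓ v) +
      (-2 * (n : ℂ)) • ((fieldPsi Γ ℓ b)[[n - 1]]) v := by
  obtain ⟨K₁, h₁⟩ := exists_fermionTranslation_apply_eq_sum Γ ℓ v
  obtain ⟨K₂, h₂⟩ := exists_fermionTranslation_apply_eq_sum Γ ℓ (((fieldPsi Γ ℓ b)[[n]]) v)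
  obtain ⟨K, hK₁, hK₂, hK₃⟩ : ∃ K : ℕ, K₁ ≤ K ∧ K₂ ≤ K ∧ n.natAbs < K :=
    ⟨K₁.natAbs + K₂.natAbs + n.natAbs + 1, by omega, by omega, by omega⟩
  have hterm : ∀ p : ℕ, ((p : ℂ) + 1) • ∑ a, ((fieldPsi Γ ℓ a)[[-2 - (p : ℤ)]])
        (((fieldPsi Γ ℓ a)[[(p : ℤ)]]) (((fieldPsi Γ ℓ b)[[n]]) v)) =
      ((fieldPsi Γ ℓ b)[[n]]) (((p : ℂ) + 1) • ∑ a, ((fieldPsi Γ ℓ a)[[-2 - (p : ℤ)]])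
        (((fieldPsi Γ ℓ a)[[(p : ℤ)]]) v)) +
      ((if p = (-1 - n).toNat ∧ n ≤ -1 then (-(n : ℂ)) • ((fieldPsi Γ ℓ b)[[n - 1]]) v else 0) +
      (if p = (n - 1).toNat ∧ 1 ≤ n then (-(n : ℂ)) • ((fieldPsi Γ ℓ b)[[n - 1]]) v else 0)) := by
    intro p
    have h : ∀ a, ((fieldPsi Γ ℓ a)[[-2 - (p : ℤ)]])
        (((fieldPsi Γ ℓ a)[[(p : ℤ)]]) (((fieldPsi Γ ℓ b)[[n]]) v)) =
        ((fieldPsi Γ ℓ b)[[n]]) (((fieldPsi Γ ℓ a)[[-2 - (p : ℤ)]])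
          (((fieldPsi Γ ℓ a)[[(p : ℤ)]]) v)) +
        if a = b then
          ((if (p : ℤ) + n + 1 = 0 then (1 : ℂ) else 0) • ((fieldPsi Γ ℓ b)[[-2 - (p : ℤ)]]) v -
          (if -2 - (p : ℤ) + n + 1 = 0 then (1 : ℂ) else 0) • ((fieldPsi Γ ℓ b)[[(p : ℤ)]]) v)
        else 0 := by
      intro a
      rw [fieldPsi_apply_fieldPsi Γ ℓ a b p n, map_sub, map_smul,
        fieldPsi_apply_fieldPsi Γ ℓ a b (-2 - (p : ℤ)) n]
      by_cases hab : a = b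
      · subst hab
        simp only [true_and, if_true]
        abel
      · simp [hab]
    rw [Finset.sum_congr rfl fun a _ => h a, Finset.sum_add_distrib, Finset.sum_ite_eq',
      if_pos (Finset.mem_univ b), smul_add, map_smul, map_sum]
    congr 1
    by_cases h1 : (p : ℤ) + n + 1 = 0
    · rw [if_pos h1, if_neg (by omega), if_pos ⟨by omega, by omega⟩, if_neg (by omega)]
      have : (p : ℂ) + 1 = -n := by
        have : (p : ℤ) + 1 = -n := by omega
        exact_mod_cast this
      rw [this, show (-2 : ℤ) - p = n - 1 by omega]
      module
    · rw [if_neg h1, if_neg (show ¬(p = (-1 - n).toNat ∧ n ≤ -1) by omega)]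
      by_cases h2 : -2 - (p : ℤ) + n + 1 = 0
      · rw [if_pos h2, if_pos ⟨by omega, by omega⟩]
        have : (p : ℂ) + 1 = n := by
          have : (p : ℤ) + 1 = n := by omega
          exact_mod_cast this
        rw [this, show (p : ℤ) = n - 1 by omega]
        module
      · rw [if_neg h2, if_neg (by omega)]
        simp
  rw [h₁ K hK₁]
  refine (h₂ K hK₂).trans ?_
  rw [Finset.sum_congr rfl fun p _ => hterm p]
  simp only [Finset.sum_add_distrib]
  rw [sum_range_ite_and _ _ (by omega), sum_range_ite_and _ _ (by omega), map_smul, map_sum]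
  rcases lt_trichotomy n 0 with h | h | h
  · rw [if_pos (by omega), if_neg (by omega)]; module
  · subst h; simp
  · rw [if_neg (by omega), if_pos (by omega)]; module

variable {Γ}

/-- Commuting X^b_n through X^a_{-1-p} X^a_p produces central terms, which add up to -nℓ X^b_{n-1},
and bilinear terms φ(p+n) - φ(p), which telescope to -(n/2)·2g X^b_{n-1}. Doubling gives -2n(ℓ + g).
-/
theorem sugawara_fieldX (hΓ₁ : ∀ a b c, Γ a b c = -Γ b a c) (hΓ₂ : ∀ a b c, Γ a b c = -Γ a c b)
    (hC : ∀ b d, ∑ a, ∑ c, Γ a c b * Γ a c d = if b = d then 2 * dualCoxeter Γ else 0)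
    (b : ι) (n : ℤ) (v : SuperSpace Γ ℓ) :
    sugawara Γ ℓ (((fieldX Γ ℓ b)[[n]]) v) = ((fieldX Γ ℓ b)[[n]]) (sugawara Γ ℓ v) +
      (-2 * (level Γ ℓ : ℂ) * (n : ℂ)) • ((fieldX Γ ℓ b)[[n - 1]]) v := by
  let x : ι → ℤ → Module.End ℂ (SuperSpace Γ ℓ) := fun a n => (fieldX Γ ℓ a)[[n]]
  have hx : ∀ a b m n v, x a m (x b n v) = x b n (x a m v) +
      (∑ c, (Complex.I * (Γ a b c : ℂ)) • x c (m + n) v +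
        (if a = b ∧ m + n = 0 then (m * ℓ : ℂ) else 0) • v) := fieldX_apply_fieldX Γ ℓ
  let φ : ℤ → SuperSpace Γ ℓ := fun j =>
    ∑ a, ∑ c, (Complex.I * (Γ a b c : ℂ)) • x a (n - 1 - j) (x c j v)
  have hswap : ∀ f : ι → ι → SuperSpace Γ ℓ, ∑ a, ∑ c, (Complex.I * (Γ a b c : ℂ)) • f c a =
      -∑ a, ∑ c, (Complex.I * (Γ a b c : ℂ)) • f a c := by
    intro f
    rw [Finset.sum_comm]
    simp only [← Finset.sum_neg_distrib]
    refine Finset.sum_congr rfl fun a _ => Finset.sum_congr rfl fun c _ => ?_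
    have : Γ c b a = -Γ a b c := by rw [hΓ₁ c b a, hΓ₂ b c a, hΓ₁ b a c, neg_neg]
    rw [this]
    push_cast
    module
  -- Reflecting j and exchanging the factors changes the sign of the contraction, by antisymmetry of
  -- Γ. What remains are the commutators, which contract to the Casimir eigenvalue; the central
  -- terms drop out since Γ_{ab}^a = 0.
  have hφ : ∀ j, φ j + φ (n - 1 - j) = (2 * dualCoxeter Γ : ℂ) • x b (n - 1) v := by
    intro j
    have h1 : φ (n - 1 - j) = -φ j + ∑ a, ∑ c, (Complex.I * (Γ a b c : ℂ)) •
        ∑ e, (Complex.I * (Γ a c e : ℂ)) • x e (n - 1) v := by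
      rw [← hswap (fun a c => x a (n - 1 - j) (x c j v)), ← Finset.sum_add_distrib]
      refine Finset.sum_congr rfl fun a _ => ?_
      rw [← Finset.sum_add_distrib]
      refine Finset.sum_congr rfl fun c _ => ?_
      rw [sub_sub_cancel, hx a c, ← smul_add]
      by_cases hac : a = c
      · subst hac
        have : Γ a b a = 0 := by
          have h1 := hΓ₁ a b a
          have h2 := hΓ₂ b a a
          linarith
        simp [this]
      · simp [hac]
    rw [h1, add_neg_cancel_left]
    simp only [Finset.smul_sum, smul_smul]
    have h2 : ∀ e, ∑ a, ∑ c, ((Complex.I * (Γ a b c : ℂ)) * (Complex.I * (Γ a c e : ℂ))) =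
        if b = e then (2 * dualCoxeter Γ : ℂ) else 0 := by
      intro e
      have := congrArg (fun r : ℝ => (r : ℂ)) (hC b e)
      push_cast [apply_ite (fun r : ℝ => (r : ℂ))] at this
      rw [← this]
      refine Finset.sum_congr rfl fun a _ => Finset.sum_congr rfl fun c _ => ?_
      rw [hΓ₂ a b c]
      push_cast
      linear_combination (-(Γ a c b * Γ a c e : ℂ)) * Complex.I_mul_I
    calc _ = ∑ e, (∑ a, ∑ c, ((Complex.I * (Γ a b c : ℂ)) * (Complex.I * (Γ a c e : ℂ)))) •
          x e (n - 1) v := by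
          simp only [Finset.sum_smul]
          rw [Finset.sum_comm (s := Finset.univ (α := ι)) (t := Finset.univ (α := ι))
            (f := fun e a => ∑ c, ((Complex.I * (Γ a b c : ℂ)) * (Complex.I * (Γ a c e : ℂ))) •
              x e (n - 1) v)]
          exact Finset.sum_congr rfl fun a _ => Finset.sum_comm
      _ = _ := by simp [h2]
  obtain ⟨J, hJ⟩ := exists_uniform (P := fun (c : ι) (k : ℤ) => x c k v = 0)
    (fun c => exists_ncoeff_eq_zero (fieldX Γ ℓ c) v)
  have hφJ : ∀ j, J ≤ j → φ j = 0 := fun j hj =>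
    Finset.sum_eq_zero fun a _ => Finset.sum_eq_zero fun c _ => by
      rw [hJ c j hj, map_zero, smul_zero]
  obtain ⟨K₁, h₁⟩ := exists_sugawara_apply_eq_sum Γ ℓ v
  obtain ⟨K₂, h₂⟩ := exists_sugawara_apply_eq_sum Γ ℓ (x b n v)
  obtain ⟨K, hK₁, hK₂, hK₃, hK₄, hK₅⟩ : ∃ K : ℕ,
      K₁ ≤ K ∧ K₂ ≤ K ∧ n.natAbs < K ∧ J ≤ K ∧ J - n ≤ K :=
    ⟨K₁.natAbs + K₂.natAbs + n.natAbs + J.natAbs + 1, by omega, by omega, by omega, by omega, by omega⟩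
  -- Exactly one p carries a central term: p = -n from the right factor if n ≤ 0, and p = n - 1 from
  -- the left factor if n ≥ 1.
  have hterm : ∀ p : ℕ, ∑ a, x a (-1 - (p : ℤ)) (x a p (x b n v)) =
      x b n (∑ a, x a (-1 - (p : ℤ)) (x a p v)) + (φ (p + n) - φ p) +
      ((if p = (-n).toNat ∧ n ≤ 0 then (-(n : ℂ) * ℓ) • x b (n - 1) v else 0) +
      (if p = (n - 1).toNat ∧ 1 ≤ n then (-(n : ℂ) * ℓ) • x b (n - 1) v else 0)) := by
    intro p
    have h : ∀ a, x a (-1 - (p : ℤ)) (x a p (x b n v)) = x b n (x a (-1 - (p : ℤ)) (x a p v)) +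
        ((∑ c, (Complex.I * (Γ a b c : ℂ)) • x a (n - 1 - (p + n)) (x c (p + n) v)) +
        ∑ c, (Complex.I * (Γ a b c : ℂ)) • x c (n - 1 - p) (x a p v)) +
        ((if a = b then (if p = (-n).toNat ∧ n ≤ 0 then
          (-(n : ℂ) * ℓ) • x b (n - 1) v else 0) else 0) +
        (if a = b then (if p = (n - 1).toNat ∧ 1 ≤ n then
          (-(n : ℂ) * ℓ) • x b (n - 1) v else 0) else 0)) := by
      intro a
      rw [hx a b p n, map_add, map_add, map_smul, map_sum, hx a b (-1 - (p : ℤ)) n]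
      simp only [map_smul]
      rw [show n - 1 - ((p : ℤ) + n) = -1 - p by ring, show -1 - (p : ℤ) + n = n - 1 - p by ring]
      have e1 : (if a = b ∧ (p : ℤ) + n = 0 then ((p : ℤ) * ℓ : ℂ) else 0) • x a (-1 - (p : ℤ)) v =
          if a = b then (if p = (-n).toNat ∧ n ≤ 0 then
          (-(n : ℂ) * ℓ) • x b (n - 1) v else 0) else 0 := by
        by_cases hab : a = b
        · subst hab
          by_cases hp : (p : ℤ) + n = 0
          · rw [if_pos ⟨rfl, hp⟩, if_pos rfl, if_pos ⟨by omega, by omega⟩,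
              show (p : ℤ) = -n by omega, show -1 - -n = n - 1 by ring]
            push_cast; rfl
          · rw [if_neg (by tauto), if_pos rfl, if_neg (by omega), zero_smul]
        · rw [if_neg (by tauto), if_neg hab, zero_smul]
      have e2 : (if a = b ∧ n - 1 - (p : ℤ) = 0 then ((-1 - (p : ℤ) : ℤ) * ℓ : ℂ) else 0) •
          x a p v =
          if a = b then (if p = (n - 1).toNat ∧ 1 ≤ n then
          (-(n : ℂ) * ℓ) • x b (n - 1) v else 0) else 0 := by
        by_cases hab : a = b
        · subst hab
          by_cases hp : n - 1 - (p : ℤ) = 0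
          · rw [if_pos ⟨rfl, hp⟩, if_pos rfl, if_pos ⟨by omega, by omega⟩,
              show -1 - (p : ℤ) = -n by omega, show (p : ℤ) = n - 1 by omega]
            push_cast; rfl
          · rw [if_neg (by tauto), if_pos rfl, if_neg (by omega), zero_smul]
        · rw [if_neg (by tauto), if_neg hab, zero_smul]
      rw [e1, e2]
      abel
    rw [Finset.sum_congr rfl fun a _ => h a]
    simp only [Finset.sum_add_distrib, Finset.sum_ite_eq', Finset.mem_univ, if_true, map_sum]
    rw [hswap (fun c a => x c (n - 1 - p) (x a p v)), ← sub_eq_add_neg]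
  rw [h₁ K hK₁]
  refine (h₂ K hK₂).trans ?_
  rw [Finset.sum_congr rfl fun p _ => hterm p]
  simp only [Finset.sum_add_distrib (s := Finset.range K)]
  rw [sum_shift_sub φ _ n hφ hφJ hK₄ hK₅, sum_range_ite_and _ _ (by omega),
    sum_range_ite_and _ _ (by omega), map_smul, map_sum]
  have e3 : (if n ≤ 0 then (-(n : ℂ) * ℓ) • x b (n - 1) v else 0) +
      (if 1 ≤ n then (-(n : ℂ) * ℓ) • x b (n - 1) v else 0) = (-(n : ℂ) * ℓ) • x b (n - 1) v := by
    rcases le_or_gt n 0 with h | h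
    · rw [if_pos h, if_neg (by omega), add_zero]
    · rw [if_neg (by omega), if_pos (by omega), zero_add]
  rw [e3, level]
  push_cast
  simp only [x]
  module

theorem translation_fieldPsi (b : ι) (n : ℤ) (v : SuperSpace Γ ℓ) :
    translation Γ ℓ (((fieldPsi Γ ℓ b)[[n]]) v) = ((fieldPsi Γ ℓ b)[[n]]) (translation Γ ℓ v) +
      (-n : ℂ) • ((fieldPsi Γ ℓ b)[[n - 1]]) v := by
  simp only [translation, LinearMap.add_apply, LinearMap.smul_apply, sugawara_fieldPsi,
    fermionTranslation_fieldPsi, map_add, map_smul]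
  module

theorem translation_fieldX (hΓ₁ : ∀ a b c, Γ a b c = -Γ b a c)
    (hΓ₂ : ∀ a b c, Γ a b c = -Γ a c b)
    (hC : ∀ b d, ∑ a, ∑ c, Γ a c b * Γ a c d = if b = d then 2 * dualCoxeter Γ else 0)
    (hd : level Γ ℓ ≠ 0) (b : ι) (n : ℤ) (v : SuperSpace Γ ℓ) :
    translation Γ ℓ (((fieldX Γ ℓ b)[[n]]) v) = ((fieldX Γ ℓ b)[[n]]) (translation Γ ℓ v) +
      (-n : ℂ) • ((fieldX Γ ℓ b)[[n - 1]]) v := by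
  have hd' : (level Γ ℓ : ℂ) ≠ 0 := by exact_mod_cast hd
  simp only [translation, LinearMap.add_apply, LinearMap.smul_apply,
    sugawara_fieldX ℓ hΓ₁ hΓ₂ hC, fermionTranslation_fieldX, map_add, map_smul, smul_add, smul_smul]
  rw [show 1 / (2 * (level Γ ℓ : ℂ)) * (-2 * (level Γ ℓ : ℂ) * n) = -n by field_simp]
  abel

end Translation

/-! ### Locality and homogeneity of the generators -/

section SuperData

variable {ι : Type*} [Fintype ι] [DecidableEq ι] (Γ : ι → ι → ι → ℝ) (ℓ : ℕ)

/-- The parity involution of `H`. -/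
def superParity : Module.End ℂ (SuperSpace Γ ℓ) := (fockParity ι).lTensor (BosonRep Γ ℓ)

theorem superParity_fieldX (a : ι) (n : ℤ) (v : SuperSpace Γ ℓ) :
    superParity Γ ℓ (((fieldX Γ ℓ a)[[n]]) v) = ((fieldX Γ ℓ a)[[n]]) (superParity Γ ℓ v) := by
  simp only [superParity, fieldX, ncoeff_mkField]
  rw [← LinearMap.comp_apply, ← LinearMap.comp_apply, LinearMap.rTensor_comp_lTensor,
    LinearMap.lTensor_comp_rTensor]

theorem superParity_fieldPsi (a : ι) (n : ℤ) (v : SuperSpace Γ ℓ) :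
    superParity Γ ℓ (((fieldPsi Γ ℓ a)[[n]]) v) =
      -((fieldPsi Γ ℓ a)[[n]]) (superParity Γ ℓ v) := by
  simp only [superParity, fieldPsi, ncoeff_mkField]
  have h : fockParity ι ∘ₗ fermionMode a n = -(fermionMode a n ∘ₗ fockParity ι) :=
    LinearMap.ext fun y => fockParity_mode ι a n y
  rw [← LinearMap.comp_apply, ← LinearMap.comp_apply, ← LinearMap.lTensor_comp,
    ← LinearMap.lTensor_comp, h, LinearMap.lTensor_neg, LinearMap.neg_apply]

theorem superParity_vac : superParity Γ ℓ (vac Γ ℓ) = vac Γ ℓ := by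
  rw [superParity, vac, LinearMap.lTensor_tmul, fockParity_vac]

/-- The vacuum, translation operator, parity and generating fields of `H`. -/
def superData : VacuumData (SuperSpace Γ ℓ) where
  Ω := vac Γ ℓ
  T := translation Γ ℓ
  θ := superParity Γ ℓ
  even := Set.range (fieldX Γ ℓ)
  odd := Set.range (fieldPsi Γ ℓ)
  T_vac := translation_vac Γ ℓ
  θ_vac := superParity_vac Γ ℓ
  cyclic W hW h := eq_top_of_vac_mem Γ ℓ W hW (fun a => h _ (Or.inl ⟨a, rfl⟩))
    (fun a => h _ (Or.inr ⟨a, rfl⟩))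

/-- For fixed m + n the bracket is affine in m, so its second difference vanishes. -/
theorem localTo_fieldX_fieldX (a b : ι) : LocalTo 0 (fieldX Γ ℓ a) (fieldX Γ ℓ b) := by
  have h : ∀ m n, superBracket 0 ((fieldX Γ ℓ a)[[m]]) ((fieldX Γ ℓ b)[[n]]) =
      ∑ c, (Complex.I * (Γ a b c : ℂ)) • (fieldX Γ ℓ c)[[m + n]] +
        (if a = b ∧ m + n = 0 then (m * ℓ : ℂ) else 0) • 1 := by
    intro m n
    refine LinearMap.ext fun v => ?_
    have := fieldX_apply_fieldX Γ ℓ a b m n v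
    simp only [superBracket, parSign_zero, one_smul, LinearMap.sub_apply, Module.End.mul_apply,
      LinearMap.add_apply, LinearMap.sum_apply, LinearMap.smul_apply, Module.End.one_apply]
    rw [this, add_sub_cancel_left]
  refine ⟨2, fun m n => ?_⟩
  simp only [h, Finset.sum_range_succ, Finset.sum_range_zero, Nat.choose_zero_right,
    Nat.choose_self, Nat.choose_one_right, Nat.cast_zero, Nat.cast_one, Nat.cast_ofNat]
  rw [show m + (2 - 0) + (n + 0) = m + n + 2 by ring, show m + (2 - 1) + (n + 1) = m + n + 2 by ring,
    show m + (2 - 2) + (n + 2) = m + n + 2 by ring]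
  split_ifs <;> push_cast <;> module

theorem localTo_fieldPsi_fieldPsi (a b : ι) : LocalTo 1 (fieldPsi Γ ℓ a) (fieldPsi Γ ℓ b) := by
  have h : ∀ m n, superBracket 1 ((fieldPsi Γ ℓ a)[[m]]) ((fieldPsi Γ ℓ b)[[n]]) =
      (if a = b ∧ m + n + 1 = 0 then (1 : ℂ) else 0) • 1 := by
    intro m n
    refine LinearMap.ext fun v => ?_
    have := fieldPsi_apply_fieldPsi Γ ℓ a b m n v
    simp only [superBracket, parSign_one, LinearMap.sub_apply, Module.End.mul_apply,
      LinearMap.smul_apply, Module.End.one_apply]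
    rw [this]
    module
  refine ⟨1, fun m n => ?_⟩
  simp only [h, Finset.sum_range_succ, Finset.sum_range_zero, Nat.choose_zero_right,
    Nat.choose_self, Nat.cast_zero, Nat.cast_one]
  rw [show m + (1 - 0) + (n + 0) = m + n + 1 by ring, show m + (1 - 1) + (n + 1) = m + n + 1 by ring]
  module

theorem localTo_fieldX_fieldPsi (a b : ι) : LocalTo 0 (fieldX Γ ℓ a) (fieldPsi Γ ℓ b) := by
  refine ⟨0, fun m n => LinearMap.ext fun v => ?_⟩
  simp [superBracket, parSign_zero, fieldX_apply_fieldPsi]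

theorem isHomogeneous_fieldPsi (a : ι) :
    (superData Γ ℓ).IsHomogeneous 1 (fieldPsi Γ ℓ a) where
  local_even := by
    rintro _ ⟨b, rfl⟩
    exact (localTo_fieldX_fieldPsi Γ ℓ b a).symm
  local_odd := by
    rintro _ ⟨b, rfl⟩
    exact localTo_fieldPsi_fieldPsi Γ ℓ a b
  parity n v := by
    rw [parSign_one, neg_one_smul ℂ]
    exact superParity_fieldPsi Γ ℓ a n v
  vacuum n hn := fieldPsi_vac Γ ℓ a hn
  translation n v := translation_fieldPsi ℓ a n v

theorem fieldPsi_fieldPsi_fieldPsi_vac (a c d : ι) {n : ℤ} (hn : 0 ≤ n) :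
    ((fieldPsi Γ ℓ a)[[n]]) (((fieldPsi Γ ℓ c)[[-1]]) (((fieldPsi Γ ℓ d)[[-1]]) (vac Γ ℓ))) =
      (if n = 0 then (1 : ℂ) else 0) • ((if a = c then (1 : ℂ) else 0) •
        ((fieldPsi Γ ℓ d)[[-1]]) (vac Γ ℓ) -
        (if a = d then (1 : ℂ) else 0) • ((fieldPsi Γ ℓ c)[[-1]]) (vac Γ ℓ)) := by
  rw [fieldPsi_apply_fieldPsi Γ ℓ a c n, fieldPsi_apply_fieldPsi Γ ℓ a d n, fieldPsi_vac Γ ℓ a hn,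
    map_zero, sub_zero, map_smul]
  by_cases h0 : n = 0
  · subst h0
    simp
  · rw [if_neg h0, if_neg (by omega), if_neg (by omega)]
    simp

end SuperData

/-- The facts about the structure constants of a simple Lie algebra on which the construction
depends: antisymmetry, the Jacobi identity, and the eigenvalue of the Casimir operator. -/
structure IsSimpleStructure {ι : Type*} [Fintype ι] [DecidableEq ι] (Γ : ι → ι → ι → ℝ) :
    Prop where
  antisymm_left : ∀ a b c, Γ a b c = -Γ b a c
  antisymm_right : ∀ a b c, Γ a b c = -Γ a c b
  jacobi : ∀ a b c f,
    ∑ e, Γ b c e * Γ a e f = ∑ e, Γ a b e * Γ e c f + ∑ e, Γ a c e * Γ b e f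
  casimir : ∀ b d, ∑ a, ∑ c, Γ a c b * Γ a c d = if b = d then 2 * dualCoxeter Γ else 0
  dualCoxeter_pos : 0 < dualCoxeter Γ

/-! ### The state-field correspondence of H -/

namespace IsSimpleStructure

variable {ι : Type*} [Fintype ι] [DecidableEq ι] {Γ : ι → ι → ι → ℝ} (h : IsSimpleStructure Γ)
  (ℓ : ℕ)

include h

theorem level_pos : 0 < level Γ ℓ :=
  add_pos_of_nonneg_of_pos (Nat.cast_nonneg ℓ) h.dualCoxeter_pos

theorem cyclic (a b c : ι) : Γ a b c = Γ b c a := by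
  rw [h.antisymm_left a b c, h.antisymm_right b a c, neg_neg]

theorem isHomogeneous_fieldX (a : ι) :
    (superData Γ ℓ).IsHomogeneous 0 (fieldX Γ ℓ a) where
  local_even := by
    rintro _ ⟨b, rfl⟩
    exact localTo_fieldX_fieldX Γ ℓ a b
  local_odd := by
    rintro _ ⟨b, rfl⟩
    exact localTo_fieldX_fieldPsi Γ ℓ a b
  parity n v := by
    rw [parSign_zero, one_smul]
    exact superParity_fieldX Γ ℓ a n v
  vacuum n hn := fieldX_vac Γ ℓ a hn
  translation n v := translation_fieldX ℓ h.antisymm_left h.antisymm_right h.casimir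
    (h.level_pos ℓ).ne' a n v

theorem isHomogeneous_even : ∀ A ∈ (superData Γ ℓ).even, (superData Γ ℓ).IsHomogeneous 0 A := by
  rintro _ ⟨a, rfl⟩
  exact h.isHomogeneous_fieldX ℓ a

omit h in
theorem isHomogeneous_odd : ∀ A ∈ (superData Γ ℓ).odd, (superData Γ ℓ).IsHomogeneous 1 A := by
  rintro _ ⟨a, rfl⟩
  exact isHomogeneous_fieldPsi Γ ℓ a

theorem vertexV_spec (v : SuperSpace Γ ℓ) : vertexV Γ ℓ v ∈ fieldSpace (generators Γ ℓ) ∧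
    stateOf (vac Γ ℓ) (vertexV Γ ℓ v) = v :=
  stateField_spec ((superData Γ ℓ).exists_stateOf_eq (h.isHomogeneous_even ℓ)
    (isHomogeneous_odd ℓ) v)

theorem vertexV_stateOf {A : VertexOperator ℂ (SuperSpace Γ ℓ)}
    (hA : A ∈ fieldSpace (generators Γ ℓ)) : vertexV Γ ℓ (stateOf (vac Γ ℓ) A) = A :=
  (superData Γ ℓ).stateOf_injOn (h.isHomogeneous_even ℓ) (isHomogeneous_odd ℓ)
    (h.vertexV_spec ℓ _).1 hA (h.vertexV_spec ℓ _).2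

theorem isVertexField_vertexV {p : ZMod 2} {v : SuperSpace Γ ℓ}
    (hv : superParity Γ ℓ v = parSign p • v) :
    (superData Γ ℓ).IsVertexField p (vertexV Γ ℓ v) := by
  refine (superData Γ ℓ).isVertexField_of_parity (h.isHomogeneous_even ℓ) (isHomogeneous_odd ℓ)
    (h.vertexV_spec ℓ v).1 ?_
  have := (h.vertexV_spec ℓ v).2
  change superParity Γ ℓ (stateOf (vac Γ ℓ) (vertexV Γ ℓ v)) =
    parSign p • stateOf (vac Γ ℓ) (vertexV Γ ℓ v)
  rw [this, hv]

/-! ### The modes of `S` -/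

theorem stateOf_fieldS (c : ι) : ((fieldS Γ ℓ c)[[-1]]) (vac Γ ℓ) =
    (-(Complex.I / 2)) • ∑ a, ∑ b, (Γ a b c : ℂ) •
      ((fieldPsi Γ ℓ a)[[-1]]) (((fieldPsi Γ ℓ b)[[-1]]) (vac Γ ℓ)) :=
  (h.vertexV_spec ℓ _).2

theorem isVertexField_fieldS (c : ι) : (superData Γ ℓ).IsVertexField 0 (fieldS Γ ℓ c) := by
  refine h.isVertexField_vertexV ℓ ?_
  simp only [parSign_zero, one_smul, map_smul, map_sum, superParity_fieldPsi, superParity_vac,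
    map_neg, neg_neg]

theorem fieldS_vac (a : ι) {n : ℤ} (hn : 0 ≤ n) : ((fieldS Γ ℓ a)[[n]]) (vac Γ ℓ) = 0 :=
  (h.isVertexField_fieldS ℓ a).vacuum n hn

theorem fieldX_fieldS_vac (a b : ι) {n : ℤ} (hn : 0 ≤ n) :
    ((fieldX Γ ℓ a)[[n]]) (((fieldS Γ ℓ b)[[-1]]) (vac Γ ℓ)) = 0 := by
  rw [h.stateOf_fieldS]
  simp only [map_smul, map_sum, fieldX_apply_fieldPsi, fieldX_vac Γ ℓ a hn, map_zero, smul_zero,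
    Finset.sum_const_zero]

theorem fieldPsi_fieldS_vac (a b : ι) {n : ℤ} (hn : 0 ≤ n) :
    ((fieldPsi Γ ℓ a)[[n]]) (((fieldS Γ ℓ b)[[-1]]) (vac Γ ℓ)) = (if n = 0 then (1 : ℂ) else 0) •
      ∑ d, (-Complex.I * (Γ a d b : ℂ)) • ((fieldPsi Γ ℓ d)[[-1]]) (vac Γ ℓ) := by
  rw [h.stateOf_fieldS]
  simp only [map_smul, map_sum, fieldPsi_fieldPsi_fieldPsi_vac Γ ℓ a _ _ hn]
  by_cases h0 : n = 0
  · simp only [if_pos h0, one_smul, smul_sub, Finset.sum_sub_distrib, ite_smul, zero_smul,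
      smul_ite, smul_zero]
    rw [Finset.sum_comm]
    simp only [Finset.sum_ite_eq, Finset.mem_univ, if_true]
    rw [← smul_sub, ← Finset.sum_sub_distrib, Finset.smul_sum]
    refine Finset.sum_congr rfl fun d _ => ?_
    rw [h.antisymm_left d a b]
    push_cast
    module
  · simp only [if_neg h0, zero_smul, smul_zero, Finset.sum_const_zero]

/-- S^a acts on the fermions by the adjoint representation. No formula for the modes of S^a is
needed: the products of ψ^b with S^a are identified by their states, and the commutator formula does
the rest. -/
theorem fieldS_apply_fieldPsi (a b : ι) (m n : ℤ) (v : SuperSpace Γ ℓ) :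
    ((fieldS Γ ℓ a)[[n]]) (((fieldPsi Γ ℓ b)[[m]]) v) =
      ((fieldPsi Γ ℓ b)[[m]]) (((fieldS Γ ℓ a)[[n]]) v) +
      ∑ d, (Complex.I * (Γ a b d : ℂ)) • ((fieldPsi Γ ℓ d)[[m + n]]) v := by
  have hS := h.isVertexField_fieldS ℓ a
  have hψ := isHomogeneous_fieldPsi Γ ℓ b
  obtain ⟨N, hN⟩ : LocalTo 0 (fieldPsi Γ ℓ b) (fieldS Γ ℓ a) :=
    (hS.local_odd _ ⟨b, rfl⟩).symm
  have hprod : ∀ j : ℕ, nthProduct 0 (j : ℤ) (fieldPsi Γ ℓ b) (fieldS Γ ℓ a) =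
      (if (j : ℤ) = 0 then (1 : ℂ) else 0) •
        ∑ d, (-Complex.I * (Γ b d a : ℂ)) • fieldPsi Γ ℓ d := by
    intro j
    refine (hψ.nthProduct hS.toIsHomogeneous hN.localTo j).ext (VacuumData.IsHomogeneous.smul _
      (VacuumData.IsHomogeneous.sum _ _ fun d _ => (isHomogeneous_fieldPsi Γ ℓ d).smul _)) ?_
    rw [stateOf_nthProduct hψ.vacuum hS.vacuum]
    refine (h.fieldPsi_fieldS_vac ℓ b a (Nat.cast_nonneg j)).trans ?_
    rw [stateOf, ncoeff_smul, LinearMap.smul_apply, map_sum, Finset.sum_apply,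
      LinearMap.sum_apply]
    simp only [ncoeff_smul, LinearMap.smul_apply]
    rfl
  -- Raising the order by one ensures that the term j = 0 is present even if N = 0.
  have := LinearMap.congr_fun ((hN.mono (Nat.le_succ N)).superBracket_eq_sum m n) v
  rw [Finset.sum_range_succ', LinearMap.add_apply, hprod, LinearMap.sum_apply,
    Finset.sum_eq_zero, zero_add] at this
  · simp only [Nat.cast_zero, sub_zero, if_true, one_smul, map_sum, Finset.sum_apply,
      LinearMap.sum_apply, ncoeff_smul, LinearMap.smul_apply, Ring.choose_zero_right, Int.cast_one,
      superBracket, parSign_zero, LinearMap.sub_apply, Module.End.mul_apply] at this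
    rw [← sub_eq_iff_eq_add', ← neg_sub, this, ← Finset.sum_neg_distrib]
    refine Finset.sum_congr rfl fun d _ => ?_
    rw [h.cyclic a b d]
    module
  · intro j _
    rw [hprod, if_neg (by omega), zero_smul, ncoeff_zero]
    simp

theorem fieldS_apply_fieldX (a b : ι) (m n : ℤ) (v : SuperSpace Γ ℓ) :
    ((fieldS Γ ℓ a)[[n]]) (((fieldX Γ ℓ b)[[m]]) v) =
      ((fieldX Γ ℓ b)[[m]]) (((fieldS Γ ℓ a)[[n]]) v) := by
  have hS := h.isVertexField_fieldS ℓ a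
  have hX := h.isHomogeneous_fieldX ℓ b
  obtain ⟨N, hN⟩ : LocalTo 0 (fieldX Γ ℓ b) (fieldS Γ ℓ a) :=
    (hS.local_even _ ⟨b, rfl⟩).symm
  have := LinearMap.congr_fun (hN.superBracket_eq_sum m n) v
  rw [Finset.sum_eq_zero] at this
  · simp only [superBracket, parSign_zero, one_smul, LinearMap.sub_apply, Module.End.mul_apply,
      LinearMap.zero_apply] at this
    exact (sub_eq_zero.1 this).symm
  · intro j _
    have : nthProduct 0 (j : ℤ) (fieldX Γ ℓ b) (fieldS Γ ℓ a) = 0 := by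
      refine (hX.nthProduct hS.toIsHomogeneous hN.localTo j).eq_zero ?_
      rw [stateOf_nthProduct hX.vacuum hS.vacuum]
      exact h.fieldX_fieldS_vac ℓ b a (Nat.cast_nonneg j)
    rw [this, ncoeff_zero, smul_zero]

end IsSimpleStructure

/-! ### S as a current of level g -/

namespace IsSimpleStructure

variable {ι : Type*} [Fintype ι] [DecidableEq ι] {Γ : ι → ι → ι → ℝ} (h : IsSimpleStructure Γ)
  (ℓ : ℕ)

include h

theorem sum_sum_antisymm {M : Type*} [AddCommGroup M] [Module ℂ M] (a : ι) (f : ι → ι → M) :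
    ∑ b, ∑ c, (Complex.I * (Γ a b c : ℂ)) • f c b =
      -∑ b, ∑ c, (Complex.I * (Γ a b c : ℂ)) • f b c := by
  rw [Finset.sum_comm]
  simp only [← Finset.sum_neg_distrib]
  refine Finset.sum_congr rfl fun b _ => Finset.sum_congr rfl fun c _ => ?_
  rw [h.antisymm_right a c b]
  push_cast
  module

theorem fieldS_fieldPsi_fieldPsi_vac (a c d : ι) {n : ℤ} (hn : 0 ≤ n) :
    ((fieldS Γ ℓ a)[[n]]) (((fieldPsi Γ ℓ c)[[-1]]) (((fieldPsi Γ ℓ d)[[-1]]) (vac Γ ℓ))) =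
      ∑ e, (Complex.I * (Γ a d e : ℂ)) •
        ((fieldPsi Γ ℓ c)[[-1]]) (((fieldPsi Γ ℓ e)[[-1 + n]]) (vac Γ ℓ)) +
      ∑ e, (Complex.I * (Γ a c e : ℂ)) •
        ((fieldPsi Γ ℓ e)[[-1 + n]]) (((fieldPsi Γ ℓ d)[[-1]]) (vac Γ ℓ)) := by
  rw [h.fieldS_apply_fieldPsi, h.fieldS_apply_fieldPsi, h.fieldS_vac ℓ a hn]
  simp only [map_zero, zero_add, map_sum, map_smul]

/-- The action of `S^a_0` on the state of `S^b`. -/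
theorem fieldS_zero_fieldS_vac (a b : ι) :
    ((fieldS Γ ℓ a)[[0]]) (((fieldS Γ ℓ b)[[-1]]) (vac Γ ℓ)) =
      ∑ c, (Complex.I * (Γ a b c : ℂ)) • ((fieldS Γ ℓ c)[[-1]]) (vac Γ ℓ) := by
  let P : ι → ι → SuperSpace Γ ℓ := fun c d =>
    ((fieldPsi Γ ℓ c)[[-1]]) (((fieldPsi Γ ℓ d)[[-1]]) (vac Γ ℓ))
  have hS : ∀ b, ((fieldS Γ ℓ b)[[-1]]) (vac Γ ℓ) =
      (-(Complex.I / 2)) • ∑ c, ∑ d, (Γ c d b : ℂ) • P c d := h.stateOf_fieldS ℓ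
  have hP : ∀ c d, ((fieldS Γ ℓ a)[[0]]) (P c d) =
      ∑ e, (Complex.I * (Γ a d e : ℂ)) • P c e + ∑ e, (Complex.I * (Γ a c e : ℂ)) • P e d :=
    fun c d => h.fieldS_fieldPsi_fieldPsi_vac ℓ a c d le_rfl
  simp only [hS, map_smul, map_sum, hP, smul_add, Finset.sum_add_distrib]
  have e1 : ∑ c, ∑ d, (Γ c d b : ℂ) • ∑ e, (Complex.I * (Γ a d e : ℂ)) • P c e =
      ∑ e, ∑ f, (Complex.I * ∑ d, (Γ e d b : ℂ) * Γ a d f) • P e f := by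
    refine Finset.sum_congr rfl fun e _ => ?_
    simp only [Finset.smul_sum, smul_smul, Finset.mul_sum, Finset.sum_smul]
    rw [Finset.sum_comm]
    exact Finset.sum_congr rfl fun f _ => Finset.sum_congr rfl fun d _ => by congr 1; ring
  have e2 : ∑ c, ∑ d, (Γ c d b : ℂ) • ∑ e, (Complex.I * (Γ a c e : ℂ)) • P e d =
      ∑ e, ∑ f, (Complex.I * ∑ c, (Γ c f b : ℂ) * Γ a c e) • P e f := by
    rw [Finset.sum_comm]
    simp only [Finset.smul_sum, smul_smul, Finset.mul_sum, Finset.sum_smul]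
    conv_rhs => rw [Finset.sum_comm]
    refine Finset.sum_congr rfl fun f _ => ?_
    rw [Finset.sum_comm]
    exact Finset.sum_congr rfl fun e _ => Finset.sum_congr rfl fun c _ => by congr 1; ring
  have e3 : ∑ c, (Complex.I * (Γ a b c : ℂ)) • (-(Complex.I / 2)) • ∑ e, ∑ f, (Γ e f c : ℂ) • P e f
      = (-(Complex.I / 2)) • ∑ e, ∑ f, (Complex.I * ∑ c, (Γ a b c : ℂ) * Γ e f c) • P e f := by
    simp only [Finset.smul_sum, smul_smul, Finset.mul_sum, Finset.sum_smul]
    rw [Finset.sum_comm]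
    refine Finset.sum_congr rfl fun e _ => ?_
    rw [Finset.sum_comm]
    exact Finset.sum_congr rfl fun f _ => Finset.sum_congr rfl fun c _ => by congr 1; ring
  rw [e1, e2, e3, ← smul_add]
  congr 1
  rw [← Finset.sum_add_distrib]
  refine Finset.sum_congr rfl fun e _ => ?_
  rw [← Finset.sum_add_distrib]
  refine Finset.sum_congr rfl fun f _ => ?_
  rw [← add_smul, ← mul_add]
  congr 2
  -- Comparing the coefficients of ψ^e ψ^f leaves a quadratic identity in Γ, which is the Jacobi
  -- identity up to antisymmetry.
  have hJ := h.jacobi a e f b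
  have e4 : ∑ c, Γ a b c * Γ e f c = -∑ d, Γ e f d * Γ a d b := by
    rw [← Finset.sum_neg_distrib]
    exact Finset.sum_congr rfl fun c _ => by rw [h.antisymm_right a b c]; ring
  have e5 : ∑ d, Γ e d b * Γ a d f = -∑ d, Γ a f d * Γ e d b := by
    rw [← Finset.sum_neg_distrib]
    exact Finset.sum_congr rfl fun c _ => by rw [h.antisymm_right a c f]; ring
  have e6 : ∑ c, Γ c f b * Γ a c e = -∑ d, Γ a e d * Γ d f b := by
    rw [← Finset.sum_neg_distrib]
    exact Finset.sum_congr rfl fun c _ => by rw [h.antisymm_right a c e]; ring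
  have : ∑ d, Γ e d b * Γ a d f + ∑ c, Γ c f b * Γ a c e = ∑ c, Γ a b c * Γ e f c := by
    rw [e4, e5, e6, hJ]; ring
  exact_mod_cast this

/-- The action of `S^a_n` with `n > 0` on the state of `S^b`. -/
theorem fieldS_pos_fieldS_vac (a b : ι) {n : ℤ} (hn : 0 < n) :
    ((fieldS Γ ℓ a)[[n]]) (((fieldS Γ ℓ b)[[-1]]) (vac Γ ℓ)) =
      (if n = 1 ∧ a = b then (dualCoxeter Γ : ℂ) else 0) • vac Γ ℓ := by
  have hP : ∀ c d, ((fieldS Γ ℓ a)[[n]])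
      (((fieldPsi Γ ℓ c)[[-1]]) (((fieldPsi Γ ℓ d)[[-1]]) (vac Γ ℓ))) =
      (if n = 1 then Complex.I * (Γ a c d : ℂ) else 0) • vac Γ ℓ := by
    intro c d
    rw [h.fieldS_fieldPsi_fieldPsi_vac ℓ a c d hn.le]
    have e1 : ∀ e, ((fieldPsi Γ ℓ e)[[-1 + n]]) (vac Γ ℓ) = 0 := fun e =>
      fieldPsi_vac Γ ℓ e (by omega)
    simp only [e1, map_zero, smul_zero, Finset.sum_const_zero, zero_add,
      fieldPsi_apply_fieldPsi Γ ℓ _ d (-1 + n), sub_zero]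
    by_cases h1 : n = 1
    · subst h1
      simp
    · rw [if_neg h1, zero_smul]
      refine Finset.sum_eq_zero fun e _ => ?_
      rw [if_neg (by omega), zero_smul, smul_zero]
  rw [h.stateOf_fieldS]
  simp only [map_smul, map_sum, hP, smul_smul, ← Finset.sum_smul]
  congr 1
  by_cases h1 : n = 1
  · simp only [if_pos h1]
    have hC := congrArg (fun r : ℝ => (r : ℂ)) (h.casimir b a)
    push_cast [apply_ite (fun r : ℝ => (r : ℂ))] at hC
    -- For a = b the contraction is i·2g, and the prefactor -i/2 of S^b turns it into g.
    have e : ∑ c, ∑ d, (Γ c d b : ℂ) * (Complex.I * (Γ a c d : ℂ)) =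
        Complex.I * if b = a then 2 * (dualCoxeter Γ : ℂ) else 0 := by
      rw [← hC, Finset.mul_sum]
      refine Finset.sum_congr rfl fun c _ => ?_
      rw [Finset.mul_sum]
      refine Finset.sum_congr rfl fun d _ => ?_
      rw [h.cyclic a c d]
      ring
    rw [e, h1]
    by_cases hab : a = b
    · subst hab
      simp only [if_true, true_and]
      linear_combination (-(dualCoxeter Γ : ℂ)) * Complex.I_mul_I
    · rw [if_neg (fun h => hab h.symm), if_neg (fun h => hab h.2)]
      ring
  · simp [h1]

/-! ### The modes of `G` -/

omit h in
theorem tau_eq : tau Γ ℓ = (((Real.sqrt (level Γ ℓ))⁻¹ : ℝ) : ℂ) •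
    (∑ b, ((fieldPsi Γ ℓ b)[[-1]]) (((fieldX Γ ℓ b)[[-1]]) (vac Γ ℓ)) +
      (1 / 3 : ℂ) • ∑ b, ((fieldPsi Γ ℓ b)[[-1]]) (((fieldS Γ ℓ b)[[-1]]) (vac Γ ℓ))) := by
  simp only [tau, map_add, map_smul, Finset.sum_add_distrib, Finset.smul_sum]

theorem isVertexField_fieldG : (superData Γ ℓ).IsVertexField 1 (fieldG Γ ℓ) := by
  refine h.isVertexField_vertexV ℓ ?_
  have hS : ∀ b, superParity Γ ℓ (((fieldS Γ ℓ b)[[-1]]) (vac Γ ℓ)) =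
      ((fieldS Γ ℓ b)[[-1]]) (vac Γ ℓ) := by
    intro b
    have := (h.isVertexField_fieldS ℓ b).parity (-1) (vac Γ ℓ)
    rw [parSign_zero, one_smul] at this
    exact this.trans (congrArg _ (superParity_vac Γ ℓ))
  rw [tau_eq, parSign_one]
  simp only [map_smul, map_add, map_sum, superParity_fieldPsi, superParity_fieldX,
    superParity_vac, hS, Finset.sum_neg_distrib]
  module

theorem stateOf_fieldG : ((fieldG Γ ℓ)[[-1]]) (vac Γ ℓ) = tau Γ ℓ := (h.vertexV_spec ℓ _).2

theorem isVertexField_fieldB (a : ι) : (superData Γ ℓ).IsVertexField 0 (fieldB Γ ℓ a) :=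
  VacuumData.IsVertexField.add ⟨h.isHomogeneous_fieldX ℓ a, fun q B hB => by
    rw [zero_mul]; exact (hB.local_even _ ⟨a, rfl⟩).symm⟩ (h.isVertexField_fieldS ℓ a)

/-- The factor 1/3 in τ is chosen for this: contraction with the outer fermion of ψ^b S^b and with
each of the two inside S^b gives S^a every time. -/
theorem fieldPsi_tau (a : ι) {n : ℤ} (hn : 0 ≤ n) :
    ((fieldPsi Γ ℓ a)[[n]]) (tau Γ ℓ) = (if n = 0 then (1 : ℂ) else 0) •
      (((Real.sqrt (level Γ ℓ))⁻¹ : ℝ) : ℂ) • ((fieldB Γ ℓ a)[[-1]]) (vac Γ ℓ) := by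
  have hX : ((fieldPsi Γ ℓ a)[[n]])
      (∑ b, ((fieldPsi Γ ℓ b)[[-1]]) (((fieldX Γ ℓ b)[[-1]]) (vac Γ ℓ))) =
      (if n = 0 then (1 : ℂ) else 0) • ((fieldX Γ ℓ a)[[-1]]) (vac Γ ℓ) := by
    rw [map_sum, Finset.sum_eq_single a]
    · rw [fieldPsi_apply_fieldPsi, ← fieldX_apply_fieldPsi, fieldPsi_vac Γ ℓ a hn, map_zero,
        map_zero, sub_zero]
      simp
    · intro b _ hb
      rw [fieldPsi_apply_fieldPsi, ← fieldX_apply_fieldPsi, fieldPsi_vac Γ ℓ a hn, map_zero,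
        map_zero, sub_zero, if_neg (fun h => hb h.1.symm), zero_smul]
    · simp
  have hS : ((fieldPsi Γ ℓ a)[[n]])
      (∑ b, ((fieldPsi Γ ℓ b)[[-1]]) (((fieldS Γ ℓ b)[[-1]]) (vac Γ ℓ))) =
      (if n = 0 then (1 : ℂ) else 0) • (3 : ℂ) • ((fieldS Γ ℓ a)[[-1]]) (vac Γ ℓ) := by
    simp only [map_sum, fieldPsi_apply_fieldPsi Γ ℓ a _ n, h.fieldPsi_fieldS_vac ℓ a _ hn,
      Finset.sum_sub_distrib, map_smul]
    by_cases h0 : n = 0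
    · subst h0
      -- These are the two inner contractions. They enter with a minus sign, so that the total is 1
      -- - (-2) = 3.
      have e : ∑ b, ∑ d, (-Complex.I * (Γ a d b : ℂ)) •
          ((fieldPsi Γ ℓ b)[[-1]]) (((fieldPsi Γ ℓ d)[[-1]]) (vac Γ ℓ)) =
          (-2 : ℂ) • ((fieldS Γ ℓ a)[[-1]]) (vac Γ ℓ) := by
        rw [h.stateOf_fieldS, smul_smul, Finset.smul_sum]
        refine Finset.sum_congr rfl fun b _ => ?_
        rw [Finset.smul_sum]
        refine Finset.sum_congr rfl fun d _ => ?_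
        rw [h.antisymm_right a d b, h.cyclic a b d]
        push_cast
        module
      simp only [if_true, one_smul, e]
      simp
      module
    · have : ∀ x, ¬(a = x ∧ n + -1 + 1 = 0) := fun x h => h0 (by omega)
      simp [h0]
  rw [tau_eq, map_smul, map_add, map_smul, hX, hS, fieldB, ncoeff_add, LinearMap.add_apply]
  module

omit h in
theorem fieldX_sum_fieldPsi_fieldX_vac (a : ι) {n : ℤ} (hn : 0 ≤ n) :
    ((fieldX Γ ℓ a)[[n]])
      (∑ b, ((fieldPsi Γ ℓ b)[[-1]]) (((fieldX Γ ℓ b)[[-1]]) (vac Γ ℓ))) =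
      ∑ b, ∑ c, (Complex.I * (Γ a b c : ℂ)) •
        ((fieldPsi Γ ℓ b)[[-1]]) (((fieldX Γ ℓ c)[[-1 + n]]) (vac Γ ℓ)) +
      (if n = 1 then (ℓ : ℂ) else 0) • ((fieldPsi Γ ℓ a)[[-1]]) (vac Γ ℓ) := by
  have e : ∀ b, ((fieldX Γ ℓ a)[[n]])
      (((fieldPsi Γ ℓ b)[[-1]]) (((fieldX Γ ℓ b)[[-1]]) (vac Γ ℓ))) =
      ∑ c, (Complex.I * (Γ a b c : ℂ)) •
      ((fieldPsi Γ ℓ b)[[-1]]) (((fieldX Γ ℓ c)[[-1 + n]]) (vac Γ ℓ)) +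
      if a = b then (if n = 1 then (ℓ : ℂ) else 0) • ((fieldPsi Γ ℓ b)[[-1]]) (vac Γ ℓ)
        else 0 := by
    intro b
    rw [fieldX_apply_fieldPsi, fieldX_apply_fieldX, fieldX_vac Γ ℓ a hn, map_zero, zero_add,
      map_add, map_sum, map_smul, add_comm n (-1)]
    simp only [map_smul]
    congr 1
    by_cases hab : a = b
    · by_cases h1 : n = 1
      · subst h1; simp [hab]
      · rw [if_neg (by omega), if_neg h1, if_pos hab, zero_smul]
    · rw [if_neg (by tauto), if_neg hab, zero_smul]
  rw [map_sum, Finset.sum_congr rfl fun b _ => e b, Finset.sum_add_distrib, Finset.sum_ite_eq,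
    if_pos (Finset.mem_univ a)]

/-- The rotated fermion of index 1/2 contracts with a fermion inside S^b, and the two structure
constants combine to the Casimir eigenvalue. -/
theorem sum_fieldPsi_fieldS_vac (a : ι) {n : ℤ} (h0 : 0 < n) :
    ∑ b, ∑ c, (Complex.I * (Γ a b c : ℂ)) •
      ((fieldPsi Γ ℓ c)[[-1 + n]]) (((fieldS Γ ℓ b)[[-1]]) (vac Γ ℓ)) =
      (if n = 1 then (2 * dualCoxeter Γ : ℂ) else 0) •
        ((fieldPsi Γ ℓ a)[[-1]]) (vac Γ ℓ) := by
  simp only [h.fieldPsi_fieldS_vac ℓ _ _ (show 0 ≤ -1 + n by omega)]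
  by_cases h1 : n = 1
  · subst h1
    have hC : ∀ d, ∑ b, ∑ c, (Γ b c a : ℂ) * Γ b c d =
        if a = d then 2 * (dualCoxeter Γ : ℂ) else 0 := by
      intro d
      have hC := congrArg (fun r : ℝ => (r : ℂ)) (h.casimir a d)
      push_cast [apply_ite (fun r : ℝ => (r : ℂ))] at hC
      rw [← hC, Finset.sum_comm]
    calc _ = ∑ b, ∑ c, ∑ d, ((Γ b c a : ℂ) * Γ b c d) •
          ((fieldPsi Γ ℓ d)[[-1]]) (vac Γ ℓ) := by
          refine Finset.sum_congr rfl fun b _ => Finset.sum_congr rfl fun c _ => ?_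
          rw [if_pos (by norm_num), one_smul, Finset.smul_sum]
          refine Finset.sum_congr rfl fun d _ => ?_
          rw [smul_smul, h.cyclic a b c, h.cyclic b c d]
          congr 1
          linear_combination (-(Γ b c a : ℂ) * Γ c d b) * Complex.I_mul_I
      _ = ∑ d, (∑ b, ∑ c, ((Γ b c a : ℂ) * Γ b c d)) •
          ((fieldPsi Γ ℓ d)[[-1]]) (vac Γ ℓ) := by
          simp only [Finset.sum_smul]
          rw [Finset.sum_comm (s := Finset.univ (α := ι)) (t := Finset.univ (α := ι))
            (f := fun d b => ∑ c, ((Γ b c a : ℂ) * Γ b c d) •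
              ((fieldPsi Γ ℓ d)[[-1]]) (vac Γ ℓ))]
          exact Finset.sum_congr rfl fun b _ => Finset.sum_comm
      _ = _ := by simp [hC]
  · rw [if_neg h1, if_neg (by omega)]
    simp

theorem fieldB_tau (a : ι) {n : ℤ} (hn : 0 ≤ n) :
    ((fieldB Γ ℓ a)[[n]]) (tau Γ ℓ) = (if n = 1 then (1 : ℂ) else 0) •
      (Real.sqrt (level Γ ℓ) : ℂ) • ((fieldPsi Γ ℓ a)[[-1]]) (vac Γ ℓ) := by
  have hXS : ((fieldX Γ ℓ a)[[n]])
      (∑ b, ((fieldPsi Γ ℓ b)[[-1]]) (((fieldS Γ ℓ b)[[-1]]) (vac Γ ℓ))) = 0 := by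
    simp only [map_sum, fieldX_apply_fieldPsi, h.fieldX_fieldS_vac ℓ a _ hn, map_zero,
      Finset.sum_const_zero]
  have hSX : ((fieldS Γ ℓ a)[[n]])
      (∑ b, ((fieldPsi Γ ℓ b)[[-1]]) (((fieldX Γ ℓ b)[[-1]]) (vac Γ ℓ))) =
      ∑ b, ∑ c, (Complex.I * (Γ a b c : ℂ)) •
        ((fieldPsi Γ ℓ c)[[-1 + n]]) (((fieldX Γ ℓ b)[[-1]]) (vac Γ ℓ)) := by
    simp only [map_sum, h.fieldS_apply_fieldPsi, h.fieldS_apply_fieldX, h.fieldS_vac ℓ a hn,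
      map_zero, zero_add]
  have hSS : ((fieldS Γ ℓ a)[[n]])
      (∑ b, ((fieldPsi Γ ℓ b)[[-1]]) (((fieldS Γ ℓ b)[[-1]]) (vac Γ ℓ))) =
      ∑ b, ((fieldPsi Γ ℓ b)[[-1]])
        (((fieldS Γ ℓ a)[[n]]) (((fieldS Γ ℓ b)[[-1]]) (vac Γ ℓ))) +
      ∑ b, ∑ c, (Complex.I * (Γ a b c : ℂ)) •
        ((fieldPsi Γ ℓ c)[[-1 + n]]) (((fieldS Γ ℓ b)[[-1]]) (vac Γ ℓ)) := by
    simp only [map_sum, h.fieldS_apply_fieldPsi, Finset.sum_add_distrib]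
  have hB : ((fieldB Γ ℓ a)[[n]]) (tau Γ ℓ) = (((Real.sqrt (level Γ ℓ))⁻¹ : ℝ) : ℂ) •
      ((if n = 1 then (level Γ ℓ : ℂ) else 0) • ((fieldPsi Γ ℓ a)[[-1]]) (vac Γ ℓ)) := by
    rw [tau_eq, map_smul, map_add, map_smul, fieldB, ncoeff_add, LinearMap.add_apply,
      LinearMap.add_apply, fieldX_sum_fieldPsi_fieldX_vac ℓ a hn, hXS, hSX, hSS]
    congr 1
    -- For n = 0 the rotations of the two factors of each term cancel by antisymmetry of Γ. For n >
    -- 0 only n = 1 contributes, with ℓ + (g + 2g)/3 = d.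
    rcases hn.eq_or_lt with h0 | h0
    · subst h0
      simp only [h.fieldS_zero_fieldS_vac, add_zero, map_sum, map_smul]
      rw [h.sum_sum_antisymm a (fun b c =>
          ((fieldPsi Γ ℓ b)[[-1]]) (((fieldX Γ ℓ c)[[-1]]) (vac Γ ℓ))),
        h.sum_sum_antisymm a (fun b c =>
          ((fieldPsi Γ ℓ b)[[-1]]) (((fieldS Γ ℓ c)[[-1]]) (vac Γ ℓ)))]
      simp
    · have e1 : ∀ c, ((fieldX Γ ℓ c)[[-1 + n]]) (vac Γ ℓ) = 0 := fun c =>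
        fieldX_vac Γ ℓ c (by omega)
      have e2 : ∀ b c, ((fieldPsi Γ ℓ c)[[-1 + n]]) (((fieldX Γ ℓ b)[[-1]]) (vac Γ ℓ)) = 0 :=
        fun b c => by
          rw [← fieldX_apply_fieldPsi, fieldPsi_vac Γ ℓ c (by omega), map_zero]
      have e3 : ∑ b, ((fieldPsi Γ ℓ b)[[-1]])
          (((fieldS Γ ℓ a)[[n]]) (((fieldS Γ ℓ b)[[-1]]) (vac Γ ℓ))) =
          (if n = 1 then (dualCoxeter Γ : ℂ) else 0) •
            ((fieldPsi Γ ℓ a)[[-1]]) (vac Γ ℓ) := by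
        simp only [h.fieldS_pos_fieldS_vac ℓ a _ h0, map_smul]
        rw [Finset.sum_eq_single a]
        · simp
        · intro b _ hb
          rw [if_neg (fun h => hb h.2.symm), zero_smul]
        · simp
      rw [e3, h.sum_fieldPsi_fieldS_vac ℓ a h0]
      simp only [e1, e2, map_zero, smul_zero, Finset.sum_const_zero, level]
      split_ifs
      · push_cast; module
      · module
  rw [hB]
  by_cases h1 : n = 1
  · have hs : ((Real.sqrt (level Γ ℓ))⁻¹ : ℝ) * level Γ ℓ = Real.sqrt (level Γ ℓ) := by
      rw [inv_mul_eq_div, Real.div_sqrt]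
    rw [if_pos h1, if_pos h1, one_smul, smul_smul]
    congr 1
    exact_mod_cast hs
  · simp [h1]

/-- Each product is homogeneous of the same parity as its claimed value, so the two need only be
compared on the vacuum, where `fieldB_tau` applies. -/
theorem hasOPE_fieldB_fieldG (a : ι) : HasOPE 0 (fieldB Γ ℓ a) (fieldG Γ ℓ)
    (Pi.single 1 ((Real.sqrt (level Γ ℓ) : ℂ) • fieldPsi Γ ℓ a)) := by
  have hB := (h.isVertexField_fieldB ℓ a)
  have hG := (h.isVertexField_fieldG ℓ).toIsHomogeneous
  obtain ⟨N, hN⟩ : LocalTo 0 (fieldB Γ ℓ a) (fieldG Γ ℓ) := by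
    simpa using hB.localTo 1 _ hG
  -- The order is raised so that every index from it on differs from 1.
  refine ⟨⟨N + 2, hN.mono (by omega), fun n hn => Pi.single_eq_of_ne (by omega) _⟩, fun n => ?_⟩
  have hψ := isHomogeneous_fieldPsi Γ ℓ a
  have e : (Pi.single 1 ((Real.sqrt (level Γ ℓ) : ℂ) • fieldPsi Γ ℓ a) :
      ℕ → VertexOperator ℂ (SuperSpace Γ ℓ)) n =
      (if (n : ℤ) = 1 then (1 : ℂ) else 0) • (Real.sqrt (level Γ ℓ) : ℂ) • fieldPsi Γ ℓ a := by
    by_cases h1 : n = 1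
    · subst h1; simp
    · rw [Pi.single_eq_of_ne h1, if_neg (by omega), zero_smul]
  rw [e]
  refine (hB.toIsHomogeneous.nthProduct hG hN.localTo n).ext (p := 0 + 1) ?_ ?_
  · rw [zero_add]
    exact (hψ.smul _).smul _
  · rw [stateOf_nthProduct hB.vacuum hG.vacuum]
    refine (congrArg _ (h.stateOf_fieldG ℓ)).trans
      ((h.fieldB_tau ℓ a (Nat.cast_nonneg n)).trans ?_)
    rw [stateOf, ncoeff_smul, ncoeff_smul]
    rfl

theorem hasOPE_fieldPsi_fieldG (a : ι) : HasOPE 1 (fieldPsi Γ ℓ a) (fieldG Γ ℓ)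
    (Pi.single 0 ((((Real.sqrt (level Γ ℓ))⁻¹ : ℝ) : ℂ) • fieldB Γ ℓ a)) := by
  have hψ := isHomogeneous_fieldPsi Γ ℓ a
  have hG := (h.isVertexField_fieldG ℓ).toIsHomogeneous
  obtain ⟨N, hN⟩ : LocalTo 1 (fieldPsi Γ ℓ a) (fieldG Γ ℓ) := (hG.local_odd _ ⟨a, rfl⟩).symm
  refine ⟨⟨N + 1, hN.mono (by omega), fun n hn => Pi.single_eq_of_ne (by omega) _⟩, fun n => ?_⟩
  have hB := (h.isVertexField_fieldB ℓ a).toIsHomogeneous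
  have e : (Pi.single 0 ((((Real.sqrt (level Γ ℓ))⁻¹ : ℝ) : ℂ) • fieldB Γ ℓ a) :
      ℕ → VertexOperator ℂ (SuperSpace Γ ℓ)) n =
      (if (n : ℤ) = 0 then (1 : ℂ) else 0) •
        (((Real.sqrt (level Γ ℓ))⁻¹ : ℝ) : ℂ) • fieldB Γ ℓ a := by
    by_cases h1 : n = 0
    · subst h1; simp
    · rw [Pi.single_eq_of_ne h1, if_neg (by omega), zero_smul]
  rw [e]
  refine (hψ.nthProduct hG hN.localTo n).ext (p := 1 + 1) ?_ ?_
  · rw [show (1 + 1 : ZMod 2) = 0 from rfl]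
    exact (hB.smul _).smul _
  · rw [stateOf_nthProduct hψ.vacuum hG.vacuum]
    refine (congrArg _ (h.stateOf_fieldG ℓ)).trans
      ((h.fieldPsi_tau ℓ a (Nat.cast_nonneg n)).trans ?_)
    rw [stateOf, ncoeff_smul, ncoeff_smul]
    rfl

/-- With B^a in first place only j = 1 contributes, with binomial coefficient n; exchanging the
operators gives the minus sign. The index is n + (k + 1) - 1, as G_{k+1/2} is the coefficient
G(k+1). -/
theorem superBracket_modeG_modeB (a : ι) (k n : ℤ) :
    superBracket 0 (modeG Γ ℓ k) (modeB Γ ℓ a n) =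
      (-(n : ℂ) * (Real.sqrt (level Γ ℓ) : ℂ)) • modePsi Γ ℓ a (k + n) := by
  obtain ⟨⟨N, hN, hN'⟩, hOPE⟩ := h.hasOPE_fieldB_fieldG ℓ a
  have hN2 := hN.mono (Nat.le_add_right N 2)
  rw [modeG, modeB, modePsi, superBracket_swap, hN2.superBracket_eq_sum,
    Finset.sum_eq_single_of_mem 1 (Finset.mem_range.2 (by omega))]
  · rw [hOPE, Pi.single_eq_same, ncoeff_smul, Nat.cast_one, Ring.choose_one_right, parSign_zero,
      smul_smul, smul_smul, show n + (k + 1) - 1 = k + n by ring]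
    congr 1
    ring
  · intro j _ hj
    rw [hOPE, Pi.single_eq_of_ne hj, ncoeff_zero, smul_zero]

/-- Here only j = 0 contributes, and the anticommutator is symmetric. The index k + n + 1 is r + s
for r = k + 1/2 and s = n + 1/2. -/
theorem superBracket_modeG_modePsi (a : ι) (k n : ℤ) :
    superBracket 1 (modeG Γ ℓ k) (modePsi Γ ℓ a n) =
      (((Real.sqrt (level Γ ℓ))⁻¹ : ℝ) : ℂ) • modeB Γ ℓ a (k + n + 1) := by
  obtain ⟨⟨N, hN, hN'⟩, hOPE⟩ := h.hasOPE_fieldPsi_fieldG ℓ a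
  have hN2 := hN.mono (Nat.le_add_right N 1)
  rw [modeG, modeB, modePsi, superBracket_swap, hN2.superBracket_eq_sum,
    Finset.sum_eq_single_of_mem 0 (Finset.mem_range.2 (by omega))]
  · rw [hOPE, Pi.single_eq_same, ncoeff_smul, Nat.cast_zero, Ring.choose_zero_right, parSign_one,
      smul_smul, smul_smul, show n + (k + 1) - 0 = k + n + 1 by ring]
    congr 1
    push_cast
    ring
  · intro j _ hj
    rw [hOPE, Pi.single_eq_of_ne hj, ncoeff_zero, smul_zero]

end IsSimpleStructure

end SuperVertex

end

theorem mainTheorem3 {𝔤 ι : Type*} [LieRing 𝔤] [LieAlgebra ℂ 𝔤] [LieAlgebra.IsSimple ℂ 𝔤]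
    [Fintype ι] [DecidableEq ι] (X : Module.Basis ι ℂ 𝔤) (Γ : ι → ι → ι → ℝ)
    (hX : ∀ a b, ⁅X a, X b⁆ = ∑ c, (Complex.I * (Γ a b c : ℂ)) • X c)
    (hΓ₁ : ∀ a b c, Γ a b c = -Γ b a c) (hΓ₂ : ∀ a b c, Γ a b c = -Γ a c b) (ℓ : ℕ) :
    (∀ v, vertexV Γ ℓ v ∈ fieldSpace (generators Γ ℓ) ∧ stateOf (vac Γ ℓ) (vertexV Γ ℓ v) = v) ∧
    (∀ A ∈ fieldSpace (generators Γ ℓ), vertexV Γ ℓ (stateOf (vac Γ ℓ) A) = A) ∧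
    (∀ a, HasOPE 0 (fieldB Γ ℓ a) (fieldG Γ ℓ)
      (Pi.single 1 ((Real.sqrt (level Γ ℓ) : ℂ) • fieldPsi Γ ℓ a))) ∧
    (∀ a, HasOPE 1 (fieldPsi Γ ℓ a) (fieldG Γ ℓ)
      (Pi.single 0 ((((Real.sqrt (level Γ ℓ))⁻¹ : ℝ) : ℂ) • fieldB Γ ℓ a))) ∧
    (∀ (a : ι) (k n : ℤ), superBracket 0 (modeG Γ ℓ k) (modeB Γ ℓ a n) =
      (-(n : ℂ) * (Real.sqrt (level Γ ℓ) : ℂ)) • modePsi Γ ℓ a (k + n)) ∧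
    (∀ (a : ι) (k n : ℤ), superBracket 1 (modeG Γ ℓ k) (modePsi Γ ℓ a n) =
      (((Real.sqrt (level Γ ℓ))⁻¹ : ℝ) : ℂ) • modeB Γ ℓ a (k + n + 1)) := by
  -- The Lie algebra enters only through these properties of Γ.
  have h : IsSimpleStructure Γ :=
    { antisymm_left := hΓ₁
      antisymm_right := hΓ₂
      jacobi := jacobi_structureConstants X hX hΓ₁
      casimir := sum_mul_structureConstants X hX hΓ₁ hΓ₂
      dualCoxeter_pos := dualCoxeter_pos X hX }
  exact ⟨h.vertexV_spec ℓ, fun A hA => h.vertexV_stateOf ℓ hA, h.hasOPE_fieldB_fieldG ℓ,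
    h.hasOPE_fieldPsi_fieldG ℓ, h.superBracket_modeG_modeB ℓ, h.superBracket_modeG_modePsi ℓ⟩
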